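/- Let $\mathcal G$ be a locally compact, not necessarily Hausdorff, étale groupoid: a groupoid with a locally compact topology such that the groupoid operations are continuous, the unit space $\mathcal G^{(0)}$ is locally compact Hausdorff in the relative topology, and the range and source maps $r,s\colon\mathcal G\to\mathcal G^{(0)}$ are local homeomorphisms. For an open set $U\subset\mathcal G$ let $C_c(U)$ be the linear span, in the space of all functions $\mathcal G\to\mathbb C$, of the functions that are continuous with compact support on some open Hausdorff subset $V\subset U$ and zero off $V$. Then $C_c(\mathcal G)$ is a $*$-algebra under $$(f_1*f_2)(g)=\sum_{r(h)=r(g)}f_1(h)f_2(h^{-1}g),\qquad f^*(g)=\overline{f(g^{-1})},$$ and $C^*(\mathcal G)$ denotes its C$^*$-enveloping algebra. Extension by zero of functions in $C_c(\mathcal G^{(0)})$ induces the embedding $C_0(\mathcal G^{(0)})\subset C^*(\mathcal G)$. Let $X\subset\mathcal G^{(0)}$ be a closed invariant subset (that is, $r(g)\in X$ if and only if $s(g)\in X$, for all $g\in\mathcal G$), and let $\mathcal G_X=r^{-1}(X)=s^{-1}(X)$. Identify $C_0(\mathcal G^{(0)}\setminus X)$ with the set of functions in $C_0(\mathcal G^{(0)})$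 vanishing on $X$. Then the following three subsets of $C^*(\mathcal G)$ coincide: 1. the kernel of the $*$-homomorphism $C^*(\mathcal G)\to C^*(\mathcal G_X)$ extending the restriction $C_c(\mathcal G)\ni f\mapsto f|_{\mathcal G_X}\in C_c(\mathcal G_X)$; 2. the closure of (the image of) $C_c(\mathcal G\setminus\mathcal G_X)$ in $C^*(\mathcal G)$; 3. the closed two-sided ideal of $C^*(\mathcal G)$ generated by $C_0(\mathcal G^{(0)}\setminus X)$. Moreover, the sequence $$0\to C^*(\mathcal G\setminus\mathcal G_X)\to C^*(\mathcal G)\to C^*(\mathcal G_X)\to0$$ is exact, where the first map extends the inclusion $C_c(\mathcal G\setminus\mathcal G_X)\subset C_c(\mathcal G)$ given by extension by zero and the second map is the one in (1). -/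

import Mathlib

noncomputable section

/-! ### C*-seminorms, Hausdorff completions and enveloping C*-algebras of *-algebras -/

section Enveloping

set_option linter.unusedSectionVars false

variable {A : Type*} [NonUnitalRing A] [Module ℂ A] [IsScalarTower ℂ A A] [SMulCommClass ℂ A A]
  [StarRing A] [StarModule ℂ A]

/-- A C*-seminorm on a complex *-algebra: a submultiplicative seminorm satisfying the C*-identity.
Equivalently, a seminorm of the form `a ↦ ‖π a‖` for a *-homomorphism `π` into a C*-algebra. -/
structure CStarSeminorm (A : Type*) [NonUnitalRing A] [Module ℂ A] [StarRing A]
    extends Seminorm ℂ A where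
  mul_le' : ∀ a b : A, toFun (a * b) ≤ toFun a * toFun b
  star_mul_self' : ∀ a : A, toFun (star a * a) = toFun a ^ 2

namespace CStarSeminorm

instance (A : Type*) [NonUnitalRing A] [Module ℂ A] [StarRing A] :
    CoeFun (CStarSeminorm A) (fun _ => A → ℝ) := ⟨fun p => p.toSeminorm⟩

theorem mul_le (p : CStarSeminorm A) (a b : A) : p (a * b) ≤ p a * p b := p.mul_le' a b

theorem star_mul_self (p : CStarSeminorm A) (a : A) : p (star a * a) = p a ^ 2 :=
  p.star_mul_self' a

theorem nonneg (p : CStarSeminorm A) (a : A) : 0 ≤ p a := apply_nonneg p.toSeminorm a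

theorem le_star (p : CStarSeminorm A) (a : A) : p a ≤ p (star a) := by
  have h1 := p.star_mul_self a
  have h2 := p.mul_le (star a) a
  by_contra! h
  nlinarith [p.nonneg a, p.nonneg (star a)]

theorem star_eq (p : CStarSeminorm A) (a : A) : p (star a) = p a :=
  le_antisymm (by simpa using p.le_star (star a)) (p.le_star a)

/-- The zero C*-seminorm. -/
instance : Inhabited (CStarSeminorm A) :=
  ⟨{ (0 : Seminorm ℂ A) with
      mul_le' := fun _ _ => (zero_mul (0 : ℝ)).ge
      star_mul_self' := fun _ => (zero_pow two_ne_zero).symm }⟩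

/-- The pullback of a C*-seminorm along a *-homomorphism. -/
def comap {B : Type*} [NonUnitalRing B] [Module ℂ B] [StarRing B] (p : CStarSeminorm B)
    (φ : A →⋆ₙₐ[ℂ] B) : CStarSeminorm A :=
  { p.toSeminorm.comp (φ : A →ₗ[ℂ] B) with
    mul_le' := fun a b => by
      have := p.mul_le' (φ a) (φ b)
      rw [← map_mul] at this
      exact this
    star_mul_self' := fun a => by
      have := p.star_mul_self' (φ a)
      rw [← map_star, ← map_mul] at this
      exact this }

theorem comap_apply {B : Type*} [NonUnitalRing B] [Module ℂ B] [StarRing B]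
    (p : CStarSeminorm B) (φ : A →⋆ₙₐ[ℂ] B) (a : A) : p.comap φ a = p (φ a) := rfl

/-- The norm of a C*-algebra as a C*-seminorm. -/
def ofNorm (B : Type*) [NonUnitalCStarAlgebra B] : CStarSeminorm B :=
  { normSeminorm ℂ B with
    mul_le' := fun a b => norm_mul_le a b
    star_mul_self' := fun a => by
      have := CStarRing.norm_star_mul_self (x := a)
      rw [← pow_two] at this
      exact this }

theorem ofNorm_apply {B : Type*} [NonUnitalCStarAlgebra B] (b : B) : ofNorm B b = ‖b‖ := rfl

/-! #### The Hausdorff completion of a *-algebra with respect to a C*-seminorm -/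

/-- The *-algebra `A` regarded as a seminormed ring with the seminorm `p`. -/
def Pre (_p : CStarSeminorm A) : Type _ := A

variable (p : CStarSeminorm A)

instance : NonUnitalRing p.Pre := inferInstanceAs (NonUnitalRing A)
instance : Module ℂ p.Pre := inferInstanceAs (Module ℂ A)
instance : IsScalarTower ℂ p.Pre p.Pre := inferInstanceAs (IsScalarTower ℂ A A)
instance : SMulCommClass ℂ p.Pre p.Pre := inferInstanceAs (SMulCommClass ℂ A A)
instance : StarRing p.Pre := inferInstanceAs (StarRing A)
instance : StarModule ℂ p.Pre := inferInstanceAs (StarModule ℂ A)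

instance : NonUnitalSeminormedRing p.Pre :=
  { (inferInstance : NonUnitalRing p.Pre),
    AddGroupSeminorm.toSeminormedAddCommGroup (E := A) p.toSeminorm.toAddGroupSeminorm with
    norm_mul_le := fun a b => p.mul_le a b }

theorem Pre.norm_def (a : p.Pre) : ‖a‖ = p a := rfl

instance : NormedSpace ℂ p.Pre where
  norm_smul_le c a := (map_smul_eq_mul p.toSeminorm c a).le

instance : NormedStarGroup p.Pre where
  norm_star_le a := (p.star_eq a).le

/-- The Hausdorff completion of the *-algebra `A` with respect to the C*-seminorm `p`. -/
def CStarCompletion : Type _ := UniformSpace.Completion p.Pre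

namespace CStarCompletion

open UniformSpace

instance : NormedAddCommGroup p.CStarCompletion := inferInstanceAs (NormedAddCommGroup (Completion p.Pre))
instance : NormedSpace ℂ p.CStarCompletion := inferInstanceAs (NormedSpace ℂ (Completion p.Pre))
instance : CompleteSpace p.CStarCompletion := inferInstanceAs (CompleteSpace (Completion p.Pre))

/-- The canonical linear map from `A` into its completion. -/
def coeL : p.Pre →ₗᵢ[ℂ] p.CStarCompletion := Completion.toComplₗᵢ

theorem isDenseInducing_coeL : IsDenseInducing (coeL p) := Completion.isDenseInducing_coe

theorem denseRange_coeL : DenseRange (coeL p) := Completion.denseRange_coe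

@[elab_as_elim]
theorem induction₁ {P : p.CStarCompletion → Prop} (a : p.CStarCompletion) (hP : IsClosed {a | P a})
    (h : ∀ a, P (coeL p a)) : P a := Completion.induction_on a hP h

@[elab_as_elim]
theorem induction₂ {P : p.CStarCompletion → p.CStarCompletion → Prop} (a b : p.CStarCompletion)
    (hP : IsClosed {x : p.CStarCompletion × p.CStarCompletion | P x.1 x.2})
    (h : ∀ a b, P (coeL p a) (coeL p b)) : P a b := Completion.induction_on₂ a b hP h

@[elab_as_elim]
theorem induction₃ {P : p.CStarCompletion → p.CStarCompletion → p.CStarCompletion → Prop} (a b c : p.CStarCompletion)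
    (hP : IsClosed {x : p.CStarCompletion × p.CStarCompletion × p.CStarCompletion | P x.1 x.2.1 x.2.2})
    (h : ∀ a b c, P (coeL p a) (coeL p b) (coeL p c)) : P a b c :=
  Completion.induction_on₃ a b c hP h

/-- The continuous extension of the multiplication. -/
instance : Mul p.CStarCompletion :=
  ⟨fun a b => ((isDenseInducing_coeL p).prodMap (isDenseInducing_coeL p)).extend
    (fun x : p.Pre × p.Pre => coeL p (x.1 * x.2)) (a, b)⟩

theorem coe_mul (a b : p.Pre) : coeL p (a * b) = coeL p a * coeL p b :=
  (((isDenseInducing_coeL p).prodMap (isDenseInducing_coeL p)).extend_eq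
    (f := fun x : p.Pre × p.Pre => coeL p (x.1 * x.2))
    ((coeL p).continuous.comp continuous_mul) (a, b)).symm

instance : ContinuousMul p.CStarCompletion where
  continuous_mul := by
    let m := (AddMonoidHom.mul : p.Pre →+ p.Pre →+ p.Pre).compr₂
      (coeL p : p.Pre →+ p.CStarCompletion)
    have : Continuous fun x : p.Pre × p.Pre => m x.1 x.2 :=
      (coeL p).continuous.comp continuous_mul
    have di : IsDenseInducing ((coeL p : p.Pre →+ p.CStarCompletion) : p.Pre → p.CStarCompletion) :=
      isDenseInducing_coeL p
    exact (di.extend_Z_bilin di this :)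

/-- The continuous extension of the involution. -/
instance : Star p.CStarCompletion := ⟨(isDenseInducing_coeL p).extend (fun a => coeL p (star a))⟩

theorem coe_star (a : p.Pre) : coeL p (star a) = star (coeL p a) :=
  ((isDenseInducing_coeL p).extend_eq ((coeL p).continuous.comp continuous_star) a).symm

theorem isometry_star : Isometry (star : p.CStarCompletion → p.CStarCompletion) := by
  have h : Isometry (fun a : p.Pre => coeL p (star a)) :=
    (coeL p).isometry.comp (starₗᵢ ℂ : p.Pre ≃ₗᵢ⋆[ℂ] p.Pre).isometry
  have h2 : (star : p.CStarCompletion → p.CStarCompletion) = Completion.extension (fun a : p.Pre => coeL p (star a)) := by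
    refine (Completion.extension_unique h.uniformContinuous ?_ ?_).symm
    · have hu : UniformContinuous (fun a : p.Pre => coeL p (star a)) := h.uniformContinuous
      exact uniformContinuous_uniformly_extend (Completion.isUniformInducing_coe _)
        Completion.denseRange_coe hu
    · intro a
      exact coe_star p a
  rw [h2]
  exact h.completion_extension

instance : ContinuousStar p.CStarCompletion := ⟨(isometry_star p).continuous⟩

instance : NonUnitalRing p.CStarCompletion :=
  { (inferInstance : AddCommGroup p.CStarCompletion), (inferInstance : Mul p.CStarCompletion) with
    zero_mul := fun a => induction₁ p a (isClosed_eq (by fun_prop) continuous_const)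
      fun a => by rw [← map_zero (coeL p), ← coe_mul, zero_mul]
    mul_zero := fun a => induction₁ p a (isClosed_eq (by fun_prop) continuous_const)
      fun a => by rw [← map_zero (coeL p), ← coe_mul, mul_zero]
    mul_assoc := fun a b c => induction₃ p a b c (isClosed_eq (by fun_prop) (by fun_prop))
      fun a b c => by simp only [← coe_mul, mul_assoc]
    left_distrib := fun a b c => induction₃ p a b c (isClosed_eq (by fun_prop) (by fun_prop))
      fun a b c => by simp only [← coe_mul, ← map_add, mul_add]
    right_distrib := fun a b c => induction₃ p a b c (isClosed_eq (by fun_prop) (by fun_prop))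
      fun a b c => by simp only [← coe_mul, ← map_add, add_mul] }

theorem smul_mul_aux (c : ℂ) (a b : p.CStarCompletion) : (c • a) * b = c • (a * b) := by
  have h1 : Continuous fun x : p.CStarCompletion × p.CStarCompletion => (c • x.1) * x.2 :=
    (continuous_fst.const_smul c).mul continuous_snd
  have h2 : Continuous fun x : p.CStarCompletion × p.CStarCompletion => c • (x.1 * x.2) :=
    (continuous_fst.mul continuous_snd).const_smul c
  refine induction₂ p a b (isClosed_eq h1 h2) fun a b => ?_
  rw [← map_smul, ← coe_mul, ← coe_mul, ← map_smul, smul_mul_assoc]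

theorem mul_smul_aux (c : ℂ) (a b : p.CStarCompletion) : a * (c • b) = c • (a * b) := by
  have h1 : Continuous fun x : p.CStarCompletion × p.CStarCompletion => x.1 * (c • x.2) :=
    continuous_fst.mul (continuous_snd.const_smul c)
  have h2 : Continuous fun x : p.CStarCompletion × p.CStarCompletion => c • (x.1 * x.2) :=
    (continuous_fst.mul continuous_snd).const_smul c
  refine induction₂ p a b (isClosed_eq h1 h2) fun a b => ?_
  rw [← map_smul, ← coe_mul, ← coe_mul, ← map_smul, mul_smul_comm]

theorem star_smul_aux (c : ℂ) (a : p.CStarCompletion) : star (c • a) = star c • star a := by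
  have h1 : Continuous fun x : p.CStarCompletion => star (c • x) :=
    (continuous_id.const_smul c).star
  have h2 : Continuous fun x : p.CStarCompletion => star c • star x :=
    continuous_star.const_smul (star c)
  refine induction₁ p a (isClosed_eq h1 h2) fun a => ?_
  rw [← map_smul, ← coe_star, ← coe_star, ← map_smul, star_smul]

instance : IsScalarTower ℂ p.CStarCompletion p.CStarCompletion := ⟨smul_mul_aux p⟩

instance : SMulCommClass ℂ p.CStarCompletion p.CStarCompletion :=
  ⟨fun c a b => (mul_smul_aux p c a b).symm⟩

instance : StarRing p.CStarCompletion where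
  star_involutive a := induction₁ p a (isClosed_eq (by fun_prop) continuous_id)
    fun a => by rw [← coe_star, ← coe_star, star_star]
  star_mul a b := induction₂ p a b (isClosed_eq (by fun_prop) (by fun_prop))
    fun a b => by simp only [← coe_mul, ← coe_star, star_mul]
  star_add a b := induction₂ p a b (isClosed_eq (by fun_prop) (by fun_prop))
    fun a b => by simp only [← map_add, ← coe_star, star_add]

instance : StarModule ℂ p.CStarCompletion := ⟨star_smul_aux p⟩

theorem norm_coeL (a : p.Pre) : ‖coeL p a‖ = p a := (coeL p).norm_map a

instance : NonUnitalNormedRing p.CStarCompletion :=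
  { (inferInstance : NonUnitalRing p.CStarCompletion),
    (inferInstance : NormedAddCommGroup p.CStarCompletion) with
    norm_mul_le := fun a b => induction₂ p a b (isClosed_le (by fun_prop) (by fun_prop))
      fun a b => by
        rw [← coe_mul, norm_coeL, norm_coeL, norm_coeL]
        exact p.mul_le a b }

instance : CStarRing p.CStarCompletion where
  norm_mul_self_le a := induction₁ p a (isClosed_le (by fun_prop) (by fun_prop))
    fun a => by
      rw [← coe_star, ← coe_mul, norm_coeL, norm_coeL, ← pow_two]
      exact (p.star_mul_self a).ge

instance : NonUnitalCStarAlgebra p.CStarCompletion where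

end CStarCompletion

/-- The canonical *-homomorphism from `A` into its completion. -/
def toCompl (p : CStarSeminorm A) : A →⋆ₙₐ[ℂ] p.CStarCompletion where
  toFun a := CStarCompletion.coeL p a
  map_smul' c a := (CStarCompletion.coeL p).map_smul c a
  map_zero' := (CStarCompletion.coeL p).map_zero
  map_add' a b := (CStarCompletion.coeL p).map_add a b
  map_mul' a b := CStarCompletion.coe_mul p a b
  map_star' a := CStarCompletion.coe_star p a

theorem norm_toCompl (a : A) : ‖p.toCompl a‖ = p a := CStarCompletion.norm_coeL p a

theorem denseRange_toCompl : DenseRange p.toCompl := CStarCompletion.denseRange_coeL p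

end CStarSeminorm

/-- The class of *-algebras for which the supremum of all C*-seminorms is finite at every element,
so that the enveloping C*-algebra is defined. -/
class HasEnveloping (A : Type*) [NonUnitalRing A] [Module ℂ A] [StarRing A] : Prop where
  bdd : ∀ a : A, BddAbove (Set.range fun p : CStarSeminorm A => p a)

/-- The largest C*-seminorm `a ↦ sup {p a | p a C*-seminorm}`, that is, the supremum of `‖π a‖` over
all *-homomorphisms `π` into C*-algebras, or all representations by bounded operators on
Hilbert spaces. -/
def maxCStarSeminorm (A : Type*) [NonUnitalRing A] [Module ℂ A] [IsScalarTower ℂ A A]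
    [SMulCommClass ℂ A A] [StarRing A] [StarModule ℂ A] [HasEnveloping A] : CStarSeminorm A :=
  { Seminorm.of (fun a : A => ⨆ p : CStarSeminorm A, p a)
      (fun a b => ciSup_le fun p => (map_add_le_add p.toSeminorm a b).trans
        (add_le_add (le_ciSup (HasEnveloping.bdd a) p) (le_ciSup (HasEnveloping.bdd b) p)))
      (fun c a => by
        rw [Real.mul_iSup_of_nonneg (norm_nonneg c)]
        exact iSup_congr fun p => map_smul_eq_mul p.toSeminorm c a) with
    mul_le' := fun a b => ciSup_le fun p => (p.mul_le a b).trans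
      (mul_le_mul (le_ciSup (HasEnveloping.bdd a) p) (le_ciSup (HasEnveloping.bdd b) p)
        (p.nonneg b) ((p.nonneg a).trans (le_ciSup (HasEnveloping.bdd a) p)))
    star_mul_self' := fun a => by
      change (⨆ p : CStarSeminorm A, p (star a * a)) = (⨆ p : CStarSeminorm A, p a) ^ 2
      apply le_antisymm
      · refine ciSup_le fun p => ?_
        rw [p.star_mul_self]
        exact pow_le_pow_left₀ (p.nonneg a) (le_ciSup (HasEnveloping.bdd a) p) 2
      · have hb := HasEnveloping.bdd (star a * a)
        have h0 : 0 ≤ ⨆ p : CStarSeminorm A, p (star a * a) := Real.iSup_nonneg fun p => p.nonneg _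
        refine (Real.le_sqrt (Real.iSup_nonneg fun p => p.nonneg _) h0).1 (ciSup_le fun p => ?_)
        refine Real.le_sqrt_of_sq_le ?_
        rw [← p.star_mul_self]
        exact le_ciSup (f := fun p : CStarSeminorm A => p (star a * a)) hb p }

theorem le_maxCStarSeminorm [HasEnveloping A] (p : CStarSeminorm A) (a : A) :
    p a ≤ maxCStarSeminorm A a :=
  le_ciSup (f := fun p : CStarSeminorm A => p a) (HasEnveloping.bdd a) p

/-- The enveloping C*-algebra of a *-algebra: its Hausdorff completion with respect to the largest
C*-seminorm. -/
abbrev EnvelopingCStar (A : Type*) [NonUnitalRing A] [Module ℂ A] [IsScalarTower ℂ A A]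
    [SMulCommClass ℂ A A] [StarRing A] [StarModule ℂ A] [HasEnveloping A] : Type _ :=
  (maxCStarSeminorm A).CStarCompletion

namespace EnvelopingCStar

variable [HasEnveloping A] {B : Type*} [NonUnitalCStarAlgebra B]

/-- The canonical *-homomorphism into the enveloping C*-algebra. -/
abbrev ofAlg : A →⋆ₙₐ[ℂ] EnvelopingCStar A := (maxCStarSeminorm A).toCompl

theorem norm_le_max (φ : A →⋆ₙₐ[ℂ] B) (a : A) : ‖φ a‖ ≤ ‖(ofAlg a : EnvelopingCStar A)‖ := by
  rw [CStarSeminorm.norm_toCompl]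
  exact le_maxCStarSeminorm ((CStarSeminorm.ofNorm B).comap φ) a

/-- The continuous linear extension of a *-homomorphism. -/
def liftL (φ : A →⋆ₙₐ[ℂ] B) : EnvelopingCStar A →L[ℂ] B :=
  LinearMap.extendOfNorm (φ : A →ₗ[ℂ] B) ((ofAlg : A →⋆ₙₐ[ℂ] EnvelopingCStar A) : A →ₗ[ℂ] _)

theorem liftL_ofAlg (φ : A →⋆ₙₐ[ℂ] B) (a : A) : liftL φ (ofAlg a) = φ a :=
  LinearMap.extendOfNorm_eq (CStarSeminorm.denseRange_toCompl _)
    ⟨1, fun x => by rw [one_mul]; exact norm_le_max φ x⟩ a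

/-- The universal property: every *-homomorphism from `A` to a C*-algebra extends to
the enveloping C*-algebra of `A`. -/
def lift (φ : A →⋆ₙₐ[ℂ] B) : EnvelopingCStar A →⋆ₙₐ[ℂ] B :=
  { liftL φ with
    map_smul' := fun c a => (liftL φ).map_smul c a
    map_zero' := (liftL φ).map_zero
    map_mul' := fun a b => by
      change liftL φ (a * b) = liftL φ a * liftL φ b
      refine (CStarSeminorm.denseRange_toCompl _).induction_on₂
        (isClosed_eq (by fun_prop) (by fun_prop)) (fun a b => ?_) a b
      rw [← map_mul, liftL_ofAlg, liftL_ofAlg, liftL_ofAlg, map_mul]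
    map_star' := fun a => by
      change liftL φ (star a) = star (liftL φ a)
      refine (CStarSeminorm.denseRange_toCompl _).induction_on
        (p := fun a => liftL φ (star a) = star (liftL φ a)) a
        (isClosed_eq (by fun_prop) (by fun_prop)) (fun a => ?_)
      rw [← map_star, liftL_ofAlg, liftL_ofAlg, map_star] }

theorem lift_ofAlg (φ : A →⋆ₙₐ[ℂ] B) (a : A) : lift φ (ofAlg a) = φ a := liftL_ofAlg φ a

/-- The *-homomorphism of enveloping C*-algebras induced by a *-homomorphism. -/
def map {A' : Type*} [NonUnitalRing A'] [Module ℂ A'] [IsScalarTower ℂ A' A']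
    [SMulCommClass ℂ A' A'] [StarRing A'] [StarModule ℂ A'] [HasEnveloping A']
    (φ : A →⋆ₙₐ[ℂ] A') : EnvelopingCStar A →⋆ₙₐ[ℂ] EnvelopingCStar A' :=
  lift ((ofAlg : A' →⋆ₙₐ[ℂ] EnvelopingCStar A').comp φ)

end EnvelopingCStar

end Enveloping

/-! ### Groupoids, locally compact étale groupoids -/

/-- A groupoid, presented by its set `G` of arrows. The units are the arrows `x` with `src x = x`.
The product `mul g h` is meaningful only if `src g = rng h`, and nothing is required of it
otherwise. -/
class ArrowGroupoid (G : Type*) where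
  src : G → G
  rng : G → G
  mul : G → G → G
  inv : G → G
  src_src : ∀ g, src (src g) = src g
  rng_src : ∀ g, rng (src g) = src g
  src_rng : ∀ g, src (rng g) = rng g
  rng_rng : ∀ g, rng (rng g) = rng g
  src_mul : ∀ g h, src g = rng h → src (mul g h) = src h
  rng_mul : ∀ g h, src g = rng h → rng (mul g h) = rng g
  mul_assoc : ∀ g h k, src g = rng h → src h = rng k → mul (mul g h) k = mul g (mul h k)
  rng_mul_self : ∀ g, mul (rng g) g = g
  mul_src_self : ∀ g, mul g (src g) = g
  src_inv : ∀ g, src (inv g) = rng g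
  rng_inv : ∀ g, rng (inv g) = src g
  inv_mul : ∀ g, mul (inv g) g = src g
  mul_inv : ∀ g, mul g (inv g) = rng g

namespace ArrowGroupoid

section Algebra

variable {G : Type*} [ArrowGroupoid G]

theorem inv_mul_mul (k l : G) (h : src k = rng l) : mul (inv k) (mul k l) = l := by
  rw [← mul_assoc _ _ _ (src_inv k) h, inv_mul, h, rng_mul_self]

theorem mul_inv_mul (k h : G) (e : rng k = rng h) : mul k (mul (inv k) h) = h := by
  rw [← mul_assoc _ _ _ (rng_inv k).symm ((src_inv k).trans e), mul_inv, e, rng_mul_self]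

theorem eq_inv_of_mul (a b : G) (e : src a = rng b) (h : mul a b = rng a) : b = inv a := by
  have h1 := inv_mul_mul a b e
  rw [h, ← src_inv, mul_src_self] at h1
  exact h1.symm

theorem inv_inv (g : G) : inv (inv g) = g :=
  (eq_inv_of_mul (inv g) g (src_inv g) (by rw [inv_mul, rng_inv])).symm

theorem inv_mul_rev (g h : G) (e : src g = rng h) : inv (mul g h) = mul (inv h) (inv g) := by
  have e1 : src (inv h) = rng (inv g) := by rw [src_inv, rng_inv, e]
  refine (eq_inv_of_mul _ _ ?_ ?_).symm
  · rw [src_mul _ _ e, rng_mul _ _ e1, rng_inv]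
  · rw [mul_assoc _ _ _ e (by rw [rng_mul _ _ e1, rng_inv]),
      mul_inv_mul _ _ (by rw [rng_inv, e]), mul_inv, rng_mul _ _ e]

theorem mul_mul_inv (g h : G) (e : src g = src h) : mul (mul g (inv h)) h = g := by
  rw [mul_assoc _ _ _ (by rw [rng_inv, e]) (src_inv h), inv_mul, ← e, mul_src_self]

/-- The unit space `G⁰`. It carries the relative topology if `G` is a topological space. -/
abbrev UnitSpace (G : Type*) [ArrowGroupoid G] : Type _ := {x : G // src x = x}

/-- The source map `G → G⁰`. -/
def s (g : G) : UnitSpace G := ⟨src g, src_src g⟩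

/-- The range map `G → G⁰`. -/
def r (g : G) : UnitSpace G := ⟨rng g, src_rng g⟩

theorem rng_unit (x : UnitSpace G) : rng (x : G) = x := by
  have := rng_src (x : G)
  rwa [x.2] at this

theorem r_unit (x : UnitSpace G) : r (x : G) = x := Subtype.ext (rng_unit x)

theorem s_unit (x : UnitSpace G) : s (x : G) = x := Subtype.ext x.2

theorem r_eq_iff {g h : G} : r g = r h ↔ rng g = rng h := Subtype.ext_iff

theorem s_eq_iff {g h : G} : s g = s h ↔ src g = src h := Subtype.ext_iff

/-- The convolution product `(f₁ * f₂) g = ∑ f₁ h * f₂ (h⁻¹ g)` over all `h` with `r h = r g`. -/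
def conv (f₁ f₂ : G → ℂ) (g : G) : ℂ :=
  ∑ᶠ h ∈ {h : G | r h = r g}, f₁ h * f₂ (mul (inv h) g)

/-- The involution `f* g = conj (f g⁻¹)`. -/
def invol (f : G → ℂ) (g : G) : ℂ := star (f (inv g))

/-- The function `f` has finite support in every fibre of the range map. -/
def RFin (f : G → ℂ) : Prop := ∀ x : UnitSpace G, ({h : G | r h = x} ∩ Function.support f).Finite

theorem conv_add {f₁ f₂ f₃ : G → ℂ} (h₁ : RFin f₁) :
    conv f₁ (f₂ + f₃) = conv f₁ f₂ + conv f₁ f₃ := by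
  funext g
  have hf : ∀ f : G → ℂ, ({h : G | r h = r g} ∩
      Function.support fun h => f₁ h * f (mul (inv h) g)).Finite := fun f =>
    (h₁ (r g)).subset (Set.inter_subset_inter_right _ (Function.support_mul_subset_left _ _))
  simp only [conv, Pi.add_apply, mul_add]
  exact finsum_mem_add_distrib' (hf f₂) (hf f₃)

theorem add_conv {f₁ f₂ f₃ : G → ℂ} (h₁ : RFin f₁) (h₂ : RFin f₂) :
    conv (f₁ + f₂) f₃ = conv f₁ f₃ + conv f₂ f₃ := by
  funext g
  have hf : ∀ f : G → ℂ, RFin f → ({h : G | r h = r g} ∩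
      Function.support fun h => f h * f₃ (mul (inv h) g)).Finite := fun f h =>
    (h (r g)).subset (Set.inter_subset_inter_right _ (Function.support_mul_subset_left _ _))
  simp only [conv, Pi.add_apply, add_mul]
  exact finsum_mem_add_distrib' (hf f₁ h₁) (hf f₂ h₂)

theorem smul_conv (c : ℂ) (f₁ f₂ : G → ℂ) : conv (c • f₁) f₂ = c • conv f₁ f₂ := by
  funext g
  simp only [conv, Pi.smul_apply, smul_eq_mul, mul_finsum_mem, _root_.mul_assoc]

theorem conv_smul (c : ℂ) (f₁ f₂ : G → ℂ) : conv f₁ (c • f₂) = c • conv f₁ f₂ := by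
  funext g
  simp only [conv, Pi.smul_apply, smul_eq_mul, mul_finsum_mem, mul_left_comm]

theorem zero_conv (f : G → ℂ) : conv 0 f = 0 := by
  simpa using smul_conv 0 0 f

theorem conv_zero (f : G → ℂ) : conv f 0 = 0 := by
  simpa using conv_smul 0 f 0

theorem bijOn_mul (k : G) :
    Set.BijOn (mul k) {l : G | r l = s k} {h : G | r h = r k} := by
  refine ⟨fun l hl => ?_, fun l hl l' hl' e => ?_, fun h hh => ?_⟩
  · exact r_eq_iff.2 (rng_mul _ _ (congrArg Subtype.val hl).symm)
  · have e1 := congrArg (mul (inv k)) e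
    rwa [inv_mul_mul _ _ (congrArg Subtype.val hl).symm,
      inv_mul_mul _ _ (congrArg Subtype.val hl').symm] at e1
  · have e : rng k = rng h := (congrArg Subtype.val hh).symm
    refine ⟨mul (inv k) h, Subtype.ext ?_, mul_inv_mul k h e⟩
    exact (rng_mul _ _ ((src_inv k).trans e)).trans (rng_inv k)

theorem conv_assoc {f₁ f₂ f₃ : G → ℂ} (h₁ : RFin f₁) (h₂ : RFin f₂) :
    conv (conv f₁ f₂) f₃ = conv f₁ (conv f₂ f₃) := by
  funext g
  set F : Set G := {h : G | r h = r g} with hF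
  set S : Set G := F ∩ Function.support f₁ with hS
  have hSf : S.Finite := h₁ (r g)
  set T : Set G := ⋃ k ∈ S, mul k '' ({l : G | r l = s k} ∩ Function.support f₂) with hT
  have hTf : T.Finite := hSf.biUnion fun k _ => (h₂ (s k)).image _
  have hTF : T ⊆ F := by
    intro h hh
    simp only [hT, Set.mem_iUnion] at hh
    obtain ⟨k, hk, l, ⟨hl, -⟩, rfl⟩ := hh
    exact ((bijOn_mul k).mapsTo hl).trans hk.1
  have inner : ∀ h ∈ F, conv f₁ f₂ h = ∑ᶠ k ∈ S, f₁ k * f₂ (mul (inv k) h) := by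
    intro h hh
    have e : {k : G | r k = r h} = F := by rw [hF]; rw [show r h = r g from hh]
    rw [conv, e]
    refine finsum_mem_inter_support_eq _ _ _ ?_
    ext k
    simp only [hS, Set.mem_inter_iff, Function.mem_support, ne_eq, mul_eq_zero, not_or]
    tauto
  have mem : ∀ k ∈ S, ∀ h ∈ F, f₂ (mul (inv k) h) ≠ 0 → h ∈ T := by
    intro k hk h hh hne
    have e : r h = r k := (show r h = r g from hh).trans (show r k = r g from hk.1).symm
    obtain ⟨l, hl, rfl⟩ := (bijOn_mul k).surjOn e
    rw [inv_mul_mul _ _ (congrArg Subtype.val hl).symm] at hne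
    exact Set.mem_biUnion hk ⟨l, ⟨hl, hne⟩, rfl⟩
  have left : conv (conv f₁ f₂) f₃ g =
      ∑ᶠ h ∈ T, ∑ᶠ k ∈ S, f₁ k * f₂ (mul (inv k) h) * f₃ (mul (inv h) g) := by
    rw [conv, ← hF]
    have : ∑ᶠ h ∈ F, conv f₁ f₂ h * f₃ (mul (inv h) g) =
        ∑ᶠ h ∈ T, conv f₁ f₂ h * f₃ (mul (inv h) g) := by
      refine finsum_mem_inter_support_eq _ _ _ ?_
      ext h
      constructor
      · rintro ⟨hh, hne⟩
        refine ⟨?_, hne⟩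
        have h3 : conv f₁ f₂ h ≠ 0 := left_ne_zero_of_mul hne
        rw [inner h hh] at h3
        obtain ⟨k, hk, hk2⟩ := exists_ne_zero_of_finsum_mem_ne_zero h3
        exact mem k hk h hh (right_ne_zero_of_mul hk2)
      · rintro ⟨hh, hne⟩
        exact ⟨hTF hh, hne⟩
    rw [this]
    refine finsum_mem_congr rfl fun h hh => ?_
    rw [inner h (hTF hh), finsum_mem_mul]
  have right : conv f₁ (conv f₂ f₃) g =
      ∑ᶠ k ∈ S, ∑ᶠ h ∈ T, f₁ k * f₂ (mul (inv k) h) * f₃ (mul (inv h) g) := by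
    rw [conv, ← hF]
    have : ∑ᶠ k ∈ F, f₁ k * conv f₂ f₃ (mul (inv k) g) =
        ∑ᶠ k ∈ S, f₁ k * conv f₂ f₃ (mul (inv k) g) := by
      refine finsum_mem_inter_support_eq _ _ _ ?_
      ext k
      simp only [hS, Set.mem_inter_iff, Function.mem_support, ne_eq, mul_eq_zero, not_or]
      tauto
    rw [this]
    refine finsum_mem_congr rfl fun k hk => ?_
    have hkg : rng k = rng g := r_eq_iff.1 hk.1
    have e1 : r (mul (inv k) g) = s k :=
      Subtype.ext ((rng_mul _ _ ((src_inv k).trans hkg)).trans (rng_inv k))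
    have e2 : conv f₂ f₃ (mul (inv k) g) =
        ∑ᶠ h ∈ F, f₂ (mul (inv k) h) * f₃ (mul (inv h) g) := by
      rw [conv, e1, hF, ← show r k = r g from hk.1]
      refine finsum_mem_eq_of_bijOn (mul k) (bijOn_mul k) fun l hl => ?_
      have hl' : src k = rng l := (congrArg Subtype.val hl).symm
      rw [inv_mul_mul _ _ hl', inv_mul_rev _ _ hl',
        mul_assoc _ _ _ (by rw [src_inv, rng_inv, hl']) ((src_inv k).trans hkg)]
    have e3 : ∑ᶠ h ∈ F, f₂ (mul (inv k) h) * f₃ (mul (inv h) g) =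
        ∑ᶠ h ∈ T, f₂ (mul (inv k) h) * f₃ (mul (inv h) g) := by
      refine finsum_mem_inter_support_eq _ _ _ ?_
      ext h
      constructor
      · rintro ⟨hh, hne⟩
        exact ⟨mem k hk h hh (left_ne_zero_of_mul hne), hne⟩
      · rintro ⟨hh, hne⟩
        exact ⟨hTF hh, hne⟩
    rw [e2, e3, mul_finsum_mem]
    simp only [_root_.mul_assoc]
  rw [left, right]
  exact finsum_mem_comm _ hTf hSf

theorem invol_invol (f : G → ℂ) : invol (invol f) = f := by
  funext g
  simp only [invol, inv_inv, star_star]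

theorem invol_conv (f₁ f₂ : G → ℂ) : invol (conv f₁ f₂) = conv (invol f₂) (invol f₁) := by
  funext g
  have h1 : star (conv f₁ f₂ (inv g)) =
      ∑ᶠ h ∈ {h : G | r h = s g}, star (f₁ h * f₂ (mul (inv h) (inv g))) := by
    have e : r (inv g) = s g := Subtype.ext (rng_inv g)
    rw [conv, e]
    exact ((starAddEquiv : ℂ ≃+ ℂ).map_finsum _).trans
      (finsum_congr fun h => (starAddEquiv : ℂ ≃+ ℂ).map_finsum _)
  rw [invol, h1, conv]
  refine finsum_mem_eq_of_bijOn (mul g) (bijOn_mul g) fun h hh => ?_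
  have hh' : src g = rng h := (congrArg Subtype.val hh).symm
  have e1 : mul (mul (inv h) (inv g)) g = inv h :=
    mul_mul_inv (inv h) g (by rw [src_inv, hh'])
  simp only [invol]
  rw [inv_mul_rev g h hh', e1, inv_inv, star_mul]

end Algebra
end ArrowGroupoid

open scoped CompactlySupported ZeroAtInfty


/-- A locally compact, not necessarily Hausdorff, étale groupoid. -/
class IsLCEtaleGroupoid (G : Type*) [TopologicalSpace G] [ArrowGroupoid G] : Prop where
  locallyCompact : LocallyCompactSpace G
  continuousOn_mul :
    ContinuousOn (fun p : G × G => ArrowGroupoid.mul p.1 p.2)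
      {p | ArrowGroupoid.src p.1 = ArrowGroupoid.rng p.2}
  continuous_inv : Continuous (ArrowGroupoid.inv : G → G)
  t2_units : T2Space (ArrowGroupoid.UnitSpace G)
  locallyCompact_units : LocallyCompactSpace (ArrowGroupoid.UnitSpace G)
  isLocalHomeomorph_r : IsLocalHomeomorph (ArrowGroupoid.r : G → ArrowGroupoid.UnitSpace G)
  isLocalHomeomorph_s : IsLocalHomeomorph (ArrowGroupoid.s : G → ArrowGroupoid.UnitSpace G)

/-! ### The spaces `C_c(U)` -/

section Cc

set_option linter.unusedSectionVars false

variable {G : Type*} [TopologicalSpace G]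

/-- The functions in `C_c(V)`, extended by zero to `G`. -/
def CcOn (V : Set G) : Set (G → ℂ) :=
  {f | ∃ φ : C_c(V, ℂ), f = Function.extend (Subtype.val : V → G) φ 0}

/-- For an open set `U`, the span `C_c(U)` of the spaces `C_c(V)` over all open Hausdorff
subsets `V` of `U`, inside the space of all functions on `G`. -/
def Cc (U : Set G) : Submodule ℂ (G → ℂ) :=
  Submodule.span ℂ {f | ∃ V ⊆ U, IsOpen V ∧ T2Space V ∧ f ∈ CcOn V}

theorem mem_CcOn_iff {V : Set G} [T2Space V] {f : G → ℂ} :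
    f ∈ CcOn V ↔ ContinuousOn f V ∧ ∃ K ⊆ V, IsCompact K ∧ ∀ g, g ∉ K → f g = 0 := by
  constructor
  · rintro ⟨φ, rfl⟩
    have hval : ∀ v : V, Function.extend (Subtype.val : V → G) φ 0 v = φ v := fun v =>
      Subtype.val_injective.extend_apply φ 0 v
    refine ⟨?_, Subtype.val '' tsupport φ, ?_, ?_, ?_⟩
    · rw [continuousOn_iff_continuous_domRestrict]
      convert! φ.continuous using 1
      funext v
      exact hval v
    · rintro _ ⟨v, -, rfl⟩
      exact v.2
    · exact φ.hasCompactSupport.isCompact.image continuous_subtype_val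
    · intro g hg
      by_cases hgV : g ∈ V
      · rw [hval ⟨g, hgV⟩]
        refine image_eq_zero_of_notMem_tsupport fun h => hg ⟨⟨g, hgV⟩, h, rfl⟩
      · rw [Function.extend_apply']
        · rfl
        · rintro ⟨v, rfl⟩
          exact hgV v.2
  · rintro ⟨hc, K, hKV, hK, h0⟩
    refine ⟨⟨⟨V.domRestrict f, continuousOn_iff_continuous_domRestrict.1 hc⟩, ?_⟩, ?_⟩
    · refine HasCompactSupport.intro (K := Subtype.val ⁻¹' K) ?_ fun v hv => h0 v hv
      rw [Subtype.isCompact_iff, Subtype.image_preimage_coe, Set.inter_eq_right.2 hKV]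
      exact hK
    · funext g
      by_cases hgV : g ∈ V
      · exact (Subtype.val_injective.extend_apply (V.domRestrict f) 0 ⟨g, hgV⟩).symm
      · rw [Function.extend_apply']
        · exact h0 g fun h => hgV (hKV h)
        · rintro ⟨v, rfl⟩
          exact hgV v.2

theorem CcOn_le_Cc {U V : Set G} (hVU : V ⊆ U) (hV : IsOpen V) [hT : T2Space V] {f : G → ℂ}
    (hf : f ∈ CcOn V) : f ∈ Cc U := Submodule.subset_span ⟨V, hVU, hV, hT, hf⟩

theorem Cc_mono {U V : Set G} (hVU : V ⊆ U) : Cc V ≤ Cc U :=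
  Submodule.span_mono fun _ ⟨W, hW, h⟩ => ⟨W, hW.trans hVU, h⟩

/-- Partition of unity argument: it suffices to take small sets `V`. -/
theorem CcOn_mem_span [LocallyCompactSpace G] {V : Set G} (hV : IsOpen V) [T2Space V]
    (P : Set G → Prop) (hP : ∀ g ∈ V, ∃ B, g ∈ B ∧ IsOpen B ∧ B ⊆ V ∧ P B) {f : G → ℂ}
    (hf : f ∈ CcOn V) :
    f ∈ Submodule.span ℂ {f | ∃ B, IsOpen B ∧ B ⊆ V ∧ P B ∧ f ∈ CcOn B} := by
  obtain ⟨φ, rfl⟩ := hf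
  have : LocallyCompactSpace V := hV.locallyCompactSpace
  choose! B hgB hBo hBV hBP using hP
  have hK : IsCompact (tsupport φ) := φ.hasCompactSupport.isCompact
  obtain ⟨t, -, ht⟩ := hK.elim_nhds_subcover (fun v : V => Subtype.val ⁻¹' (B v))
    (fun v _ => ((hBo v v.2).preimage continuous_subtype_val).mem_nhds (hgB v v.2))
  let e := t.equivFin.symm
  obtain ⟨ρ, hρs, hρ1, -, hρc⟩ := exists_continuous_sum_one_of_isOpen_isCompact
    (s := fun i : Fin t.card => (Subtype.val ⁻¹' (B (e i : V)) : Set V))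
    (fun i => (hBo _ (e i : V).2).preimage continuous_subtype_val) hK (by
      refine ht.trans ?_
      intro v hv
      simp only [Set.mem_iUnion] at hv ⊢
      obtain ⟨w, hw, hv⟩ := hv
      exact ⟨t.equivFin ⟨w, hw⟩, by simpa [e] using hv⟩)
  let F : Fin t.card → G → ℂ := fun i =>
    Function.extend (Subtype.val : V → G) (fun v => (ρ i v : ℂ) * φ v) 0
  have hsum : Function.extend (Subtype.val : V → G) φ 0 = ∑ i, F i := by
    funext g
    rw [Finset.sum_apply]
    by_cases hg : g ∈ V
    · have h1 : ∀ ψ : V → ℂ, Function.extend (Subtype.val : V → G) ψ 0 g = ψ ⟨g, hg⟩ := fun ψ =>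
        Subtype.val_injective.extend_apply ψ 0 ⟨g, hg⟩
      simp only [F, h1, ← Finset.sum_mul]
      by_cases hs : (⟨g, hg⟩ : V) ∈ tsupport φ
      · have h2 := hρ1 hs
        rw [Finset.sum_apply] at h2
        rw [← Complex.ofReal_sum, h2]
        simp
      · rw [image_eq_zero_of_notMem_tsupport hs, mul_zero]
    · have h1 : ∀ ψ : V → ℂ, Function.extend (Subtype.val : V → G) ψ 0 g = 0 := fun ψ => by
        rw [Function.extend_apply']
        · rfl
        · rintro ⟨v, rfl⟩
          exact hg v.2
      simp [F, h1]
  rw [hsum]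
  refine Submodule.sum_mem _ fun i _ => Submodule.subset_span
    ⟨B (e i : V), hBo _ (e i : V).2, hBV _ (e i : V).2, hBP _ (e i : V).2, ?_⟩
  have hBV' := hBV _ (e i : V).2
  have : T2Space (B (e i : V)) := T2Space.of_injective_continuous
    (f := Set.inclusion hBV') (Set.inclusion_injective hBV') (continuous_inclusion hBV')
  refine mem_CcOn_iff.2 ⟨?_, Subtype.val '' tsupport (ρ i), ?_, ?_, ?_⟩
  · refine ContinuousOn.mono (continuousOn_iff_continuous_domRestrict.2 ?_) hBV'
    have : V.domRestrict (F i) = fun v => (ρ i v : ℂ) * φ v := by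
      funext v
      exact Subtype.val_injective.extend_apply (fun v => (ρ i v : ℂ) * φ v) (0 : G → ℂ) v
    rw [this]
    exact (Complex.continuous_ofReal.comp (ρ i).continuous).mul φ.continuous
  · rintro _ ⟨v, hv, rfl⟩
    exact hρs i hv
  · exact (hρc i).isCompact.image continuous_subtype_val
  · intro g hg
    by_cases hgV : g ∈ V
    · have : F i g = (ρ i ⟨g, hgV⟩ : ℂ) * φ ⟨g, hgV⟩ :=
        Subtype.val_injective.extend_apply (fun v => (ρ i v : ℂ) * φ v) (0 : G → ℂ) ⟨g, hgV⟩
      rw [this, image_eq_zero_of_notMem_tsupport fun h => hg ⟨⟨g, hgV⟩, h, rfl⟩]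
      simp
    · refine (Function.extend_apply' _ _ _ ?_).trans rfl
      rintro ⟨v, rfl⟩
      exact hgV v.2

end Cc

namespace ArrowGroupoid

section Etale

set_option linter.unusedSectionVars false

variable {G : Type*} [TopologicalSpace G] [ArrowGroupoid G] [IsLCEtaleGroupoid G]

instance : T2Space (UnitSpace G) := IsLCEtaleGroupoid.t2_units
instance : LocallyCompactSpace (UnitSpace G) := IsLCEtaleGroupoid.locallyCompact_units

theorem continuous_r : Continuous (r : G → UnitSpace G) :=
  IsLCEtaleGroupoid.isLocalHomeomorph_r.continuous

theorem continuous_s : Continuous (s : G → UnitSpace G) :=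
  IsLCEtaleGroupoid.isLocalHomeomorph_s.continuous

theorem continuous_inv' : Continuous (inv : G → G) := IsLCEtaleGroupoid.continuous_inv

/-- An open bisection: an open set on which both `r` and `s` are injective. -/
structure IsOpenBisection (B : Set G) : Prop where
  isOpen : IsOpen B
  injOn_r : Set.InjOn (r : G → UnitSpace G) B
  injOn_s : Set.InjOn (s : G → UnitSpace G) B

theorem t2_of_injOn {B : Set G} (h : Set.InjOn (r : G → UnitSpace G) B) : T2Space B :=
  T2Space.of_injective_continuous (f := B.domRestrict (r : G → UnitSpace G))
    (Set.injOn_iff_injective.1 h) (continuous_r.comp continuous_subtype_val)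

theorem IsOpenBisection.t2 {B : Set G} (h : IsOpenBisection B) : T2Space B := t2_of_injOn h.injOn_r

theorem exists_bisection {V : Set G} (hV : IsOpen V) {g : G} (hg : g ∈ V) :
    ∃ B, g ∈ B ∧ IsOpen B ∧ B ⊆ V ∧ IsOpenBisection B := by
  obtain ⟨e₁, h₁, he₁⟩ := IsLCEtaleGroupoid.isLocalHomeomorph_r (G := G) g
  obtain ⟨e₂, h₂, he₂⟩ := IsLCEtaleGroupoid.isLocalHomeomorph_s (G := G) g
  have ho : IsOpen (V ∩ (e₁.source ∩ e₂.source)) :=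
    hV.inter (e₁.open_source.inter e₂.open_source)
  refine ⟨V ∩ (e₁.source ∩ e₂.source), ⟨hg, h₁, h₂⟩, ho, Set.inter_subset_left, ho, ?_, ?_⟩
  · rw [he₁]
    exact e₁.injOn.mono fun x hx => hx.2.1
  · rw [he₂]
    exact e₂.injOn.mono fun x hx => hx.2.2

/-- In the definition of `C_c(U)` it suffices to take open bisections. -/
theorem Cc_eq_span (U : Set G) :
    Cc U = Submodule.span ℂ {f | ∃ B, IsOpenBisection B ∧ B ⊆ U ∧ f ∈ CcOn B} := by
  have : LocallyCompactSpace G := IsLCEtaleGroupoid.locallyCompact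
  apply le_antisymm
  · refine Submodule.span_le.2 ?_
    rintro f ⟨V, hVU, hV, hT, hf⟩
    refine Submodule.span_mono ?_ (CcOn_mem_span hV IsOpenBisection
      (fun g hg => exists_bisection hV hg) hf)
    rintro f ⟨B, -, hBV, hB, hf⟩
    exact ⟨B, hB, hBV.trans hVU, hf⟩
  · refine Submodule.span_mono ?_
    rintro f ⟨B, hB, hBU, hf⟩
    exact ⟨B, hBU, hB.isOpen, hB.t2, hf⟩

theorem RFin.add {f₁ f₂ : G → ℂ} (h₁ : RFin f₁) (h₂ : RFin f₂) : RFin (f₁ + f₂) := fun x => by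
  refine ((h₁ x).union (h₂ x)).subset ?_
  rw [← Set.inter_union_distrib_left]
  exact Set.inter_subset_inter_right _ (Function.support_add f₁ f₂)

theorem RFin.smul {f : G → ℂ} (c : ℂ) (h : RFin f) : RFin (c • f) := fun x =>
  (h x).subset (Set.inter_subset_inter_right _ (Function.support_const_smul_subset c f))

theorem rFin_of_mem_CcOn {B : Set G} (hB : IsOpenBisection B) {f : G → ℂ} (hf : f ∈ CcOn B) :
    RFin f := by
  intro x
  have := hB.t2
  obtain ⟨-, K, hKB, -, h0⟩ := mem_CcOn_iff.1 hf
  refine Set.Subsingleton.finite ?_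
  rintro g ⟨hg, hg'⟩ h ⟨hh, hh'⟩
  refine hB.injOn_r (hKB ?_) (hKB ?_) ((show r g = x from hg).trans (show r h = x from hh).symm)
  · by_contra h
    exact hg' (h0 _ h)
  · by_contra h
    exact hh' (h0 _ h)

theorem rFin_of_mem_Cc {U : Set G} {f : G → ℂ} (hf : f ∈ Cc U) : RFin f := by
  rw [Cc_eq_span] at hf
  induction hf using Submodule.span_induction with
  | mem f h =>
    obtain ⟨B, hB, -, hf⟩ := h
    exact rFin_of_mem_CcOn hB hf
  | zero => exact fun x => by simp
  | add f₁ f₂ _ _ h₁ h₂ => exact h₁.add h₂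
  | smul c f _ h => exact h.smul c

/-- The product of two sets of arrows. -/
def setMul (B₁ B₂ : Set G) : Set G := {g | ∃ h ∈ B₁, ∃ k ∈ B₂, src h = rng k ∧ mul h k = g}

theorem conv_mem_CcOn {B₁ B₂ : Set G} (h₁ : IsOpenBisection B₁) (h₂ : IsOpenBisection B₂)
    {f₁ f₂ : G → ℂ} (hf₁ : f₁ ∈ CcOn B₁) (hf₂ : f₂ ∈ CcOn B₂) :
    IsOpen (setMul B₁ B₂) ∧ Set.InjOn (r : G → UnitSpace G) (setMul B₁ B₂) ∧
      conv f₁ f₂ ∈ CcOn (setMul B₁ B₂) := by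
  have := h₁.t2
  have := h₂.t2
  obtain ⟨hc₁, K₁, hK₁B, hK₁, hz₁⟩ := mem_CcOn_iff.1 hf₁
  obtain ⟨hc₂, K₂, hK₂B, hK₂, hz₂⟩ := mem_CcOn_iff.1 hf₂
  have key : ∀ g ∈ setMul B₁ B₂, ∃ h ∈ B₁, r h = r g ∧ mul (inv h) g ∈ B₂ := by
    rintro _ ⟨h, hh, k, hk, e, rfl⟩
    refine ⟨h, hh, r_eq_iff.2 (rng_mul _ _ e).symm, ?_⟩
    rwa [inv_mul_mul _ _ e]
  have key' : ∀ g, ∀ h ∈ B₁, r h = r g → mul (inv h) g ∈ B₂ → g ∈ setMul B₁ B₂ := by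
    intro g h hh e hk
    refine ⟨h, hh, _, hk, ?_, mul_inv_mul _ _ (r_eq_iff.1 e)⟩
    rw [rng_mul _ _ ((src_inv h).trans (r_eq_iff.1 e)), rng_inv]
  have hinj : Set.InjOn (r : G → UnitSpace G) (setMul B₁ B₂) := by
    intro g hg g' hg' e
    obtain ⟨h, hh, e1, hk⟩ := key g hg
    obtain ⟨h', hh', e1', hk'⟩ := key g' hg'
    obtain rfl : h = h' := h₁.injOn_r hh hh' (e1.trans (e.trans e1'.symm))
    have e2 : mul (inv h) g = mul (inv h) g' := by
      refine h₂.injOn_r hk hk' (r_eq_iff.2 ?_)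
      rw [rng_mul _ _ ((src_inv h).trans (r_eq_iff.1 e1)),
        rng_mul _ _ ((src_inv h).trans (r_eq_iff.1 e1'))]
    rw [← mul_inv_mul h g (r_eq_iff.1 e1), e2, mul_inv_mul h g' (r_eq_iff.1 e1')]
  -- the arrow of the first bisection with the same range
  have hex : ∀ g : G, r g ∈ r '' B₁ → ∃ h ∈ B₁, r h = r g := fun g hg => hg
  choose! σ hσB hσr using hex
  set D : Set G := r ⁻¹' (r '' B₁) with hD
  have hDo : IsOpen D :=
    (IsLCEtaleGroupoid.isLocalHomeomorph_r.isOpenMap _ h₁.isOpen).preimage continuous_r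
  have hσc : ContinuousOn σ D := by
    intro g hg
    refine ContinuousAt.continuousWithinAt ?_
    intro W hW
    obtain ⟨W', hW'W, hW'o, hgW'⟩ := mem_nhds_iff.1 hW
    have hO : IsOpen (r ⁻¹' (r '' (B₁ ∩ W')) : Set G) :=
      (IsLCEtaleGroupoid.isLocalHomeomorph_r.isOpenMap _ (h₁.isOpen.inter hW'o)).preimage
        continuous_r
    refine Filter.mem_map.2 (Filter.mem_of_superset (hO.mem_nhds ⟨σ g, ⟨hσB g hg, hgW'⟩, hσr g hg⟩) ?_)
    rintro g' ⟨b, ⟨hb, hbW⟩, e⟩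
    have hg' : r g' ∈ r '' B₁ := ⟨b, hb, e⟩
    have : σ g' = b := h₁.injOn_r (hσB g' hg') hb ((hσr g' hg').trans e.symm)
    exact hW'W (by rw [this]; exact hbW)
  have huc : ContinuousOn (fun g => mul (inv (σ g)) g) D := by
    refine IsLCEtaleGroupoid.continuousOn_mul.comp
      ((continuous_inv'.comp_continuousOn hσc).prodMk continuousOn_id) ?_
    intro g hg
    exact (src_inv _).trans (r_eq_iff.1 (hσr g hg))
  have hPD : setMul B₁ B₂ = D ∩ (fun g => mul (inv (σ g)) g) ⁻¹' B₂ := by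
    ext g
    constructor
    · intro hg
      obtain ⟨h, hh, e, hk⟩ := key g hg
      have hgD : g ∈ D := ⟨h, hh, e⟩
      refine ⟨hgD, ?_⟩
      obtain rfl : σ g = h := h₁.injOn_r (hσB g hgD) hh ((hσr g hgD).trans e.symm)
      exact hk
    · rintro ⟨hgD, hk⟩
      exact key' g (σ g) (hσB g hgD) (hσr g hgD) hk
  have hPo : IsOpen (setMul B₁ B₂) := by
    rw [hPD]
    exact huc.isOpen_inter_preimage hDo h₂.isOpen
  refine ⟨hPo, hinj, ?_⟩
  have := t2_of_injOn hinj
  have nz : ∀ g, conv f₁ f₂ g ≠ 0 → ∃ h ∈ K₁, r h = r g ∧ mul (inv h) g ∈ K₂ := by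
    intro g hg
    obtain ⟨h, hh, hne⟩ := exists_ne_zero_of_finsum_mem_ne_zero hg
    refine ⟨h, ?_, hh, ?_⟩
    · by_contra hn
      exact left_ne_zero_of_mul hne (hz₁ _ hn)
    · by_contra hn
      exact right_ne_zero_of_mul hne (hz₂ _ hn)
  refine mem_CcOn_iff.2 ⟨?_, (fun p : G × G => mul p.1 p.2) ''
    ((K₁ ×ˢ K₂) ∩ {p | src p.1 = rng p.2}), ?_, ?_, ?_⟩
  · have : Set.EqOn (conv f₁ f₂) (fun g => f₁ (σ g) * f₂ (mul (inv (σ g)) g))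
        (setMul B₁ B₂) := by
      intro g hg
      rw [hPD] at hg
      have hg1 := hg.1
      change ∑ᶠ h ∈ {h : G | r h = r g}, f₁ h * f₂ (mul (inv h) g) = _
      rw [finsum_eq_single _ (σ g)]
      · exact finsum_eq_single _ (hσr g hg1) (fun x hx => absurd rfl hx)
      · intro h hne
        by_contra hn
        obtain ⟨hh, -⟩ : ∃ _ : h ∈ {h : G | r h = r g}, f₁ h * f₂ (mul (inv h) g) ≠ 0 := by
          by_contra hcon
          push Not at hcon
          exact hn (by
            rw [finsum_congr hcon]
            exact finsum_zero)
        have hfh : f₁ h * f₂ (mul (inv h) g) ≠ 0 := fun h0 => hn (by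
          rw [finsum_congr fun _ => h0]
          exact finsum_zero)
        have hhB : h ∈ B₁ := by
          by_contra hb
          exact left_ne_zero_of_mul hfh (hz₁ _ fun hk => hb (hK₁B hk))
        exact hne (h₁.injOn_r hhB (hσB g hg1) ((show r h = r g from hh).trans (hσr g hg1).symm))
    refine ContinuousOn.congr ?_ this
    rw [hPD]
    refine ContinuousOn.mul ?_ ?_
    · exact hc₁.comp (hσc.mono Set.inter_subset_left) fun g hg => hσB g hg.1
    · exact hc₂.comp (huc.mono Set.inter_subset_left) fun g hg => hg.2
  · rintro _ ⟨⟨h, k⟩, ⟨⟨hh, hk⟩, e⟩, rfl⟩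
    exact ⟨h, hK₁B hh, k, hK₂B hk, e, rfl⟩
  · refine IsCompact.image_of_continuousOn ?_
      (IsLCEtaleGroupoid.continuousOn_mul.mono Set.inter_subset_right)
    refine (hK₁.prod hK₂).inter_right ?_
    have : {p : G × G | src p.1 = rng p.2} = {p : G × G | s p.1 = r p.2} := by
      ext p
      exact (Subtype.ext_iff (a1 := s p.1) (a2 := r p.2)).symm
    rw [this]
    exact isClosed_eq (continuous_s.comp continuous_fst) (continuous_r.comp continuous_snd)
  · intro g hg
    by_contra hn
    obtain ⟨h, hh, e, hk⟩ := nz g hn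
    refine hg ⟨(h, mul (inv h) g), ⟨⟨hh, hk⟩, ?_⟩, mul_inv_mul _ _ (r_eq_iff.1 e)⟩
    exact ((rng_mul _ _ ((src_inv h).trans (r_eq_iff.1 e))).trans (rng_inv h)).symm

theorem conv_mem_Cc {f₁ f₂ : G → ℂ} (h₁ : f₁ ∈ Cc (Set.univ : Set G))
    (h₂ : f₂ ∈ Cc (Set.univ : Set G)) : conv f₁ f₂ ∈ Cc (Set.univ : Set G) := by
  have h₁' := h₁
  have h₂' := h₂
  rw [Cc_eq_span] at h₁' h₂'
  induction h₁', h₂' using Submodule.span_induction₂ with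
  | mem_mem f₁ f₂ hf₁ hf₂ =>
    obtain ⟨B₁, hB₁, -, hf₁⟩ := hf₁
    obtain ⟨B₂, hB₂, -, hf₂⟩ := hf₂
    obtain ⟨ho, hi, hc⟩ := conv_mem_CcOn hB₁ hB₂ hf₁ hf₂
    have := t2_of_injOn hi
    exact CcOn_le_Cc (Set.subset_univ _) ho hc
  | zero_left f _ => rw [zero_conv]; exact Submodule.zero_mem _
  | zero_right f _ => rw [conv_zero]; exact Submodule.zero_mem _
  | add_left f f' k hf hf' hk i i' =>
    rw [← Cc_eq_span] at hf hf' hk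
    rw [add_conv (rFin_of_mem_Cc hf) (rFin_of_mem_Cc hf')]
    exact Submodule.add_mem _ (i hf hk) (i' hf' hk)
  | add_right f k k' hf hk hk' i i' =>
    rw [← Cc_eq_span] at hf hk hk'
    rw [conv_add (rFin_of_mem_Cc hf)]
    exact Submodule.add_mem _ (i hf hk) (i' hf hk')
  | smul_left c f k hf hk i =>
    rw [← Cc_eq_span] at hf hk
    rw [smul_conv]
    exact Submodule.smul_mem _ _ (i hf hk)
  | smul_right c f k hf hk i =>
    rw [← Cc_eq_span] at hf hk
    rw [conv_smul]
    exact Submodule.smul_mem _ _ (i hf hk)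

theorem IsOpenBisection.preimage_inv {B : Set G} (hB : IsOpenBisection B) :
    IsOpenBisection (inv ⁻¹' B : Set G) where
  isOpen := hB.isOpen.preimage continuous_inv'
  injOn_r g hg h hh e := by
    have : inv g = inv h := hB.injOn_s hg hh
      (s_eq_iff.2 (by rw [src_inv, src_inv]; exact r_eq_iff.1 e))
    rw [← inv_inv g, this, inv_inv]
  injOn_s g hg h hh e := by
    have : inv g = inv h := hB.injOn_r hg hh
      (r_eq_iff.2 (by rw [rng_inv, rng_inv]; exact s_eq_iff.1 e))
    rw [← inv_inv g, this, inv_inv]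

theorem invol_mem_CcOn {B : Set G} (hB : IsOpenBisection B) {f : G → ℂ} (hf : f ∈ CcOn B) :
    invol f ∈ CcOn (inv ⁻¹' B : Set G) := by
  have := hB.t2
  have := hB.preimage_inv.t2
  obtain ⟨hc, K, hKB, hK, h0⟩ := mem_CcOn_iff.1 hf
  refine mem_CcOn_iff.2 ⟨?_, inv '' K, ?_, hK.image continuous_inv', ?_⟩
  · exact continuous_star.comp_continuousOn (hc.comp continuous_inv'.continuousOn fun g hg => hg)
  · rintro _ ⟨k, hk, rfl⟩
    rw [Set.mem_preimage, inv_inv]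
    exact hKB hk
  · intro g hg
    rw [invol, h0 (inv g) fun h => hg ⟨inv g, h, inv_inv g⟩, star_zero]

theorem invol_add (f₁ f₂ : G → ℂ) : invol (f₁ + f₂) = invol f₁ + invol f₂ := by
  funext g
  simp [invol]

theorem invol_smul (c : ℂ) (f : G → ℂ) : invol (c • f) = star c • invol f := by
  funext g
  simp [invol]

theorem invol_mem_Cc {f : G → ℂ} (h : f ∈ Cc (Set.univ : Set G)) :
    invol f ∈ Cc (Set.univ : Set G) := by
  rw [Cc_eq_span] at h
  induction h using Submodule.span_induction with
  | mem f h =>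
    obtain ⟨B, hB, -, hf⟩ := h
    have := hB.preimage_inv.t2
    exact CcOn_le_Cc (Set.subset_univ _) hB.preimage_inv.isOpen (invol_mem_CcOn hB hf)
  | zero =>
    have : invol (0 : G → ℂ) = 0 := by
      funext g
      simp [invol]
    rw [this]
    exact Submodule.zero_mem _
  | add f₁ f₂ _ _ h₁ h₂ => rw [invol_add]; exact Submodule.add_mem _ h₁ h₂
  | smul c f _ h => rw [invol_smul]; exact Submodule.smul_mem _ _ h

end Etale

/-! ### The *-algebra `C_c(G)` and the full groupoid C*-algebra -/

section ConvolutionAlgebra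

set_option linter.unusedSectionVars false

variable (G : Type*) [TopologicalSpace G] [ArrowGroupoid G]

/-- The space `C_c(G)`, regarded as a *-algebra with the convolution product. -/
def CcAlg : Type _ := ↥(Cc (Set.univ : Set G))

instance : AddCommGroup (CcAlg G) := inferInstanceAs (AddCommGroup ↥(Cc (Set.univ : Set G)))
instance : Module ℂ (CcAlg G) := inferInstanceAs (Module ℂ ↥(Cc (Set.univ : Set G)))

variable {G}

/-- The function on `G` underlying an element of `C_c(G)`. -/
def CcAlg.fn (f : CcAlg G) : G → ℂ := f.1

theorem CcAlg.fn_mem (f : CcAlg G) : f.fn ∈ Cc (Set.univ : Set G) := f.2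

theorem CcAlg.ext {f₁ f₂ : CcAlg G} (h : f₁.fn = f₂.fn) : f₁ = f₂ := Subtype.ext h

/-- A function in `C_c(G)` as an element of the *-algebra. -/
def CcAlg.mk (f : G → ℂ) (h : f ∈ Cc (Set.univ : Set G)) : CcAlg G := ⟨f, h⟩

theorem CcAlg.fn_mk (f : G → ℂ) (h : f ∈ Cc (Set.univ : Set G)) : (CcAlg.mk f h).fn = f := rfl

theorem CcAlg.fn_add (f₁ f₂ : CcAlg G) : (f₁ + f₂).fn = f₁.fn + f₂.fn := rfl

theorem CcAlg.fn_zero : (0 : CcAlg G).fn = 0 := rfl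

theorem CcAlg.fn_smul (c : ℂ) (f : CcAlg G) : (c • f).fn = c • f.fn := rfl

variable [IsLCEtaleGroupoid G]

instance : Mul (CcAlg G) := ⟨fun f₁ f₂ => .mk (conv f₁.fn f₂.fn) (conv_mem_Cc f₁.fn_mem f₂.fn_mem)⟩

instance : Star (CcAlg G) := ⟨fun f => .mk (invol f.fn) (invol_mem_Cc f.fn_mem)⟩

theorem CcAlg.fn_mul (f₁ f₂ : CcAlg G) : (f₁ * f₂).fn = conv f₁.fn f₂.fn := rfl

theorem CcAlg.fn_star (f : CcAlg G) : (star f).fn = invol f.fn := rfl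

theorem CcAlg.rFin (f : CcAlg G) : RFin f.fn := rFin_of_mem_Cc f.fn_mem

instance : NonUnitalRing (CcAlg G) :=
  { (inferInstance : AddCommGroup (CcAlg G)), (inferInstance : Mul (CcAlg G)) with
    zero_mul := fun f => CcAlg.ext (zero_conv f.fn)
    mul_zero := fun f => CcAlg.ext (conv_zero f.fn)
    mul_assoc := fun f₁ f₂ _ => CcAlg.ext (conv_assoc f₁.rFin f₂.rFin)
    left_distrib := fun f₁ _ _ => CcAlg.ext (conv_add f₁.rFin)
    right_distrib := fun f₁ f₂ _ => CcAlg.ext (add_conv f₁.rFin f₂.rFin) }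

instance : IsScalarTower ℂ (CcAlg G) (CcAlg G) :=
  ⟨fun c f₁ f₂ => CcAlg.ext (smul_conv c f₁.fn f₂.fn)⟩

instance : SMulCommClass ℂ (CcAlg G) (CcAlg G) :=
  ⟨fun c f₁ f₂ => CcAlg.ext (conv_smul c f₁.fn f₂.fn).symm⟩

instance : StarRing (CcAlg G) where
  star_involutive f := CcAlg.ext (invol_invol f.fn)
  star_mul f₁ f₂ := CcAlg.ext (invol_conv f₁.fn f₂.fn)
  star_add f₁ f₂ := CcAlg.ext (invol_add f₁.fn f₂.fn)

instance : StarModule ℂ (CcAlg G) := ⟨fun c f => CcAlg.ext (invol_smul c f.fn)⟩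

end ConvolutionAlgebra

end ArrowGroupoid

/-! ### Extension of *-homomorphisms from `C_c(Y)` to `C₀(Y)` -/

section CZero

set_option linter.unusedSectionVars false

variable {Y : Type*} [TopologicalSpace Y] [T2Space Y]

/-- The inclusion of `C_c(Y)` into `C₀(Y)`. -/
def ccToCZero : C_c(Y, ℂ) →⋆ₙₐ[ℂ] C₀(Y, ℂ) where
  toFun f :=
    { toFun := f
      continuous_toFun := f.continuous
      zero_at_infty' := f.hasCompactSupport.is_zero_at_infty }
  map_smul' _ _ := rfl
  map_zero' := rfl
  map_add' _ _ := rfl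
  map_mul' _ _ := rfl
  map_star' _ := rfl

theorem ccToCZero_apply (f : C_c(Y, ℂ)) (y : Y) : ccToCZero f y = f y := rfl

theorem norm_le_of_bound (f : C₀(Y, ℂ)) {M : ℝ} (hM : 0 ≤ M) (h : ∀ y, ‖f y‖ ≤ M) : ‖f‖ ≤ M := by
  rw [← ZeroAtInftyContinuousMap.norm_toBCF_eq_norm]
  exact (BoundedContinuousFunction.norm_le hM).2 h

theorem norm_apply_le_norm (f : C₀(Y, ℂ)) (y : Y) : ‖f y‖ ≤ ‖f‖ := by
  rw [← ZeroAtInftyContinuousMap.norm_toBCF_eq_norm]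
  exact f.toBCF.norm_coe_le_norm y

/-- The C*-algebra of functions in `C₀(Y)` vanishing off `K`. -/
def supportedIn (K : Set Y) : NonUnitalStarSubalgebra ℂ C₀(Y, ℂ) where
  carrier := {f | ∀ y, y ∉ K → f y = 0}
  add_mem' {f g} hf hg y hy := by
    rw [ZeroAtInftyContinuousMap.add_apply, hf y hy, hg y hy, add_zero]
  zero_mem' _ _ := rfl
  mul_mem' {f g} hf hg y hy := by
    rw [ZeroAtInftyContinuousMap.mul_apply, hf y hy, zero_mul]
  smul_mem' c f hf y hy := by
    rw [ZeroAtInftyContinuousMap.smul_apply, hf y hy, smul_zero]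
  star_mem' {f} hf y hy := by
    change star (f y) = 0
    rw [hf y hy, star_zero]

theorem isClosed_supportedIn (K : Set Y) : IsClosed (supportedIn K : Set C₀(Y, ℂ)) := by
  have h : (supportedIn K : Set C₀(Y, ℂ)) = ⋂ y ∈ Kᶜ, {f : C₀(Y, ℂ) | f y = 0} := by
    ext f
    simp only [Set.mem_iInter]
    rfl
  rw [h]
  refine isClosed_biInter fun y _ => isClosed_eq ?_ continuous_const
  have h2 : LipschitzWith 1 fun f : C₀(Y, ℂ) => f y := by
    refine LipschitzWith.of_dist_le_mul fun f g => ?_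
    rw [NNReal.coe_one, one_mul, dist_eq_norm, dist_eq_norm]
    exact norm_apply_le_norm (f - g) y
  exact h2.continuous

/-- The functions in `C₀(Y)` vanishing off a compact set as elements of `C_c(Y)`. -/
def supportedInToCc (K : Set Y) (hK : IsCompact K) : supportedIn K →⋆ₙₐ[ℂ] C_c(Y, ℂ) where
  toFun f := ⟨f.1.toContinuousMap, HasCompactSupport.intro hK fun y hy => f.2 y hy⟩
  map_smul' _ _ := rfl
  map_zero' := rfl
  map_add' _ _ := rfl
  map_mul' _ _ := rfl
  map_star' _ := rfl

theorem CStarSeminorm.le_of_bound (q : CStarSeminorm C_c(Y, ℂ)) (f : C_c(Y, ℂ)) {M : ℝ}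
    (hM : 0 ≤ M) (h : ∀ y, ‖f y‖ ≤ M) : q f ≤ M := by
  have hcl : IsClosed (supportedIn (tsupport f) : Set C₀(Y, ℂ)) := isClosed_supportedIn _
  let θ := q.toCompl.comp (supportedInToCc (tsupport f) f.hasCompactSupport)
  let f' : supportedIn (tsupport f) :=
    ⟨ccToCZero f, fun y hy => image_eq_zero_of_notMem_tsupport hy⟩
  have h1 : ‖θ f'‖ ≤ ‖f'‖ := NonUnitalStarAlgHom.norm_apply_le θ f'
  have h2 : ‖θ f'‖ = q f := q.norm_toCompl f
  rw [← h2]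
  exact h1.trans (norm_le_of_bound (ccToCZero f) hM h)

theorem denseRange_ccToCZero [LocallyCompactSpace Y] :
    DenseRange (ccToCZero : C_c(Y, ℂ) → C₀(Y, ℂ)) := by
  intro f
  rw [Metric.mem_closure_range_iff]
  intro ε hε
  have hz := f.zero_at_infty'
  have h1 : ∀ᶠ y in Filter.cocompact Y, ‖f y‖ < ε / 2 := by
    have h2 := hz.eventually (Metric.ball_mem_nhds (0 : ℂ) (half_pos hε))
    filter_upwards [h2] with y hy
    simpa using hy
  obtain ⟨K, hK, hKf⟩ := Filter.mem_cocompact.1 h1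
  obtain ⟨χ, hχ1, -, hχc, hχ01⟩ := exists_continuous_one_zero_of_isCompact hK isClosed_empty
    (Set.disjoint_empty K)
  let g : C_c(Y, ℂ) := ⟨⟨fun y => (χ y : ℂ) * f y,
    (Complex.continuous_ofReal.comp χ.continuous).mul f.continuous⟩, by
      refine hχc.mono ?_
      intro y hy
      have : (χ y : ℂ) ≠ 0 := left_ne_zero_of_mul hy
      exact fun h0 => this (by rw [h0, Complex.ofReal_zero])⟩
  refine ⟨g, ?_⟩
  rw [dist_eq_norm]
  refine lt_of_le_of_lt (norm_le_of_bound _ (half_pos hε).le fun y => ?_) (half_lt_self hε)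
  change ‖f y - (χ y : ℂ) * f y‖ ≤ ε / 2
  by_cases hy : y ∈ K
  · rw [hχ1 hy]
    simpa using (half_pos hε).le
  · have h3 : ‖f y‖ < ε / 2 := hKf hy
    have h4 : f y - (χ y : ℂ) * f y = ((1 - χ y : ℝ) : ℂ) * f y := by
      push_cast
      ring
    rw [h4, norm_mul, Complex.norm_real, Real.norm_of_nonneg (by linarith [(hχ01 y).2])]
    nlinarith [(hχ01 y).1, norm_nonneg (f y)]

variable {B : Type*} [NonUnitalCStarAlgebra B] [LocallyCompactSpace Y]

theorem norm_le_ccToCZero (φ : C_c(Y, ℂ) →⋆ₙₐ[ℂ] B) (f : C_c(Y, ℂ)) :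
    ‖φ f‖ ≤ ‖ccToCZero f‖ :=
  CStarSeminorm.le_of_bound ((CStarSeminorm.ofNorm B).comap φ) f (norm_nonneg _)
    fun y => norm_apply_le_norm (ccToCZero f) y

/-- The continuous linear extension to `C₀(Y)` of a *-homomorphism on `C_c(Y)`. -/
def extendCZeroL (φ : C_c(Y, ℂ) →⋆ₙₐ[ℂ] B) : C₀(Y, ℂ) →L[ℂ] B :=
  LinearMap.extendOfNorm (φ : C_c(Y, ℂ) →ₗ[ℂ] B)
    ((ccToCZero : C_c(Y, ℂ) →⋆ₙₐ[ℂ] C₀(Y, ℂ)) : C_c(Y, ℂ) →ₗ[ℂ] _)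

theorem extendCZeroL_apply (φ : C_c(Y, ℂ) →⋆ₙₐ[ℂ] B) (f : C_c(Y, ℂ)) :
    extendCZeroL φ (ccToCZero f) = φ f :=
  LinearMap.extendOfNorm_eq denseRange_ccToCZero
    ⟨1, fun x => by rw [one_mul]; exact norm_le_ccToCZero φ x⟩ f

/-- The extension to `C₀(Y)` of a *-homomorphism from `C_c(Y)` to a C*-algebra. -/
def extendCZero (φ : C_c(Y, ℂ) →⋆ₙₐ[ℂ] B) : C₀(Y, ℂ) →⋆ₙₐ[ℂ] B :=
  { extendCZeroL φ with
    map_smul' := fun c a => (extendCZeroL φ).map_smul c a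
    map_zero' := (extendCZeroL φ).map_zero
    map_mul' := fun a b => by
      change extendCZeroL φ (a * b) = extendCZeroL φ a * extendCZeroL φ b
      refine denseRange_ccToCZero.induction_on₂
        (isClosed_eq (by fun_prop) (by fun_prop)) (fun a b => ?_) a b
      rw [← map_mul, extendCZeroL_apply, extendCZeroL_apply, extendCZeroL_apply, map_mul]
    map_star' := fun a => by
      change extendCZeroL φ (star a) = star (extendCZeroL φ a)
      refine denseRange_ccToCZero.induction_on
        (p := fun a => extendCZeroL φ (star a) = star (extendCZeroL φ a)) a
        (isClosed_eq (by fun_prop) (by fun_prop)) (fun a => ?_)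
      rw [← map_star, extendCZeroL_apply, extendCZeroL_apply, map_star] }

theorem extendCZero_apply (φ : C_c(Y, ℂ) →⋆ₙₐ[ℂ] B) (f : C_c(Y, ℂ)) :
    extendCZero φ (ccToCZero f) = φ f := extendCZeroL_apply φ f

end CZero

namespace ArrowGroupoid

section FullCStar

set_option linter.unusedSectionVars false

variable {G : Type*} [TopologicalSpace G] [ArrowGroupoid G] [IsLCEtaleGroupoid G]

/-- The unit space as a subset of the set of arrows. -/
def units (G : Type*) [ArrowGroupoid G] : Set G := {x | src x = x}

theorem isOpen_units : IsOpen (units G) := by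
  rw [isOpen_iff_mem_nhds]
  intro x hx
  obtain ⟨B, hxB, -, -, hB⟩ := exists_bisection (isOpen_univ (X := G)) (Set.mem_univ x)
  have h1 : IsOpen ((fun g : G => ((s g : UnitSpace G) : G)) ⁻¹' B) :=
    hB.isOpen.preimage (continuous_subtype_val.comp continuous_s)
  have hx1 : src x ∈ B := by rw [show src x = x from hx]; exact hxB
  refine Filter.mem_of_superset ((hB.isOpen.inter h1).mem_nhds ⟨hxB, hx1⟩) ?_
  rintro g ⟨hg, hg1⟩
  exact hB.injOn_s hg1 hg (s_eq_iff.2 (src_src g))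

instance t2_unitsSet : T2Space (units G) := inferInstanceAs (T2Space (UnitSpace G))

/-- Extension by zero of a function on the unit space. -/
def extendUnits (φ : UnitSpace G → ℂ) : G → ℂ := Function.extend (Subtype.val : UnitSpace G → G) φ 0

theorem extendUnits_coe (φ : UnitSpace G → ℂ) (x : UnitSpace G) : extendUnits φ (x : G) = φ x :=
  Subtype.val_injective.extend_apply φ 0 x

theorem extendUnits_of_not (φ : UnitSpace G → ℂ) {g : G} (hg : src g ≠ g) :
    extendUnits φ g = 0 := by
  refine (Function.extend_apply' _ _ _ ?_).trans rfl
  rintro ⟨x, rfl⟩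
  exact hg x.2

theorem extendUnits_mem_CcOn (φ : C_c(UnitSpace G, ℂ)) : extendUnits φ ∈ CcOn (units G) := ⟨φ, rfl⟩

theorem inv_unit (x : UnitSpace G) : inv (x : G) = x := by
  have h := mul_inv (x : G)
  have h1 := rng_mul_self (inv (x : G))
  rw [rng_inv, x.2, h, rng_unit] at h1
  exact h1.symm

theorem inv_eq_unit {g : G} (h : src (inv g) = inv g) : src g = g := by
  have := inv_unit (⟨inv g, h⟩ : UnitSpace G)
  rw [inv_inv] at this
  rw [show g = inv g from this]
  exact h

theorem conv_extendUnits (φ ψ : UnitSpace G → ℂ) :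
    conv (extendUnits φ) (extendUnits ψ) = extendUnits (φ * ψ) := by
  funext g
  have h1 : conv (extendUnits φ) (extendUnits ψ) g = φ (r g) * extendUnits ψ g := by
    rw [conv, finsum_eq_single _ ((r g : UnitSpace G) : G)]
    · refine (finsum_eq_single _ (show ((r g : UnitSpace G) : G) ∈ {h : G | r h = r g} from
        r_unit (r g)) (fun x hx => absurd rfl hx)).trans ?_
      rw [extendUnits_coe, inv_unit]
      congr 2
      exact rng_mul_self g
    · intro h hne
      by_cases hu : src h = h
      · have hr : r h ≠ r g := fun e => hne (by rw [← e]; exact (rng_unit ⟨h, hu⟩).symm)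
        exact (finsum_congr (g := fun _ => (0 : ℂ)) fun (e : r h = r g) => absurd e hr).trans
          finsum_zero
      · simp only [extendUnits_of_not φ hu, zero_mul]
        exact finsum_zero
  rw [h1]
  by_cases hu : src g = g
  · have e : r g = ⟨g, hu⟩ := r_unit ⟨g, hu⟩
    rw [e, show extendUnits ψ g = ψ ⟨g, hu⟩ from extendUnits_coe ψ ⟨g, hu⟩,
      show extendUnits (φ * ψ) g = (φ * ψ) ⟨g, hu⟩ from extendUnits_coe (φ * ψ) ⟨g, hu⟩]
    rfl
  · rw [extendUnits_of_not _ hu, extendUnits_of_not _ hu, mul_zero]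

theorem invol_extendUnits (φ : UnitSpace G → ℂ) :
    invol (extendUnits φ) = extendUnits (star φ) := by
  funext g
  by_cases hu : src g = g
  · have h1 : inv g = g := inv_unit ⟨g, hu⟩
    rw [invol, h1, show extendUnits φ g = φ ⟨g, hu⟩ from extendUnits_coe φ ⟨g, hu⟩,
      show extendUnits (star φ) g = (star φ) ⟨g, hu⟩ from extendUnits_coe (star φ) ⟨g, hu⟩]
    rfl
  · rw [extendUnits_of_not _ hu, invol, extendUnits_of_not _ fun h => hu (inv_eq_unit h), star_zero]

theorem extendUnits_add (φ ψ : UnitSpace G → ℂ) :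
    extendUnits (φ + ψ) = extendUnits φ + extendUnits ψ := by
  funext g
  by_cases hu : src g = g
  · exact (extendUnits_coe _ ⟨g, hu⟩).trans
      (congrArg₂ (· + ·) (extendUnits_coe φ ⟨g, hu⟩) (extendUnits_coe ψ ⟨g, hu⟩)).symm
  · rw [Pi.add_apply, extendUnits_of_not _ hu, extendUnits_of_not _ hu, extendUnits_of_not _ hu,
      add_zero]

theorem extendUnits_smul (c : ℂ) (φ : UnitSpace G → ℂ) :
    extendUnits (c • φ) = c • extendUnits φ := by
  funext g
  by_cases hu : src g = g
  · exact (extendUnits_coe _ ⟨g, hu⟩).trans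
      (congrArg (c • ·) (extendUnits_coe φ ⟨g, hu⟩)).symm
  · rw [Pi.smul_apply, extendUnits_of_not _ hu, extendUnits_of_not _ hu, smul_zero]

/-- The inclusion of `C_c(G⁰)`, with the pointwise operations, into `C_c(G)`, by extension
by zero. -/
def unitsHom : C_c(UnitSpace G, ℂ) →⋆ₙₐ[ℂ] CcAlg G where
  toFun φ := .mk (extendUnits φ)
    (CcOn_le_Cc (Set.subset_univ _) isOpen_units (extendUnits_mem_CcOn φ))
  map_smul' c φ := CcAlg.ext (extendUnits_smul c φ)
  map_zero' := CcAlg.ext (by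
    have := extendUnits_smul (G := G) 0 0
    rw [zero_smul, zero_smul] at this
    exact this)
  map_add' φ ψ := CcAlg.ext (extendUnits_add φ ψ)
  map_mul' φ ψ := CcAlg.ext (conv_extendUnits φ ψ).symm
  map_star' φ := CcAlg.ext (invol_extendUnits φ).symm

theorem fn_unitsHom (φ : C_c(UnitSpace G, ℂ)) : (unitsHom φ).fn = extendUnits φ := rfl

theorem CcOn_mono {V V' : Set G} (hVV : V ⊆ V') (hV : IsOpen V) [T2Space V'] :
    CcOn V ⊆ CcOn V' := by
  intro f hf
  have : T2Space V := T2Space.of_injective_continuous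
    (f := Set.inclusion hVV) (Set.inclusion_injective hVV) (continuous_inclusion hVV)
  obtain ⟨hc, K, hKV, hK, h0⟩ := mem_CcOn_iff.1 hf
  refine mem_CcOn_iff.2 ⟨?_, K, hKV.trans hVV, hK, h0⟩
  have hKc : IsClosed (Subtype.val ⁻¹' K : Set V') := by
    refine IsCompact.isClosed ?_
    rw [Subtype.isCompact_iff, Subtype.image_preimage_coe, Set.inter_eq_right.2 (hKV.trans hVV)]
    exact hK
  intro x hx
  by_cases hxV : x ∈ V
  · exact (hc.continuousAt (hV.mem_nhds hxV)).continuousWithinAt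
  · have hev : ∀ᶠ g in nhdsWithin x V', f g = 0 := by
      have h1 : (Subtype.val ⁻¹' K : Set V')ᶜ ∈ nhds (⟨x, hx⟩ : V') :=
        hKc.isOpen_compl.mem_nhds fun h => hxV (hKV h)
      rw [nhds_subtype_eq_comap, Filter.mem_comap] at h1
      obtain ⟨O, hO, hOK⟩ := h1
      refine Filter.mem_of_superset
        (Filter.inter_mem (mem_nhdsWithin_of_mem_nhds hO) self_mem_nhdsWithin) ?_
      rintro g ⟨hgO, hgV⟩
      exact h0 g fun hgK => hOK (a := ⟨g, hgV⟩) hgO hgK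
    refine ContinuousWithinAt.congr_of_eventuallyEq (f := fun _ => (0 : ℂ))
      continuousWithinAt_const hev ?_
    exact h0 x fun h => hxV (hKV h)

theorem star_mul_self_mem {B : Set G} (hB : IsOpenBisection B) {f : G → ℂ} (hf : f ∈ CcOn B) :
    conv (invol f) f ∈ CcOn (units G) := by
  obtain ⟨ho, -, hc⟩ := conv_mem_CcOn hB.preimage_inv hB (invol_mem_CcOn hB hf) hf
  refine CcOn_mono ?_ ho hc
  rintro _ ⟨h, hh, k, hk, e, rfl⟩
  have h1 : k = inv h := hB.injOn_r hk hh (r_eq_iff.2 (by rw [rng_inv, e]))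
  change src (mul h k) = mul h k
  rw [h1, mul_inv, src_rng]

/-- The supremum of all C*-seminorms on `C_c(G)` is finite. -/
instance : HasEnveloping (CcAlg G) where
  bdd f := by
    suffices h : ∀ (f : G → ℂ), f ∈ Cc (Set.univ : Set G) →
        ∃ C : ℝ, ∀ (hf : f ∈ Cc (Set.univ : Set G)) (p : CStarSeminorm (CcAlg G)),
          p (CcAlg.mk f hf) ≤ C by
      obtain ⟨C, hC⟩ := h f.fn f.fn_mem
      exact ⟨C, by rintro _ ⟨p, rfl⟩; exact hC f.fn_mem p⟩
    intro f hf
    have hf' := hf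
    rw [Cc_eq_span] at hf'
    induction hf' using Submodule.span_induction with
    | mem f h =>
      obtain ⟨B, hB, -, hfB⟩ := h
      obtain ⟨φ, hφ⟩ := star_mul_self_mem hB hfB
      let φ' : C_c(UnitSpace G, ℂ) := φ
      refine ⟨‖ccToCZero φ'‖ + 1, fun hf p => ?_⟩
      have h1 : star (CcAlg.mk f hf) * CcAlg.mk f hf = unitsHom φ' := CcAlg.ext hφ
      have h2 : p (unitsHom φ') ≤ ‖ccToCZero φ'‖ :=
        (p.comap unitsHom).le_of_bound φ' (norm_nonneg _) fun y => norm_apply_le_norm (ccToCZero φ') y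
      have h3 := p.star_mul_self (CcAlg.mk f hf)
      rw [h1] at h3
      nlinarith [p.nonneg (CcAlg.mk f hf), norm_nonneg (ccToCZero φ')]
    | zero => exact ⟨0, fun hf p => (map_zero p.toSeminorm).le⟩
    | add f₁ f₂ h₁ h₂ i₁ i₂ =>
      rw [← Cc_eq_span] at h₁ h₂
      obtain ⟨C₁, hC₁⟩ := i₁ h₁
      obtain ⟨C₂, hC₂⟩ := i₂ h₂
      exact ⟨C₁ + C₂, fun _ p => (map_add_le_add p.toSeminorm (CcAlg.mk f₁ h₁)
        (CcAlg.mk f₂ h₂)).trans (add_le_add (hC₁ h₁ p) (hC₂ h₂ p))⟩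
    | smul c f h i =>
      rw [← Cc_eq_span] at h
      obtain ⟨C, hC⟩ := i h
      exact ⟨‖c‖ * C, fun _ p => (map_smul_eq_mul p.toSeminorm c (CcAlg.mk f h)).le.trans
        (mul_le_mul_of_nonneg_left (hC h p) (norm_nonneg c))⟩

/-- The full groupoid C*-algebra: the enveloping C*-algebra of `C_c(G)`. -/
abbrev FullCStar (G : Type*) [TopologicalSpace G] [ArrowGroupoid G] [IsLCEtaleGroupoid G] :
    Type _ := EnvelopingCStar (CcAlg G)

/-- The canonical *-homomorphism `C_c(G) → C*(G)`. -/
abbrev ofCc : CcAlg G →⋆ₙₐ[ℂ] FullCStar G := EnvelopingCStar.ofAlg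

/-- The inclusion `C₀(G⁰) → C*(G)`, extending the inclusion of `C_c(G⁰)` into `C_c(G)`. -/
def ofCZeroUnits : C₀(UnitSpace G, ℂ) →⋆ₙₐ[ℂ] FullCStar G := extendCZero (ofCc.comp unitsHom)

end FullCStar

end ArrowGroupoid

/-! ### Reductions of a groupoid to invariant sets of units -/

namespace ArrowGroupoid

section Reduction

set_option linter.unusedSectionVars false

/-- A set `X` of units is invariant if `r g ∈ X` is equivalent to `s g ∈ X`, for all arrows `g`. -/
def IsInvariant {G : Type*} [ArrowGroupoid G] (X : Set (UnitSpace G)) : Prop :=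
  ∀ g : G, r g ∈ X ↔ s g ∈ X

theorem IsInvariant.compl {G : Type*} [ArrowGroupoid G] {X : Set (UnitSpace G)}
    (hX : IsInvariant X) : IsInvariant Xᶜ := fun g => not_congr (hX g)

/-- The reduction `G_X = r⁻¹(X) = s⁻¹(X)` of `G` to a locally closed invariant set `X` of units. -/
def Reduction {G : Type*} [TopologicalSpace G] [ArrowGroupoid G] (X : Set (UnitSpace G))
    (_hX : IsInvariant X) (_hl : IsLocallyClosed X) : Type _ := {g : G // r g ∈ X}

variable {G : Type*} [TopologicalSpace G] [ArrowGroupoid G] {X : Set (UnitSpace G)}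
  (hX : IsInvariant X) (hl : IsLocallyClosed X)

namespace Reduction

/-- The inclusion of the reduction `G_X` into `G`. -/
def val (g : Reduction X hX hl) : G := g.1

theorem r_val_mem (g : Reduction X hX hl) : r (val hX hl g) ∈ X := g.2

theorem val_injective : Function.Injective (val hX hl) := Subtype.val_injective

/-- The relative topology. -/
instance : TopologicalSpace (Reduction X hX hl) :=
  inferInstanceAs (TopologicalSpace {g : G // r g ∈ X})

theorem isEmbedding_val : Topology.IsEmbedding (val hX hl) := Topology.IsEmbedding.subtypeVal

theorem continuous_val : Continuous (val hX hl) := (isEmbedding_val hX hl).continuous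

/-- An arrow with range in `X` as an element of the reduction. -/
def mk (g : G) (hg : r g ∈ X) : Reduction X hX hl := ⟨g, hg⟩

theorem val_mk (g : G) (hg : r g ∈ X) : val hX hl (mk hX hl g hg) = g := rfl

theorem ext_val {g h : Reduction X hX hl} (e : val hX hl g = val hX hl h) : g = h :=
  val_injective hX hl e

theorem r_src_mem (hX : IsInvariant X) {g : G} (hg : r g ∈ X) : r (src g) ∈ X := by
  rw [show r (src g) = s g from Subtype.ext (rng_src g)]
  exact (hX g).1 hg

theorem r_rng_mem {g : G} (hg : r g ∈ X) : r (rng g) ∈ X := by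
  rw [show r (rng g) = r g from Subtype.ext (rng_rng g)]
  exact hg

theorem r_inv_mem (hX : IsInvariant X) {g : G} (hg : r g ∈ X) : r (inv g) ∈ X := by
  rw [show r (inv g) = s g from Subtype.ext (rng_inv g)]
  exact (hX g).1 hg

theorem r_mul_mem {g h : G} (e : src g = rng h) (hg : r g ∈ X) : r (mul g h) ∈ X := by
  rw [show r (mul g h) = r g from Subtype.ext (rng_mul _ _ e)]
  exact hg

open Classical in
/-- The restricted product, defined arbitrarily for non-composable arrows. -/
def mulAux (g h : Reduction X hX hl) : Reduction X hX hl :=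
  if e : src (val hX hl g) = rng (val hX hl h) then
    mk hX hl (mul (val hX hl g) (val hX hl h)) (r_mul_mem e (r_val_mem hX hl g))
  else g

theorem val_mulAux (g h : Reduction X hX hl) (e : src (val hX hl g) = rng (val hX hl h)) :
    val hX hl (mulAux hX hl g h) = mul (val hX hl g) (val hX hl h) := by
  rw [mulAux, dif_pos e, val_mk]

/-- The reduction with the restricted groupoid operations. -/
instance : ArrowGroupoid (Reduction X hX hl) where
  src g := mk hX hl (src (val hX hl g)) (r_src_mem hX (r_val_mem hX hl g))
  rng g := mk hX hl (rng (val hX hl g)) (r_rng_mem (r_val_mem hX hl g))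
  mul g h := mulAux hX hl g h
  inv g := mk hX hl (inv (val hX hl g)) (r_inv_mem hX (r_val_mem hX hl g))
  src_src g := ext_val hX hl (src_src (val hX hl g))
  rng_src g := ext_val hX hl (rng_src (val hX hl g))
  src_rng g := ext_val hX hl (src_rng (val hX hl g))
  rng_rng g := ext_val hX hl (rng_rng (val hX hl g))
  src_mul g h e := by
    have e' : src (val hX hl g) = rng (val hX hl h) := congrArg (val hX hl) e
    refine ext_val hX hl ?_
    rw [val_mk, val_mk, val_mulAux hX hl _ _ e']
    exact src_mul _ _ e'
  rng_mul g h e := by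
    have e' : src (val hX hl g) = rng (val hX hl h) := congrArg (val hX hl) e
    refine ext_val hX hl ?_
    rw [val_mk, val_mk, val_mulAux hX hl _ _ e']
    exact rng_mul _ _ e'
  mul_assoc g h k e₁ e₂ := by
    have e₁' : src (val hX hl g) = rng (val hX hl h) := congrArg (val hX hl) e₁
    have e₂' : src (val hX hl h) = rng (val hX hl k) := congrArg (val hX hl) e₂
    have h₁ := val_mulAux hX hl _ _ e₁'
    have h₂ := val_mulAux hX hl _ _ e₂'
    refine ext_val hX hl ?_
    rw [val_mulAux hX hl (mulAux hX hl g h) k (by rw [h₁, src_mul _ _ e₁', e₂']),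
      val_mulAux hX hl g (mulAux hX hl h k) (by rw [h₂, rng_mul _ _ e₂', e₁']), h₁, h₂]
    exact mul_assoc _ _ _ e₁' e₂'
  rng_mul_self g := by
    refine ext_val hX hl ?_
    rw [val_mulAux hX hl _ _ (src_rng _), val_mk]
    exact rng_mul_self _
  mul_src_self g := by
    refine ext_val hX hl ?_
    rw [val_mulAux hX hl _ _ (rng_src _).symm, val_mk]
    exact mul_src_self _
  src_inv g := ext_val hX hl (src_inv (val hX hl g))
  rng_inv g := ext_val hX hl (rng_inv (val hX hl g))
  inv_mul g := by
    refine ext_val hX hl ?_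
    rw [val_mulAux hX hl _ _ (src_inv _), val_mk, val_mk]
    exact inv_mul _
  mul_inv g := by
    refine ext_val hX hl ?_
    rw [val_mulAux hX hl _ _ (rng_inv _).symm, val_mk, val_mk]
    exact mul_inv _

theorem val_src (g : Reduction X hX hl) : val hX hl (src g) = src (val hX hl g) := rfl
theorem val_rng (g : Reduction X hX hl) : val hX hl (rng g) = rng (val hX hl g) := rfl
theorem val_inv (g : Reduction X hX hl) : val hX hl (inv g) = inv (val hX hl g) := rfl

theorem val_mul (g h : Reduction X hX hl) (e : src (val hX hl g) = rng (val hX hl h)) :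
    val hX hl (mul g h) = mul (val hX hl g) (val hX hl h) := val_mulAux hX hl g h e

theorem r_val_iff (g h : Reduction X hX hl) :
    r g = r h ↔ r (val hX hl g) = r (val hX hl h) := by
  rw [r_eq_iff, r_eq_iff, ← val_rng, ← val_rng]
  exact (val_injective hX hl).eq_iff.symm

theorem s_val_iff (g h : Reduction X hX hl) :
    s g = s h ↔ s (val hX hl g) = s (val hX hl h) := by
  rw [s_eq_iff, s_eq_iff, ← val_src, ← val_src]
  exact (val_injective hX hl).eq_iff.symm

/-- The inclusion of the unit spaces. -/
def unitVal (x : UnitSpace (Reduction X hX hl)) : UnitSpace G :=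
  ⟨val hX hl x.1, congrArg (val hX hl) x.2⟩

theorem isEmbedding_unitVal : Topology.IsEmbedding (unitVal hX hl) := by
  have h1 : Topology.IsEmbedding (fun x : UnitSpace (Reduction X hX hl) => val hX hl x.1) :=
    (isEmbedding_val hX hl).comp Topology.IsEmbedding.subtypeVal
  exact Topology.IsEmbedding.of_comp
    (continuous_induced_rng.2 h1.continuous) continuous_subtype_val h1

theorem range_unitVal : Set.range (unitVal hX hl) = X := by
  ext x
  constructor
  · rintro ⟨y, rfl⟩
    have := r_val_mem hX hl y.1
    rwa [show r (val hX hl y.1) = unitVal hX hl y from r_unit (unitVal hX hl y)] at this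
  · intro hx
    refine ⟨⟨mk hX hl x.1 (by rw [r_unit]; exact hx), ext_val hX hl x.2⟩, rfl⟩

variable [IsLCEtaleGroupoid G]

theorem isLocalHomeomorph_aux (t : G → UnitSpace G)
    (t' : Reduction X hX hl → UnitSpace (Reduction X hX hl)) (ht : IsLocalHomeomorph t)
    (htt : ∀ g, unitVal hX hl (t' g) = t (val hX hl g)) (hmem : ∀ g, t g ∈ X → r g ∈ X) :
    IsLocalHomeomorph t' := by
  have hc : Continuous t' := by
    rw [(isEmbedding_unitVal hX hl).continuous_iff]
    have h1 : unitVal hX hl ∘ t' = t ∘ val hX hl := funext htt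
    rw [h1]
    exact ht.continuous.comp (continuous_val hX hl)
  have ho : IsOpenMap t' := by
    intro O hO
    obtain ⟨O', hO', rfl⟩ := (isEmbedding_val hX hl).isOpen_iff.1 hO
    have h1 : t' '' (val hX hl ⁻¹' O') = unitVal hX hl ⁻¹' (t '' O') := by
      ext x
      constructor
      · rintro ⟨g, hg, rfl⟩
        exact ⟨val hX hl g, hg, (htt g).symm⟩
      · rintro ⟨g, hg, e⟩
        have hgX : r g ∈ X := by
          refine hmem g ?_
          rw [e]
          exact (range_unitVal hX hl).le ⟨x, rfl⟩
        refine ⟨mk hX hl g hgX, hg, (isEmbedding_unitVal hX hl).injective ?_⟩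
        rw [htt, ← e, val_mk]
    rw [h1]
    exact (ht.isOpenMap _ hO').preimage (isEmbedding_unitVal hX hl).continuous
  rw [isLocalHomeomorph_iff_isOpenEmbedding_restrict]
  intro g
  obtain ⟨V, hV, hgV, hinj⟩ := ht.isLocallyInjective (val hX hl g)
  have hV' : IsOpen (val hX hl ⁻¹' V) := hV.preimage (continuous_val hX hl)
  refine ⟨val hX hl ⁻¹' V, hV'.mem_nhds hgV, .of_continuous_injective_isOpenMap
    (hc.comp continuous_subtype_val) ?_ (ho.comp hV'.isOpenMap_subtype_val)⟩
  rintro ⟨a, ha⟩ ⟨b, hb⟩ e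
  have e1 : t (val hX hl a) = t (val hX hl b) := by
    rw [← htt, ← htt]
    exact congrArg (unitVal hX hl) e
  exact Subtype.ext (val_injective hX hl (hinj ha hb e1))

instance : IsLCEtaleGroupoid (Reduction X hX hl) where
  locallyCompact :=
    have : LocallyCompactSpace G := IsLCEtaleGroupoid.locallyCompact
    IsLocallyClosed.locallyCompactSpace (s := (r ⁻¹' X : Set G)) (hl.preimage continuous_r)
  continuousOn_mul := by
    rw [(isEmbedding_val hX hl).continuousOn_iff]
    have h1 : ContinuousOn (fun p : Reduction X hX hl × Reduction X hX hl =>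
        mul (val hX hl p.1) (val hX hl p.2)) {p | src p.1 = rng p.2} := by
      refine IsLCEtaleGroupoid.continuousOn_mul.comp
        (((continuous_val hX hl).comp continuous_fst).prodMk
          ((continuous_val hX hl).comp continuous_snd)).continuousOn ?_
      intro p hp
      exact congrArg (val hX hl) hp
    exact h1.congr fun p hp => val_mul hX hl p.1 p.2 (congrArg (val hX hl) hp)
  continuous_inv := by
    rw [(isEmbedding_val hX hl).continuous_iff]
    exact continuous_inv'.comp (continuous_val hX hl)
  t2_units := T2Space.of_injective_continuous (isEmbedding_unitVal hX hl).injective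
    (isEmbedding_unitVal hX hl).continuous
  locallyCompact_units := (isEmbedding_unitVal hX hl).isInducing.locallyCompactSpace
    (by rw [range_unitVal]; exact hl)
  isLocalHomeomorph_r := isLocalHomeomorph_aux hX hl r r IsLCEtaleGroupoid.isLocalHomeomorph_r
    (fun _ => rfl) (fun _ h => h)
  isLocalHomeomorph_s := isLocalHomeomorph_aux hX hl s s IsLCEtaleGroupoid.isLocalHomeomorph_s
    (fun _ => rfl) (fun g h => (hX g).2 h)

/-- Convolution commutes with restriction to a reduction. -/
theorem conv_comp_val (f₁ f₂ : G → ℂ) :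
    conv (f₁ ∘ val hX hl) (f₂ ∘ val hX hl) = conv f₁ f₂ ∘ val hX hl := by
  funext g
  refine finsum_mem_eq_of_bijOn (val hX hl) ⟨?_, ?_, ?_⟩ ?_
  · intro h hh
    exact (r_val_iff hX hl h g).1 hh
  · exact (val_injective hX hl).injOn
  · intro h hh
    have hhX : r h ∈ X := by
      rw [show r h = r (val hX hl g) from hh]
      exact r_val_mem hX hl g
    exact ⟨mk hX hl h hhX, (r_val_iff hX hl (mk hX hl h hhX) g).2 hh, rfl⟩
  · intro h hh
    have e : src (val hX hl (inv h)) = rng (val hX hl g) := by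
      rw [val_inv, src_inv]
      exact r_eq_iff.1 ((r_val_iff hX hl h g).1 hh)
    simp only [Function.comp_apply]
    rw [val_mul hX hl _ _ e, val_inv]

theorem invol_comp_val (f : G → ℂ) : invol (f ∘ val hX hl) = invol f ∘ val hX hl := rfl

end Reduction

variable [IsLCEtaleGroupoid G]

/-! #### Restriction to a closed invariant set -/

theorem isClosedEmbedding_val (hc : IsClosed X) :
    Topology.IsClosedEmbedding (Reduction.val hX hc.isLocallyClosed) :=
  (hc.preimage continuous_r).isClosedEmbedding_subtypeVal

theorem isOpenEmbedding_val (ho : IsOpen X) :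
    Topology.IsOpenEmbedding (Reduction.val hX ho.isLocallyClosed) :=
  (ho.preimage continuous_r).isOpenEmbedding_subtypeVal

theorem comp_val_mem_Cc (hc : IsClosed X) {f : G → ℂ} (hf : f ∈ Cc (Set.univ : Set G)) :
    f ∘ Reduction.val hX hc.isLocallyClosed ∈
      Cc (Set.univ : Set (Reduction X hX hc.isLocallyClosed)) := by
  rw [Cc_eq_span] at hf
  induction hf using Submodule.span_induction with
  | mem f h =>
    obtain ⟨B, hB, -, hf⟩ := h
    have := hB.t2
    obtain ⟨hcont, K, hKB, hK, h0⟩ := mem_CcOn_iff.1 hf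
    have hv := Reduction.continuous_val hX hc.isLocallyClosed
    have hT : T2Space (Reduction.val hX hc.isLocallyClosed ⁻¹' B) :=
      T2Space.of_injective_continuous (f := B.restrictPreimage (Reduction.val hX hc.isLocallyClosed))
        ((Reduction.val_injective hX hc.isLocallyClosed).restrictPreimage _)
        hv.restrictPreimage
    refine CcOn_le_Cc (Set.subset_univ _) (hB.isOpen.preimage hv)
      (mem_CcOn_iff.2 ⟨hcont.comp hv.continuousOn fun g hg => hg,
        Reduction.val hX hc.isLocallyClosed ⁻¹' K, Set.preimage_mono hKB,
        (isClosedEmbedding_val hX hc).isCompact_preimage hK, fun g hg => h0 _ hg⟩)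
  | zero => exact Submodule.zero_mem _
  | add f₁ f₂ _ _ h₁ h₂ => exact Submodule.add_mem _ h₁ h₂
  | smul c f _ h => exact Submodule.smul_mem _ c h

/-- The restriction `C_c(G) → C_c(G_X)`, `f ↦ f|_{G_X}`, for a closed invariant set `X`. -/
def restrictCc (hc : IsClosed X) : CcAlg G →⋆ₙₐ[ℂ] CcAlg (Reduction X hX hc.isLocallyClosed) where
  toFun f := .mk (f.fn ∘ Reduction.val hX hc.isLocallyClosed) (comp_val_mem_Cc hX hc f.fn_mem)
  map_smul' _ _ := rfl
  map_zero' := rfl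
  map_add' _ _ := rfl
  map_mul' f₁ f₂ := CcAlg.ext (Reduction.conv_comp_val hX hc.isLocallyClosed f₁.fn f₂.fn).symm
  map_star' _ := rfl

/-- The *-homomorphism `C*(G) → C*(G_X)` extending the restriction `C_c(G) → C_c(G_X)`. -/
def restrictHom (hc : IsClosed X) :
    FullCStar G →⋆ₙₐ[ℂ] FullCStar (Reduction X hX hc.isLocallyClosed) :=
  EnvelopingCStar.map (restrictCc hX hc)

theorem restrictHom_ofCc (hc : IsClosed X) (f : CcAlg G) :
    restrictHom hX hc (ofCc f) = ofCc (restrictCc hX hc f) :=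
  EnvelopingCStar.lift_ofAlg _ f

/-! #### Extension by zero from an open invariant set -/

/-- Extension by zero of a function from a reduction to `G`. -/
def Reduction.extendZero (f : Reduction X hX hl → ℂ) : G → ℂ :=
  Function.extend (Reduction.val hX hl) f 0

theorem Reduction.extendZero_comp_val (f : Reduction X hX hl → ℂ) :
    Reduction.extendZero hX hl f ∘ Reduction.val hX hl = f :=
  funext fun g => (Reduction.val_injective hX hl).extend_apply f 0 g

theorem Reduction.extendZero_of_notMem (f : Reduction X hX hl → ℂ) {g : G} (hg : r g ∉ X) :
    Reduction.extendZero hX hl f g = 0 := by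
  refine (Function.extend_apply' _ _ _ ?_).trans rfl
  rintro ⟨h, rfl⟩
  exact hg h.2

theorem Reduction.extendZero_unique (f : Reduction X hX hl → ℂ) (F : G → ℂ)
    (h₁ : F ∘ Reduction.val hX hl = f) (h₂ : ∀ g, r g ∉ X → F g = 0) :
    Reduction.extendZero hX hl f = F := by
  funext g
  by_cases hg : r g ∈ X
  · exact congrFun ((Reduction.extendZero_comp_val hX hl f).trans h₁.symm) (Reduction.mk hX hl g hg)
  · rw [Reduction.extendZero_of_notMem hX hl f hg, h₂ g hg]

theorem Reduction.extendZero_add (f₁ f₂ : Reduction X hX hl → ℂ) :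
    Reduction.extendZero hX hl (f₁ + f₂) =
      Reduction.extendZero hX hl f₁ + Reduction.extendZero hX hl f₂ := by
  refine Reduction.extendZero_unique hX hl _ _ ?_ fun g hg => ?_
  · exact congrArg₂ (· + ·) (Reduction.extendZero_comp_val hX hl f₁)
      (Reduction.extendZero_comp_val hX hl f₂)
  · rw [Pi.add_apply, Reduction.extendZero_of_notMem hX hl _ hg,
      Reduction.extendZero_of_notMem hX hl _ hg, add_zero]

theorem Reduction.extendZero_smul (c : ℂ) (f : Reduction X hX hl → ℂ) :
    Reduction.extendZero hX hl (c • f) = c • Reduction.extendZero hX hl f := by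
  refine Reduction.extendZero_unique hX hl _ _ ?_ fun g hg => ?_
  · exact congrArg (c • ·) (Reduction.extendZero_comp_val hX hl f)
  · rw [Pi.smul_apply, Reduction.extendZero_of_notMem hX hl _ hg, smul_zero]

theorem Reduction.extendZero_zero :
    Reduction.extendZero hX hl (0 : Reduction X hX hl → ℂ) = 0 :=
  Reduction.extendZero_unique hX hl _ _ rfl fun _ _ => rfl

theorem Reduction.extendZero_conv (f₁ f₂ : Reduction X hX hl → ℂ) :
    Reduction.extendZero hX hl (conv f₁ f₂) =
      conv (Reduction.extendZero hX hl f₁) (Reduction.extendZero hX hl f₂) := by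
  refine Reduction.extendZero_unique hX hl _ _ ?_ fun g hg => ?_
  · rw [← Reduction.conv_comp_val, Reduction.extendZero_comp_val, Reduction.extendZero_comp_val]
  · refine (finsum_mem_congr rfl fun h hh => ?_).trans (finsum_mem_zero _)
    rw [Reduction.extendZero_of_notMem hX hl f₁ (by rw [show r h = r g from hh]; exact hg),
      zero_mul]

theorem Reduction.extendZero_invol (f : Reduction X hX hl → ℂ) :
    Reduction.extendZero hX hl (invol f) = invol (Reduction.extendZero hX hl f) := by
  refine Reduction.extendZero_unique hX hl _ _ ?_ fun g hg => ?_
  · rw [← Reduction.invol_comp_val, Reduction.extendZero_comp_val]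
  · have h1 : r (inv g) ∉ X := by
      rw [show r (inv g) = s g from Subtype.ext (rng_inv g), ← hX g]
      exact hg
    rw [invol, Reduction.extendZero_of_notMem hX hl f h1, star_zero]

theorem extendZero_mem_Cc (ho : IsOpen X) {f : Reduction X hX ho.isLocallyClosed → ℂ}
    (hf : f ∈ Cc (Set.univ : Set (Reduction X hX ho.isLocallyClosed))) :
    Reduction.extendZero hX ho.isLocallyClosed f ∈ Cc {g : G | r g ∈ X} := by
  rw [Cc_eq_span] at hf
  induction hf using Submodule.span_induction with
  | mem f h =>
    obtain ⟨B, hB, -, hf⟩ := h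
    have := hB.t2
    obtain ⟨hcont, K, hKB, hK, h0⟩ := mem_CcOn_iff.1 hf
    have he := isOpenEmbedding_val hX ho
    have hinj : Set.InjOn (r : G → UnitSpace G) (Reduction.val hX ho.isLocallyClosed '' B) := by
      rintro _ ⟨a, ha, rfl⟩ _ ⟨b, hb, rfl⟩ e
      exact congrArg _ (hB.injOn_r ha hb ((Reduction.r_val_iff hX ho.isLocallyClosed a b).2 e))
    have hT := t2_of_injOn hinj
    have hval : ∀ g, Reduction.extendZero hX ho.isLocallyClosed f
        (Reduction.val hX ho.isLocallyClosed g) = f g := fun g =>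
      congrFun (Reduction.extendZero_comp_val hX ho.isLocallyClosed f) g
    refine CcOn_le_Cc (V := Reduction.val hX ho.isLocallyClosed '' B) ?_
      (he.isOpenMap _ hB.isOpen) (mem_CcOn_iff.2
        ⟨?_, Reduction.val hX ho.isLocallyClosed '' K, Set.image_mono hKB,
          hK.image he.continuous, ?_⟩)
    · rintro _ ⟨a, -, rfl⟩
      exact a.2
    · rintro _ ⟨a, ha, rfl⟩
      refine ContinuousAt.continuousWithinAt ?_
      rw [← he.continuousAt_iff, Reduction.extendZero_comp_val]
      exact hcont.continuousAt (hB.isOpen.mem_nhds ha)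
    · intro g hg
      by_cases hgX : r g ∈ X
      · refine (hval (Reduction.mk hX ho.isLocallyClosed g hgX)).trans (h0 _ fun h => hg ⟨_, h, rfl⟩)
      · exact Reduction.extendZero_of_notMem hX ho.isLocallyClosed f hgX
  | zero =>
    rw [Reduction.extendZero_zero]
    exact Submodule.zero_mem _
  | add f₁ f₂ _ _ h₁ h₂ =>
    rw [Reduction.extendZero_add]
    exact Submodule.add_mem _ h₁ h₂
  | smul c f _ h =>
    rw [Reduction.extendZero_smul]
    exact Submodule.smul_mem _ c h

/-- The inclusion `C_c(G_X) → C_c(G)` by extension by zero, for an open invariant set `X`. -/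
def extendCc (ho : IsOpen X) : CcAlg (Reduction X hX ho.isLocallyClosed) →⋆ₙₐ[ℂ] CcAlg G where
  toFun f := .mk (Reduction.extendZero hX ho.isLocallyClosed f.fn)
    (Cc_mono (Set.subset_univ _) (extendZero_mem_Cc hX ho f.fn_mem))
  map_smul' c f := CcAlg.ext (Reduction.extendZero_smul hX ho.isLocallyClosed c f.fn)
  map_zero' := CcAlg.ext (Reduction.extendZero_zero hX ho.isLocallyClosed)
  map_add' f₁ f₂ := CcAlg.ext (Reduction.extendZero_add hX ho.isLocallyClosed f₁.fn f₂.fn)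
  map_mul' f₁ f₂ := CcAlg.ext (Reduction.extendZero_conv hX ho.isLocallyClosed f₁.fn f₂.fn)
  map_star' f := CcAlg.ext (Reduction.extendZero_invol hX ho.isLocallyClosed f.fn)

/-- The *-homomorphism `C*(G_X) → C*(G)` extending the inclusion `C_c(G_X) → C_c(G)`. -/
def extendHom (ho : IsOpen X) :
    FullCStar (Reduction X hX ho.isLocallyClosed) →⋆ₙₐ[ℂ] FullCStar G :=
  EnvelopingCStar.map (extendCc hX ho)

theorem extendHom_ofCc (ho : IsOpen X) (f : CcAlg (Reduction X hX ho.isLocallyClosed)) :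
    extendHom hX ho (ofCc f) = ofCc (extendCc hX ho f) :=
  EnvelopingCStar.lift_ofAlg _ f

end Reduction

end ArrowGroupoid

/-- The closed two-sided ideal generated by a set `S`: the smallest norm-closed linear subspace
that contains `S` and is stable under multiplication from both sides. -/
def closedIdealSpan {A : Type*} [NonUnitalCStarAlgebra A] (S : Set A) : Submodule ℂ A :=
  sInf {I | IsClosed (I : Set A) ∧ S ⊆ I ∧ ∀ a, ∀ b ∈ I, a * b ∈ I ∧ b * a ∈ I}

end

open scoped CompactlySupported ZeroAtInfty

/-! Write `U` for the complement of `X`, `W = r⁻¹(U)`, `J = C_c(W) ⊆ C_c(G)`, and let `‖·‖` be the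
largest C*-seminorm on `C_c(G)`. Since `C*(G_X)` is an enveloping algebra, the kernel is controlled
by producing C*-seminorms on `C_c(G_X)`, and no representation theory on Hilbert spaces is needed.

The distance to `J` is a C*-seminorm `q` on `C_c(G)`: `J` is a *-ideal, and every `j ∈ J` satisfies
`χ j = j` for some `χ ∈ C_c(U)`, so that `1 - χ` acts as a contractive left multiplier killing `j`
(`exists_quotient`, `exists_quotient_supported`). Suppose that `q` vanishes on every `f` with
`f|_{G_X} = 0`. Restriction `C_c(G) → C_c(G_X)` is onto by Tietze's theorem
(`restrictCc_surjective`), so `q` descends to a C*-seminorm on `C_c(G_X)` and is dominated by the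
norm of `C*(G_X)`. Thus the distance from `f` to `J` is at most `‖f|_{G_X}‖`. Density then gives
that the kernel is the closure of `J`, and lifts with controlled norm give surjectivity.

The supposition is the point where non-Hausdorffness matters. A function in `C_c(G)` that vanishes
on `G_X` need not lie in `J`, and it is a sum of functions on different bisections that may only
cancel on `G_X`, so it cannot simply be truncated. `exists_dist_supported_le` proves by induction on
the number of bisections that the distance to `J` is at most a constant times the supremum off `W`:
where the last summand is large off `W`, some other bisection must contain the point, and a
partition of unity moves that portion of the summand to the other bisections. What is left is small
off `W` and lives on one bisection, where the C*-norm is bounded by the supremum norm, so truncation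
is harmless.

For injectivity of `C*(G_U) → C*(G)`, `C_c(G)` acts by left multipliers on `C_c(G_U)`. The action is
bounded, because for `f` on a bisection with `|f| ≤ M` the function `M² - f* f` on the unit space is
nonnegative and has a continuous square root. The operator norm is a C*-seminorm on `C_c(G)`
(`exists_of_action`) which dominates the full norm of `C_c(G_U)` on that ideal. Finally, the closure
of `J` is the ideal generated by `C₀(U)` since elements of `J` have left units in `C_c(U)` and
`C_c(U)` is dense in `C₀(U)`. -/

noncomputable section

/-! ### Constructions of C*-seminorms: quotients, descent, actions by multipliers -/

namespace CStarSeminorm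

section Abstract

set_option linter.unusedSectionVars false

variable {A : Type*} [NonUnitalRing A] [Module ℂ A] [IsScalarTower ℂ A A] [SMulCommClass ℂ A A]
  [StarRing A] [StarModule ℂ A]

/-- In the completion the hypothesis reads `b* b ≤ M² a* a` for the spectral order, and the norm is
monotone on positive elements. An explicit complement `c` replaces positivity, so that a norm
estimate becomes an algebraic identity in the uncompleted algebra. It is used with `c` equal to `a`
times a square root. -/
theorem le_mul_of_star_mul_self_add (p : CStarSeminorm A) {a b c : A} {M : ℝ} (hM : 0 ≤ M)
    (h : star b * b + star c * c = ((M ^ 2 : ℝ) : ℂ) • (star a * a)) : p b ≤ M * p a := by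
  let _ : PartialOrder p.CStarCompletion := CStarAlgebra.spectralOrder _
  have : StarOrderedRing p.CStarCompletion := CStarAlgebra.spectralOrderedRing _
  have h1 := congrArg p.toCompl h
  simp only [map_add, map_mul, map_star, map_smul] at h1
  have h2 : ‖star (p.toCompl b) * p.toCompl b‖ ≤
      ‖((M ^ 2 : ℝ) : ℂ) • (star (p.toCompl a) * p.toCompl a)‖ := by
    refine CStarAlgebra.norm_le_norm_of_nonneg_of_le (star_mul_self_nonneg _) ?_
    rw [← h1]
    exact le_add_of_nonneg_right (star_mul_self_nonneg _)
  rw [norm_smul, CStarRing.norm_star_mul_self, CStarRing.norm_star_mul_self, norm_toCompl,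
    norm_toCompl, Complex.norm_real, Real.norm_of_nonneg (sq_nonneg M)] at h2
  refine abs_le_of_sq_le_sq' (a := p b) (b := M * p a) ?_ (mul_nonneg hM (p.nonneg a)) |>.2
  nlinarith

/-- The distance to a *-ideal `J` with respect to a C*-seminorm is a C*-seminorm, provided that for
every element of `J` there is a contractive left multiplier vanishing on it that is the identity
modulo `J`. -/
theorem exists_quotient (p : CStarSeminorm A) (J : Submodule ℂ A) (hstar : ∀ j ∈ J, star j ∈ J)
    (hl : ∀ a, ∀ j ∈ J, a * j ∈ J) (hm : ∀ j ∈ J, ∃ m : A → A, (∀ a b, m (a * b) = m a * b) ∧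
      (∀ a b, m (a - b) = m a - m b) ∧ (∀ a, p (m a) ≤ p a) ∧ m j = 0 ∧ ∀ a, a - m a ∈ J) :
    ∃ q : CStarSeminorm A, (∀ a, ∀ j ∈ J, q a ≤ p (a - j)) ∧
      ∀ a, ∀ ε > 0, ∃ j ∈ J, p (a - j) < q a + ε :=
  let J' : Submodule ℂ p.Pre := J
  let q : Seminorm ℂ A := (normSeminorm ℂ (p.Pre ⧸ J')).comp J'.mkQ
  have hq : ∀ a : A, ∀ ε > 0, ∃ j ∈ J, p (a - j) < q a + ε := fun a ε hε => by
    obtain ⟨(b : A), hb, hlt⟩ := Submodule.Quotient.norm_mk_lt (S := J') (J'.mkQ a) hε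
    have hb' : a - (b : A) ∈ J := (Submodule.Quotient.eq J').1 hb.symm
    refine ⟨a - b, hb', ?_⟩
    rw [sub_sub_cancel]
    exact hlt
  have hle : ∀ a : A, ∀ j ∈ J, q a ≤ p (a - j) := fun a j hj => by
    have h1 : J'.mkQ a = J'.mkQ ((a - j : A) : p.Pre) :=
      (Submodule.Quotient.eq J').2 (show a - (a - j) ∈ J by rwa [sub_sub_cancel])
    change ‖J'.mkQ a‖ ≤ _
    rw [h1]
    exact Submodule.Quotient.norm_mk_le J' _
  have hr : ∀ a, ∀ j ∈ J, j * a ∈ J := fun a j hj => by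
    have := hstar _ (hl (star a) _ (hstar j hj))
    rwa [star_mul, star_star, star_star] at this
  have hmul : ∀ a b, q (a * b) ≤ q a * q b := fun a b => by
    refine le_of_forall_pos_lt_add fun δ hδ => ?_
    -- An `ε > 0` is needed with `(q a + ε)(q b + ε) < q a q b + δ`.
    have hcont : Filter.Tendsto (fun ε : ℝ => (q a + ε) * (q b + ε)) (nhdsWithin 0 (Set.Ioi 0))
        (nhds (q a * q b)) := by
      have : Continuous fun ε : ℝ => (q a + ε) * (q b + ε) := by fun_prop
      simpa using (this.tendsto 0).mono_left nhdsWithin_le_nhds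
    obtain ⟨ε, hεlt, hε⟩ := ((hcont.eventually (gt_mem_nhds (lt_add_of_pos_right _ hδ))).and
      self_mem_nhdsWithin).exists
    obtain ⟨i, hi, hi'⟩ := hq a ε hε
    obtain ⟨j, hj, hj'⟩ := hq b ε hε
    -- The product of near-optimal representatives of two cosets represents the product of the
    -- cosets.
    have e : a * b - (i * b + a * j - i * j) = (a - i) * (b - j) := by noncomm_ring
    have h1 := hle (a * b) (i * b + a * j - i * j)
      (J.sub_mem (J.add_mem (hr b i hi) (hl a j hj)) (hl i j hj))
    rw [e] at h1
    refine (h1.trans ((p.mul_le _ _).trans (mul_le_mul hi'.le hj'.le (p.nonneg _) ?_))).trans_lt hεlt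
    exact (p.nonneg _).trans hi'.le
  have hst : ∀ a, q (star a) ≤ q a := fun a => by
    refine le_of_forall_pos_lt_add fun δ hδ => ?_
    obtain ⟨j, hj, hj'⟩ := hq a δ hδ
    have h1 := hle (star a) (star j) (hstar j hj)
    rw [← star_sub, p.star_eq] at h1
    exact h1.trans_lt hj'
  ⟨{ q with
    mul_le' := hmul
    star_mul_self' := fun a => by
      refine le_antisymm ?_ ?_
      · change q (star a * a) ≤ q a ^ 2
        rw [pow_two]
        exact (hmul _ _).trans (mul_le_mul_of_nonneg_right (hst a) (apply_nonneg q a))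
      · change q a ^ 2 ≤ q (star a * a)
        refine le_of_forall_pos_lt_add fun δ hδ => ?_
        obtain ⟨j, hj, hj'⟩ := hq (star a * a) δ hδ
        -- For `m` thought of as an element with `m j = 0`, the estimate is `q(a)² ≤ p(m a*)² = p(m
        -- a* a m*) ≤ p(m a* a) = p(m (a* a - j)) ≤ p(a* a - j)`. As `m` multiplies from the left
        -- only, it is applied to `a*`, and the right factor `m*` is removed by passing to adjoints.
        obtain ⟨m, hmm, hms, hmp, hmj, hmJ⟩ := hm j hj
        have h1 : q a ≤ p (m (star a)) := by
          have h2 := (hst (star a)).trans (hle _ _ (hmJ (star a)))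
          rwa [star_star, sub_sub_cancel] at h2
        have h3 : p (m (star a)) ^ 2 = p (m (star a) * star (m (star a))) := by
          rw [← p.star_eq (m (star a)), ← p.star_mul_self, star_star]
        have h4 : p (m (star a) * star (m (star a))) ≤ p (m (star a * a - j)) := by
          rw [hms, hmj, sub_zero, ← hmm, ← p.star_eq (m (star a * a))]
          refine (hmp _).trans (le_of_eq ?_)
          rw [hmm, star_mul]
        calc q a ^ 2 ≤ p (m (star a)) ^ 2 := pow_le_pow_left₀ (apply_nonneg q a) h1 2
          _ ≤ p (m (star a * a - j)) := h3.trans_le h4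
          _ ≤ p (star a * a - j) := hmp _
          _ < q (star a * a) + δ := hj' }, hle, hq⟩

/-- A C*-seminorm vanishing on the kernel of a surjective *-homomorphism descends to its target. -/
theorem exists_descend {B : Type*} [NonUnitalRing B] [Module ℂ B] [StarRing B]
    (q : CStarSeminorm A) (σ : A →⋆ₙₐ[ℂ] B) (hσ : Function.Surjective σ)
    (h0 : ∀ a, σ a = 0 → q a = 0) : ∃ q' : CStarSeminorm B, ∀ a, q' (σ a) = q a := by
  have hle : ∀ a b, σ a = σ b → q a ≤ q b := fun a b e => by
    have h1 := map_add_le_add q.toSeminorm (a - b) b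
    rw [sub_add_cancel, h0 (a - b) (by rw [map_sub, e, sub_self]), zero_add] at h1
    exact h1
  have heq : ∀ a b, σ a = σ b → q a = q b := fun a b e => le_antisymm (hle a b e) (hle b a e.symm)
  -- `q` is constant on the fibres of `σ`, so any set-theoretic section gives the descended
  -- seminorm.
  let t := Function.surjInv hσ
  have ht : ∀ b, σ (t b) = b := Function.surjInv_eq hσ
  refine ⟨{ Seminorm.of (fun b => q (t b))
    (fun x y => ?_) (fun c x => ?_) with mul_le' := fun x y => ?_, star_mul_self' := fun x => ?_ },
    fun a => heq _ _ (ht _)⟩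
  · rw [heq (t (x + y)) (t x + t y) (by simp only [map_add, ht])]
    exact map_add_le_add q.toSeminorm _ _
  · rw [heq (t (c • x)) (c • t x) (by simp only [map_smul, ht])]
    exact map_smul_eq_mul q.toSeminorm _ _
  · change q (t (x * y)) ≤ _
    rw [heq (t (x * y)) (t x * t y) (by simp only [map_mul, ht])]
    exact q.mul_le _ _
  · change q (t (star x * x)) = _
    rw [heq (t (star x * x)) (star (t x) * t x) (by simp only [map_mul, map_star, ht])]
    exact q.star_mul_self _

/-- A bounded *-representation by left multipliers of a seminormed *-algebra gives a C*-seminorm. -/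
theorem exists_of_action {B : Type*} [NonUnitalRing B] [Module ℂ B] [IsScalarTower ℂ B B]
    [SMulCommClass ℂ B B] [StarRing B] [StarModule ℂ B] (p : CStarSeminorm B)
    (L : A →ₗ[ℂ] B →ₗ[ℂ] B) (hmul : ∀ a a' b, L (a * a') b = L a (L a' b))
    (hadj : ∀ a b, star (L a b) * L a b = star b * L (star a * a) b)
    (hbdd : ∀ a, ∃ C, ∀ b, p (L a b) ≤ C * p b) :
    ∃ q : CStarSeminorm A, ∀ a b, p (L a b) ≤ q a * p b := by
  let T : A → (p.Pre →L[ℂ] p.Pre) := fun a =>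
    LinearMap.mkContinuousOfExistsBound (L a : p.Pre →ₗ[ℂ] p.Pre) (hbdd a)
  have hT : ∀ a (b : B), T a b = L a b := fun _ _ => rfl
  have hop : ∀ a (b : B), p (L a b) ≤ ‖T a‖ * p b := fun a b => (T a).le_opNorm b
  have hm : ∀ a b, ‖T (a * b)‖ ≤ ‖T a‖ * ‖T b‖ := fun a b => by
    have : T (a * b) = (T a).comp (T b) := ContinuousLinearMap.ext fun x => hmul a b x
    rw [this]
    exact ContinuousLinearMap.opNorm_comp_le _ _
  -- The usual argument for operators on a Hilbert module: `p(L_a b)² = p(b* L_{a* a} b) ≤ ‖T_{a*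
  -- a}‖ p(b)²`. The inequality `‖T_a‖ ≤ ‖T_{a*}‖`, and with it the C*-identity, follows from
  -- submultiplicativity.
  have hsq : ∀ a, ‖T a‖ ^ 2 ≤ ‖T (star a * a)‖ := fun a => by
    refine (Real.le_sqrt (norm_nonneg _) (norm_nonneg _)).1 ?_
    refine ContinuousLinearMap.opNorm_le_bound _ (Real.sqrt_nonneg _) fun (b : B) => ?_
    change p (L a b) ≤ _ * p b
    refine abs_le_of_sq_le_sq' (a := p (L a b)) ?_
      (mul_nonneg (Real.sqrt_nonneg _) (p.nonneg b)) |>.2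
    rw [← p.star_mul_self, hadj, mul_pow, Real.sq_sqrt (norm_nonneg _)]
    refine (p.mul_le _ _).trans ?_
    rw [p.star_eq]
    nlinarith [hop (star a * a) b, p.nonneg b]
  have hst : ∀ a, ‖T a‖ ≤ ‖T (star a)‖ := fun a => by
    have h1 := (hsq a).trans (hm _ _)
    by_contra! h
    nlinarith [norm_nonneg (T (star a))]
  refine ⟨{ Seminorm.of (fun a => ‖T a‖) (fun a b => ?_) (fun c a => ?_) with
    mul_le' := hm, star_mul_self' := fun a => ?_ }, hop⟩
  · have : T (a + b) = T a + T b := ContinuousLinearMap.ext fun (x : B) => by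
      change L (a + b) x = L a x + L b x
      rw [map_add, LinearMap.add_apply]
    rw [this]
    exact norm_add_le _ _
  · have : T (c • a) = c • T a := ContinuousLinearMap.ext fun (x : B) => by
      change L (c • a) x = c • L a x
      rw [map_smul, LinearMap.smul_apply]
    rw [this]
    exact norm_smul _ _
  · refine le_antisymm ((hm _ _).trans ?_) (hsq a)
    change _ ≤ ‖T a‖ ^ 2
    rw [pow_two]
    refine mul_le_mul_of_nonneg_right ?_ (norm_nonneg _)
    have := hst (star a)
    rwa [star_star] at this

end Abstract

end CStarSeminorm

end

noncomputable section

/-! ### Functions in `C_c(V)` on a Hausdorff subset: supports and truncation -/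

section CcOn

variable {G : Type*} [TopologicalSpace G] {V : Set G} [T2Space V]

theorem CcOn.mul_left {f ψ : G → ℂ} (hf : f ∈ CcOn V) (hψ : ContinuousOn ψ V) :
    (fun g => ψ g * f g) ∈ CcOn V := by
  obtain ⟨hc, K, hKV, hK, h0⟩ := mem_CcOn_iff.1 hf
  exact mem_CcOn_iff.2 ⟨hψ.mul hc, K, hKV, hK, fun g hg => by rw [h0 g hg, mul_zero]⟩

theorem CcOn.add {f₁ f₂ : G → ℂ} (h₁ : f₁ ∈ CcOn V) (h₂ : f₂ ∈ CcOn V) : f₁ + f₂ ∈ CcOn V := by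
  obtain ⟨hc₁, K₁, hKV₁, hK₁, hz₁⟩ := mem_CcOn_iff.1 h₁
  obtain ⟨hc₂, K₂, hKV₂, hK₂, hz₂⟩ := mem_CcOn_iff.1 h₂
  refine mem_CcOn_iff.2 ⟨hc₁.add hc₂, K₁ ∪ K₂, Set.union_subset hKV₁ hKV₂, hK₁.union hK₂,
    fun g hg => ?_⟩
  rw [Pi.add_apply, hz₁ g fun h => hg (.inl h), hz₂ g fun h => hg (.inr h), add_zero]

theorem CcOn.smul (c : ℂ) {f : G → ℂ} (hf : f ∈ CcOn V) : c • f ∈ CcOn V :=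
  CcOn.mul_left hf continuousOn_const

/-- The set where a function in `C_c(V)` is at least `δ > 0` in absolute value is compact. -/
theorem CcOn.isCompact_le {f : G → ℂ} (hf : f ∈ CcOn V) {δ : ℝ} (hδ : 0 < δ) :
    IsCompact {v : V | δ ≤ ‖f v‖} := by
  obtain ⟨hc, K, hKV, hK, h0⟩ := mem_CcOn_iff.1 hf
  have hK' : IsCompact (Subtype.val ⁻¹' K : Set V) := by
    rw [Subtype.isCompact_iff, Subtype.image_preimage_coe, Set.inter_eq_right.2 hKV]
    exact hK
  refine hK'.of_isClosed_subset (isClosed_le continuous_const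
    (continuousOn_iff_continuous_domRestrict.1 hc).norm) fun v hv => ?_
  by_contra hn
  have h1 : δ ≤ ‖f v‖ := hv
  rw [h0 v hn, norm_zero] at h1
  exact hδ.not_ge h1

end CcOn

theorem eq_zero_of_mem_CcOn {G : Type*} [TopologicalSpace G] {V : Set G} {f : G → ℂ} (hf : f ∈ CcOn V) {g : G} (hg : g ∉ V) :
    f g = 0 := by
  obtain ⟨φ, rfl⟩ := hf
  refine (Function.extend_apply' _ _ _ ?_).trans rfl
  rintro ⟨v, rfl⟩
  exact hg v.2

theorem eq_zero_of_mem_Cc {G : Type*} [TopologicalSpace G] {U : Set G} {f : G → ℂ} (hf : f ∈ Cc U) {g : G} (hg : g ∉ U) :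
    f g = 0 := by
  have : Cc U ≤ LinearMap.ker (LinearMap.proj (R := ℂ) (φ := fun _ : G => ℂ) g) := by
    refine Submodule.span_le.2 ?_
    rintro f ⟨V, hVU, -, -, hf⟩
    exact eq_zero_of_mem_CcOn hf fun h => hg (hVU h)
  exact this hf

/-- The radial retraction of the complex plane onto the disc of radius `δ`. -/
def radialRetraction (δ : ℝ) (z : ℂ) : ℂ := ((δ / max δ ‖z‖ : ℝ) : ℂ) * z

theorem continuous_radialRetraction {δ : ℝ} (hδ : 0 < δ) : Continuous (radialRetraction δ) := by
  have : Continuous fun z : ℂ => δ / max δ ‖z‖ :=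
    continuous_const.div (continuous_const.max continuous_norm)
      fun z => (lt_max_of_lt_left hδ).ne'
  exact (Complex.continuous_ofReal.comp this).mul continuous_id

theorem norm_radialRetraction_le {δ : ℝ} (hδ : 0 < δ) (z : ℂ) : ‖radialRetraction δ z‖ ≤ δ := by
  have h0 : 0 < max δ ‖z‖ := lt_max_of_lt_left hδ
  rw [radialRetraction, norm_mul, Complex.norm_real, Real.norm_of_nonneg (by positivity),
    div_mul_eq_mul_div, div_le_iff₀ h0]
  exact mul_le_mul_of_nonneg_left (le_max_right _ _) hδ.le

theorem radialRetraction_eq {δ : ℝ} (hδ : 0 < δ) {z : ℂ} (hz : ‖z‖ ≤ δ) :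
    radialRetraction δ z = z := by
  rw [radialRetraction, max_eq_left hz, div_self hδ.ne', Complex.ofReal_one, one_mul]

/-- A function in `C_c(V)` that is small off `W` is close to a function in `C_c(V ∩ W)`. -/
theorem CcOn.exists_truncation {G : Type*} [TopologicalSpace G] {V W : Set G} [T2Space V]
    {f : G → ℂ} (hf : f ∈ CcOn V) {δ : ℝ} (hδ : 0 < δ)
    (h : ∀ g ∉ W, ‖f g‖ < δ) :
    ∃ f₁ f₂ : G → ℂ, f = f₁ + f₂ ∧ f₁ ∈ CcOn (V ∩ W) ∧ f₂ ∈ CcOn V ∧ ∀ g, ‖f₂ g‖ ≤ δ := by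
  have hT : T2Space (V ∩ W : Set G) := T2Space.of_injective_continuous
    (f := Set.inclusion Set.inter_subset_left) (Set.inclusion_injective _)
    (continuous_inclusion Set.inter_subset_left)
  have hcomp := CcOn.isCompact_le hf hδ
  obtain ⟨hc, K, hKV, hK, h0⟩ := mem_CcOn_iff.1 hf
  have hr : ContinuousOn (fun g => radialRetraction δ (f g)) V :=
    (continuous_radialRetraction hδ).comp_continuousOn hc
  -- The first summand vanishes wherever `|f| ≤ δ`, so it is carried by the compact set `{|f| ≥ δ}`.
  -- The strict inequality assumed off `W` places this set inside `W`.
  refine ⟨fun g => f g - radialRetraction δ (f g), fun g => radialRetraction δ (f g),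
    funext fun g => (sub_add_cancel _ _).symm, mem_CcOn_iff.2 ⟨?_, Subtype.val '' {v : V | δ ≤ ‖f v‖},
      ?_, hcomp.image continuous_subtype_val, fun g hg => ?_⟩,
    mem_CcOn_iff.2 ⟨hr, K, hKV, hK, fun g hg => ?_⟩, fun g => norm_radialRetraction_le hδ _⟩
  · exact (hc.sub hr).mono Set.inter_subset_left
  · rintro _ ⟨v, hv, rfl⟩
    exact ⟨v.2, by_contra fun hn => (h v hn).not_ge hv⟩
  · have h1 : ‖f g‖ ≤ δ := by
      by_contra! hn
      refine hg ⟨⟨g, ?_⟩, hn.le, rfl⟩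
      by_contra hgV
      rw [h0 g fun hk => hgV (hKV hk), norm_zero] at hn
      exact hδ.not_gt hn
    change f g - radialRetraction δ (f g) = 0
    rw [radialRetraction_eq hδ h1, sub_self]
  · rw [h0 g hg, radialRetraction, mul_zero]

namespace ArrowGroupoid

/-! ### Pointwise multiplication by functions on the unit space -/

section Diagonal

variable {G : Type*} [ArrowGroupoid G]

/-- Multiplication of a function on `G` by the pullback of a function on the unit space along the
range map. -/
def diagMul (ψ : UnitSpace G → ℂ) (f : G → ℂ) : G → ℂ := fun g => ψ (r g) * f g

/-- All arrows in the convolution sum at `g` have the range of `g`. This makes multiplication by `ψ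
∘ r` a left multiplier even when `ψ` has no compact support, as for `1 - χ`. -/
theorem diagMul_conv (ψ : UnitSpace G → ℂ) (f h : G → ℂ) :
    conv (diagMul ψ f) h = diagMul ψ (conv f h) := by
  funext g
  simp only [diagMul, conv, mul_finsum_mem]
  refine finsum_mem_congr rfl fun k hk => ?_
  rw [show r k = r g from hk, _root_.mul_assoc]

theorem r_inv_mul {h g : G} (e : r h = r g) : r (mul (inv h) g) = r (inv h) :=
  r_eq_iff.2 (rng_mul _ _ ((src_inv h).trans (r_eq_iff.1 e)))

/-- The factors `ψ` and `ψ'` are evaluated at the ranges of `h⁻¹` and `h⁻¹ g`, which coincide. So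
the adjoint of the multiplier `ψ` is the multiplier `ψ̄`. -/
theorem conv_invol_diagMul (ψ ψ' : UnitSpace G → ℂ) (f f' : G → ℂ) :
    conv (invol (diagMul ψ f)) (diagMul ψ' f') = conv (invol f) (diagMul (star ψ * ψ') f') := by
  funext g
  refine finsum_mem_congr rfl fun h hh => ?_
  simp only [invol, diagMul, Pi.mul_apply, Pi.star_apply, r_inv_mul hh, star_mul']
  ring

/-- Only the unit `h = r(g)` contributes to the sum. -/
theorem conv_extendUnits_left [TopologicalSpace G] [IsLCEtaleGroupoid G] (ψ : UnitSpace G → ℂ)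
    (f : G → ℂ) : conv (extendUnits ψ) f = diagMul ψ f := by
  funext g
  rw [conv, finsum_eq_single _ ((r g : UnitSpace G) : G)]
  · refine (finsum_eq_single _ (show ((r g : UnitSpace G) : G) ∈ {h : G | r h = r g} from
      r_unit (r g)) (fun x hx => absurd rfl hx)).trans ?_
    rw [extendUnits_coe, inv_unit, diagMul]
    congr 2
    exact rng_mul_self g
  · intro h hne
    by_cases hu : src h = h
    · have hr : r h ≠ r g := fun e => hne (by rw [← e]; exact (rng_unit ⟨h, hu⟩).symm)
      exact (finsum_congr (g := fun _ => (0 : ℂ)) fun (e : r h = r g) => absurd e hr).trans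
        finsum_zero
    · simp only [extendUnits_of_not ψ hu, zero_mul]
      exact finsum_zero

/-- For a function `f` supported in a bisection, `f* * f` is positive on the unit space and bounded by
the square of the supremum norm of `f`. -/
theorem exists_conv_invol_self_eq {B : Set G} (hB : Set.InjOn (s : G → UnitSpace G) B) {f : G → ℂ}
    (h0 : ∀ g ∉ B, f g = 0) {M : ℝ} (hM : ∀ g, ‖f g‖ ≤ M) (x : UnitSpace G) :
    ∃ t : ℝ, 0 ≤ t ∧ t ≤ M ^ 2 ∧ conv (invol f) f x = t := by
  -- At a unit `x` the sum runs over the arrows `h⁻¹` with source `x`, with terms `|f(h⁻¹)|²`.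
  -- Injectivity of `s` on `B` leaves at most one nonzero term.
  have hterm : ∀ h : G, r h = r (x : G) →
      invol f h * f (mul (inv h) x) = ((‖f (inv h)‖ ^ 2 : ℝ) : ℂ) := fun h hh => by
    have e : src (inv h) = x := by
      rw [src_inv, r_eq_iff.1 hh, rng_unit]
    have : mul (inv h) x = inv h := by
      rw [← e, mul_src_self]
    rw [this, invol, Complex.star_def, Complex.conj_mul']
    push_cast
    rfl
  by_cases hz : conv (invol f) f x = 0
  · exact ⟨0, le_rfl, sq_nonneg M, by rw [hz, Complex.ofReal_zero]⟩
  · obtain ⟨h, hh, hne⟩ := exists_ne_zero_of_finsum_mem_ne_zero hz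
    have hmem : ∀ k : G, invol f k ≠ 0 → inv k ∈ B := fun k hk => by
      by_contra hn
      exact hk (by rw [invol, h0 _ hn, star_zero])
    refine ⟨‖f (inv h)‖ ^ 2, sq_nonneg _, pow_le_pow_left₀ (norm_nonneg _) (hM _) 2, ?_⟩
    rw [← hterm h hh, conv, finsum_eq_single _ h]
    · exact finsum_eq_single _ (show h ∈ {h : G | r h = r (x : G)} from hh)
        (fun x hx => absurd rfl hx)
    · intro k hk
      refine (finsum_congr (g := fun _ => (0 : ℂ)) fun (e : r k = r (x : G)) => ?_).trans finsum_zero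
      by_contra hn
      refine hk ?_
      have e1 : inv k = inv h := hB (hmem k (left_ne_zero_of_mul hn))
        (hmem h (left_ne_zero_of_mul hne)) (s_eq_iff.2 (by
          rw [src_inv, src_inv]
          exact r_eq_iff.1 (e.trans (show r h = r (x : G) from hh).symm)))
      rw [← inv_inv k, e1, inv_inv]

end Diagonal

/-! ### Norm estimates for bisections and for multipliers -/

section Etale

variable {G : Type*} [TopologicalSpace G] [ArrowGroupoid G] [IsLCEtaleGroupoid G]

theorem diagMul_mem_Cc {U : Set G} {ψ : UnitSpace G → ℂ} (hψ : Continuous ψ) {f : G → ℂ}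
    (hf : f ∈ Cc U) : diagMul ψ f ∈ Cc U := by
  induction hf using Submodule.span_induction with
  | mem f h =>
    obtain ⟨V, hVU, hV, hT, hf⟩ := h
    exact Submodule.subset_span
      ⟨V, hVU, hV, hT, CcOn.mul_left hf (hψ.comp continuous_r).continuousOn⟩
  | zero =>
    rw [show diagMul ψ (0 : G → ℂ) = 0 from funext fun g => mul_zero _]
    exact Submodule.zero_mem _
  | add f₁ f₂ _ _ h₁ h₂ =>
    rw [show diagMul ψ (f₁ + f₂) = diagMul ψ f₁ + diagMul ψ f₂ from funext fun g => mul_add _ _ _]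
    exact Submodule.add_mem _ h₁ h₂
  | smul c f _ h =>
    rw [show diagMul ψ (c • f) = c • diagMul ψ f from funext fun g => mul_left_comm _ _ _]
    exact Submodule.smul_mem _ c h

/-- The C*-norm of a function supported in a bisection is at most its supremum norm. -/
theorem max_le_of_mem_CcOn {B : Set G} (hB : IsOpenBisection B) {f : CcAlg G} (hf : f.fn ∈ CcOn B)
    {M : ℝ} (hM : 0 ≤ M) (h : ∀ g, ‖f.fn g‖ ≤ M) : maxCStarSeminorm (CcAlg G) f ≤ M := by
  obtain ⟨φ, hφ⟩ := star_mul_self_mem hB hf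
  let φ' : C_c(UnitSpace G, ℂ) := φ
  have h1 : star f * f = unitsHom φ' := CcAlg.ext hφ
  have h2 : ∀ x, ‖φ' x‖ ≤ M ^ 2 := fun x => by
    obtain ⟨t, ht0, htM, ht⟩ := exists_conv_invol_self_eq hB.injOn_s
      (fun g hg => eq_zero_of_mem_CcOn hf hg) h x
    have h3 : φ' x = t := by
      rw [← ht, hφ]
      exact (extendUnits_coe φ' x).symm
    rw [h3, Complex.norm_real, Real.norm_of_nonneg ht0]
    exact htM
  refine ciSup_le fun p => ?_
  -- `f* f` lies in the commutative algebra `C_c(G⁰)`, where every C*-seminorm is at most the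
  -- supremum norm.
  have h4 : p (unitsHom φ') ≤ M ^ 2 := (p.comap unitsHom).le_of_bound φ' (sq_nonneg M) h2
  rw [← h1, p.star_mul_self] at h4
  exact abs_le_of_sq_le_sq' h4 hM |>.2

/-- Pointwise multiplication by a continuous function on the unit space. -/
def CcAlg.diag (ψ : UnitSpace G → ℂ) (hψ : Continuous ψ) (f : CcAlg G) : CcAlg G :=
  .mk (diagMul ψ f.fn) (diagMul_mem_Cc hψ f.fn_mem)

/-- With `χ = √(M² - |ψ|²)` one has `(ψ f)* (ψ f) + (χ f)* (χ f) = M² f* f`. Neither `ψ` nor `χ` has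
to be an element of the algebra: continuity suffices for `ψ f` and `χ f` to lie in `C_c(G)`. -/
theorem CcAlg.max_diag_le {ψ : UnitSpace G → ℂ} (hψ : Continuous ψ) {M : ℝ} (hM : 0 ≤ M)
    (h : ∀ x, ‖ψ x‖ ≤ M) (f : CcAlg G) :
    maxCStarSeminorm (CcAlg G) (f.diag ψ hψ) ≤ M * maxCStarSeminorm (CcAlg G) f := by
  let χ : UnitSpace G → ℂ := fun x => ((√(M ^ 2 - ‖ψ x‖ ^ 2) : ℝ) : ℂ)
  have hχ : Continuous χ := by fun_prop
  refine CStarSeminorm.le_mul_of_star_mul_self_add _ (c := f.diag χ hχ) hM (CcAlg.ext ?_)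
  change conv (invol (diagMul ψ f.fn)) (diagMul ψ f.fn) +
    conv (invol (diagMul χ f.fn)) (diagMul χ f.fn) = ((M ^ 2 : ℝ) : ℂ) • conv (invol f.fn) f.fn
  rw [conv_invol_diagMul, conv_invol_diagMul, ← conv_add (f₁ := invol f.fn) (star f).rFin, ← conv_smul]
  congr 1
  funext g
  simp only [diagMul, Pi.add_apply, Pi.mul_apply, Pi.star_apply, Pi.smul_apply, smul_eq_mul,
    ← add_mul, χ]
  congr 1
  have h1 : 0 ≤ M ^ 2 - ‖ψ (r g)‖ ^ 2 :=
    sub_nonneg.2 (pow_le_pow_left₀ (norm_nonneg _) (h _) 2)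
  rw [Complex.star_def, Complex.conj_mul', Complex.conj_ofReal,
    ← Complex.ofReal_mul, Real.mul_self_sqrt h1]
  push_cast
  ring

end Etale

end ArrowGroupoid

end

noncomputable section

namespace ArrowGroupoid

/-! ### Approximation of functions vanishing off an open set -/

section Approximation

variable {G : Type*} [TopologicalSpace G] [ArrowGroupoid G] [IsLCEtaleGroupoid G]

/-- The functions in `C_c(U)` as elements of the convolution algebra. -/
def CcAlg.supported (U : Set G) : Submodule ℂ (CcAlg G) where
  carrier := {f | f.fn ∈ Cc U}
  add_mem' h₁ h₂ := (Cc U).add_mem h₁ h₂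
  zero_mem' := (Cc U).zero_mem
  smul_mem' c _ h := (Cc U).smul_mem c h

/-- An element of `C_c(B)`, for an open bisection `B`, as an element of the convolution algebra. -/
def CcAlg.ofBisection {B : Set G} (hB : IsOpenBisection B) (f : G → ℂ) (hf : f ∈ CcOn B) :
    CcAlg G :=
  have := hB.t2
  .mk f (CcOn_le_Cc (Set.subset_univ _) hB.isOpen hf)

theorem CcAlg.fn_sum {ι : Type*} (t : Finset ι) (F : ι → CcAlg G) (g : G) :
    (∑ i ∈ t, F i).fn g = ∑ i ∈ t, (F i).fn g := by
  classical
  induction t using Finset.induction_on with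
  | empty => rfl
  | insert a t ha ih => rw [Finset.sum_insert ha, Finset.sum_insert ha, ← ih]; rfl

/-- A function in `C_c(V)` that vanishes off the union of finitely many open sets `B i`, up to a
small error, is up to a small error a sum of functions in `C_c(B i)`. -/
theorem CcOn.exists_sum_decomposition {V : Set G} (hV : IsOpen V) [T2Space V] {f : G → ℂ}
    (hf : f ∈ CcOn V) {n : ℕ} {B : Fin n → Set G} (hBo : ∀ i, IsOpen (B i))
    (hBT : ∀ i, T2Space (B i)) {Z : Set G} (hZ : IsClosed Z) {δ : ℝ} (hδ : 0 < δ)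
    (h : ∀ g ∈ Z, δ ≤ ‖f g‖ → ∃ i, g ∈ B i) :
    ∃ (F : Fin n → G → ℂ) (e : G → ℂ), f = ∑ i, F i + e ∧ (∀ i, F i ∈ CcOn (B i)) ∧ e ∈ CcOn V ∧
      ∀ g ∈ Z, ‖e g‖ < (n + 1) * δ := by
  have : LocallyCompactSpace G := IsLCEtaleGroupoid.locallyCompact
  have : LocallyCompactSpace V := hV.locallyCompactSpace
  -- Only the part of `Z` where `f` is large must be covered. The partition functions sum to one
  -- there and may sum to anything elsewhere.
  have hK : IsCompact ({v : V | δ ≤ ‖f v‖} ∩ Subtype.val ⁻¹' Z) :=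
    (CcOn.isCompact_le hf hδ).inter_right (hZ.preimage continuous_subtype_val)
  obtain ⟨ρ, hρs, hρ1, hρ01, hρc⟩ := exists_continuous_sum_one_of_isOpen_isCompact
    (s := fun i => (Subtype.val ⁻¹' B i : Set V))
    (fun i => (hBo i).preimage continuous_subtype_val) hK (fun v hv => by
      obtain ⟨i, hi⟩ := h v hv.2 hv.1
      exact Set.mem_iUnion.2 ⟨i, hi⟩)
  let R : Fin n → G → ℂ := fun i => Function.extend (Subtype.val : V → G) (fun v => (ρ i v : ℂ)) 0
  have hR : ∀ i (v : V), R i v = ρ i v := fun i v => Subtype.val_injective.extend_apply _ _ v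
  have hRc : ∀ i, ContinuousOn (R i) V := fun i => by
    rw [continuousOn_iff_continuous_domRestrict]
    have : V.domRestrict (R i) = fun v => (ρ i v : ℂ) := funext (hR i)
    rw [this]
    exact Complex.continuous_ofReal.comp (ρ i).continuous
  have hfc := (mem_CcOn_iff.1 hf).1
  refine ⟨fun i g => R i g * f g, fun g => (1 - ∑ i, R i g) * f g, ?_, fun i => ?_, ?_, ?_⟩
  · funext g
    simp only [Pi.add_apply, Finset.sum_apply, ← Finset.sum_mul]
    ring
  · have := hBT i
    have hT : T2Space (V ∩ B i : Set G) := T2Space.of_injective_continuous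
      (f := Set.inclusion Set.inter_subset_left) (Set.inclusion_injective _)
      (continuous_inclusion Set.inter_subset_left)
    -- The product has compact support in `V ∩ B i`. It stays continuous on all of `B i` because a
    -- compact subset of the Hausdorff space `B i` is closed there.
    refine CcOn_mono Set.inter_subset_right (hV.inter (hBo i)) (mem_CcOn_iff.2
      ⟨((hRc i).mul hfc).mono Set.inter_subset_left, Subtype.val '' tsupport (ρ i), ?_,
        (hρc i).isCompact.image continuous_subtype_val, fun g hg => ?_⟩)
    · rintro _ ⟨v, hv, rfl⟩
      exact ⟨v.2, hρs i hv⟩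
    · change R i g * f g = 0
      by_cases hgV : g ∈ V
      · rw [hR i ⟨g, hgV⟩, image_eq_zero_of_notMem_tsupport fun h => hg ⟨_, h, rfl⟩,
          Complex.ofReal_zero, zero_mul]
      · rw [eq_zero_of_mem_CcOn hf hgV, mul_zero]
  · exact CcOn.mul_left hf (continuousOn_const.sub (continuousOn_finsetSum _ fun i _ => hRc i))
  · intro g hg
    have hpos : 0 < ((n : ℝ) + 1) * δ := by positivity
    by_cases hgV : g ∈ V
    · by_cases hge : δ ≤ ‖f g‖
      · have h1 := hρ1 (show (⟨g, hgV⟩ : V) ∈ _ from ⟨hge, hg⟩)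
        have h2 : ∑ i, R i g = 1 := by
          simp only [hR _ ⟨g, hgV⟩]
          rw [← Complex.ofReal_sum, ← Finset.sum_apply, h1]
          simp
        simpa [h2] using hpos
      · push Not at hge
        -- Away from the compact set only `0 ≤ R i ≤ 1` is available, whence the crude factor `n +
        -- 1`.
        have h2 : ‖1 - ∑ i, R i g‖ ≤ n + 1 := by
          refine (norm_sub_le _ _).trans ?_
          rw [norm_one, add_comm]
          gcongr
          refine (norm_sum_le _ _).trans ?_
          refine (Finset.sum_le_card_nsmul _ _ 1 fun i _ => ?_).trans (by simp)
          rw [hR i ⟨g, hgV⟩, Complex.norm_real, Real.norm_of_nonneg (hρ01 i _).1]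
          exact (hρ01 i _).2
        rw [norm_mul]
        exact mul_lt_mul' h2 hge (norm_nonneg _) (by positivity)
    · simpa [eq_zero_of_mem_CcOn hf hgV] using hpos

/-- The distance from a sum `f` of `n` functions supported in bisections to the functions in
`C_c(G)` supported in an open set is controlled by the supremum of `f` over the complement. -/
theorem exists_dist_supported_le {W : Set G} (hW : IsOpen W) (n : ℕ) :
    ∃ C : ℝ, 0 ≤ C ∧ ∀ (B : Fin n → Set G) (F : Fin n → CcAlg G), (∀ i, IsOpenBisection (B i)) →
      (∀ i, (F i).fn ∈ CcOn (B i)) → ∀ ε : ℝ, 0 < ε → (∀ g ∉ W, ‖∑ i, (F i).fn g‖ ≤ ε) →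
      ∃ h ∈ CcAlg.supported W, maxCStarSeminorm (CcAlg G) (∑ i, F i - h) ≤ C * ε := by
  induction n with
  | zero =>
    refine ⟨0, le_rfl, fun B F _ _ ε _ _ => ⟨0, Submodule.zero_mem _, ?_⟩⟩
    rw [Finset.univ_eq_empty, Finset.sum_empty, sub_zero, zero_mul]
    exact (map_zero (maxCStarSeminorm (CcAlg G)).toSeminorm).le
  | succ n ih =>
    obtain ⟨C, hC, ih⟩ := ih
    -- Splitting off the last summand leaves an error `e` smaller than `(n + 1) * 2ε` off `W`. The
    -- first term of the constant is the bound for the remaining `n` summands, whose sum off `W` is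
    -- at most `ε + (n + 1) * 2ε`; the second is the norm of the truncated part of `e`.
    refine ⟨C * (1 + (n + 1) * 2) + (n + 1) * 2, by positivity, fun B F hB hF ε hε h => ?_⟩
    have hBT := fun i => (hB i).t2
    obtain ⟨F', e, hsum, hF', he, heZ⟩ := CcOn.exists_sum_decomposition
      (hB (Fin.last n)).isOpen (hF (Fin.last n)) (B := fun i => B i.castSucc)
      (fun i => (hB _).isOpen) (fun i => hBT _) hW.isClosed_compl
      -- If `g ∉ W` lies in no other bisection, the last summand is the whole sum at `g` and has
      -- modulus at most `ε`. The threshold `2ε` excludes this.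
      (mul_pos two_pos hε) (fun g hg hge => by
        by_contra! hn
        have h1 := h g hg
        rw [Fin.sum_univ_castSucc, Finset.sum_eq_zero fun i _ => eq_zero_of_mem_CcOn (hF _) (hn i),
          zero_add] at h1
        linarith)
    have hδ : 0 < ((n : ℝ) + 1) * (2 * ε) := by positivity
    -- The error lives on a single bisection: `e₁` is supported in `W` and joins the approximant,
    -- and `e₂` has small C*-norm because its supremum norm is small.
    obtain ⟨e₁, e₂, rfl, he₁, he₂, hle⟩ := CcOn.exists_truncation he (W := W) hδ heZ
    -- The pieces of the last summand are absorbed by the other bisections, so the number of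
    -- bisections drops by one.
    let H : Fin n → CcAlg G := fun i =>
      F i.castSucc + CcAlg.ofBisection (hB i.castSucc) (F' i) (hF' i)
    have hBW : IsOpenBisection (B (Fin.last n) ∩ W) :=
      ⟨(hB _).isOpen.inter hW, (hB _).injOn_r.mono Set.inter_subset_left,
        (hB _).injOn_s.mono Set.inter_subset_left⟩
    let E₁ : CcAlg G := CcAlg.ofBisection hBW e₁ he₁
    let E₂ : CcAlg G := CcAlg.ofBisection (hB _) e₂ he₂
    have htot : ∑ i, F i = ∑ i, H i + E₁ + E₂ := by
      refine CcAlg.ext (funext fun g => ?_)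
      have h1 := congrFun hsum g
      rw [CcAlg.fn_add, CcAlg.fn_add, Pi.add_apply, Pi.add_apply, CcAlg.fn_sum, CcAlg.fn_sum,
        Fin.sum_univ_castSucc, h1]
      simp only [H, CcAlg.fn_add, Pi.add_apply, Finset.sum_add_distrib, Finset.sum_apply]
      simp only [E₁, E₂, CcAlg.ofBisection, CcAlg.fn_mk]
      ring
    obtain ⟨k, hk, hk'⟩ := ih (fun i => B i.castSucc) H (fun i => hB _)
      (fun i => CcOn.add (hF _) (hF' i)) ((1 + (n + 1) * 2) * ε) (by positivity) (fun g hg => by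
        have h1 := congrArg (fun f : CcAlg G => f.fn g) htot
        simp only [CcAlg.fn_add, Pi.add_apply, CcAlg.fn_sum] at h1
        have h2 : ∑ i, (H i).fn g = ∑ i, (F i).fn g - (e₁ + e₂) g := by
          rw [h1, Pi.add_apply]
          simp only [E₁, E₂, CcAlg.ofBisection, CcAlg.fn_mk]
          ring
        rw [h2]
        refine (norm_sub_le _ _).trans ((add_le_add (h g hg) (heZ g hg).le).trans (le_of_eq ?_))
        ring)
    have := hBW.t2
    refine ⟨k + E₁, Submodule.add_mem _ hk (CcOn_le_Cc Set.inter_subset_right hBW.isOpen he₁), ?_⟩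
    have e3 : ∑ i, F i - (k + E₁) = (∑ i, H i - k) + E₂ := by
      rw [htot]
      abel
    rw [e3]
    refine (map_add_le_add (maxCStarSeminorm (CcAlg G)).toSeminorm _ _).trans
      ((add_le_add hk' (max_le_of_mem_CcOn (f := E₂) (hB _) he₂ hδ.le hle)).trans (le_of_eq ?_))
    ring

/-- The scalars of a linear combination are absorbed into the summands. The index type `Fin n` is
the form required by the induction on the number of bisections. -/
theorem CcAlg.exists_eq_sum (f : CcAlg G) : ∃ (n : ℕ) (B : Fin n → Set G) (F : Fin n → CcAlg G),
    (∀ i, IsOpenBisection (B i)) ∧ (∀ i, (F i).fn ∈ CcOn (B i)) ∧ f = ∑ i, F i := by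
  have hf := f.fn_mem
  rw [Cc_eq_span, Submodule.mem_span_set'] at hf
  obtain ⟨n, c, g, h⟩ := hf
  choose B hB _ hg using fun i => (g i).2
  have := fun i => (hB i).t2
  refine ⟨n, B, fun i => c i • CcAlg.ofBisection (hB i) (g i) (hg i), hB,
    fun i => CcOn.smul _ (hg i), CcAlg.ext ?_⟩
  rw [← h]
  funext x
  rw [CcAlg.fn_sum, Finset.sum_apply]
  rfl

/-- A function in `C_c(G)` that vanishes off an open set `W` is approximated by functions in
`C_c(W)`. -/
theorem exists_supported_near {W : Set G} (hW : IsOpen W) {f : CcAlg G}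
    (hf : ∀ g ∉ W, f.fn g = 0) {ε : ℝ} (hε : 0 < ε) :
    ∃ h ∈ CcAlg.supported W, maxCStarSeminorm (CcAlg G) (f - h) < ε := by
  obtain ⟨n, B, F, hB, hF, rfl⟩ := f.exists_eq_sum
  obtain ⟨C, hC, H⟩ := exists_dist_supported_le hW n
  -- The sum is zero off `W`, so any positive bound is allowed. The denominator `C + 1` covers the
  -- case `C = 0` and makes the final inequality strict.
  obtain ⟨h, hh, hle⟩ := H B F hB hF (ε / (C + 1)) (by positivity) (fun g hg => by
    rw [← CcAlg.fn_sum, hf g hg, norm_zero]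
    positivity)
  refine ⟨h, hh, hle.trans_lt ?_⟩
  rw [← mul_div_assoc, div_lt_iff₀ (by positivity)]
  linarith

end Approximation

end ArrowGroupoid

end

noncomputable section

/-- A continuous function with compact support in an open set that is equal to one on a given
compact subset. -/
theorem exists_bump_of_isCompact {Y : Type*} [TopologicalSpace Y] [T2Space Y]
    [LocallyCompactSpace Y] {K U : Set Y} (hK : IsCompact K) (hU : IsOpen U) (hKU : K ⊆ U) :
    ∃ χ : C_c(Y, ℂ), Set.EqOn χ 1 K ∧ tsupport χ ⊆ U ∧ ∀ y, ‖1 - χ y‖ ≤ 1 := by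
  obtain ⟨L, hL, hKL, hLU⟩ := exists_compact_between hK hU hKU
  obtain ⟨χ, hχ1, hχ0, hχc, hχ01⟩ := exists_continuous_one_zero_of_isCompact hK
    isOpen_interior.isClosed_compl (Set.disjoint_compl_right_iff_subset.2 hKL)
  have h0 : ∀ y ∉ L, (χ y : ℂ) = 0 := fun y hy => by
    rw [hχ0 fun h => hy (interior_subset h), Pi.zero_apply, Complex.ofReal_zero]
  let f : C_c(Y, ℂ) := ⟨⟨fun y => (χ y : ℂ), Complex.continuous_ofReal.comp χ.continuous⟩,
    HasCompactSupport.intro hL h0⟩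
  refine ⟨f, fun y hy => ?_, ?_, fun y => ?_⟩
  · change (χ y : ℂ) = 1
    rw [hχ1 hy, Pi.one_apply, Complex.ofReal_one]
  · refine (closure_minimal (fun y hy => ?_) hL.isClosed).trans hLU
    by_contra hn
    exact hy (h0 y hn)
  · change ‖1 - (χ y : ℂ)‖ ≤ 1
    rw [← Complex.ofReal_one, ← Complex.ofReal_sub, Complex.norm_real, Real.norm_eq_abs, abs_le]
    constructor <;> linarith [(hχ01 y).1, (hχ01 y).2]

namespace ArrowGroupoid

variable {G : Type*} [TopologicalSpace G] [ArrowGroupoid G] [IsLCEtaleGroupoid G]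

/-! ### Extension from a closed subset and surjectivity of the restriction -/

section Extension

/-- Tietze extension for functions of compact support on a closed subset of an open Hausdorff
subset. -/
theorem CcOn_exists_extension {Y : Type*} [TopologicalSpace Y] {e : Y → G}
    (he : Topology.IsClosedEmbedding e) {V : Set G} (hV : IsOpen V) [T2Space V] {f : Y → ℂ}
    (hf : f ∈ CcOn (e ⁻¹' V)) : ∃ F ∈ CcOn V, F ∘ e = f := by
  have : LocallyCompactSpace G := IsLCEtaleGroupoid.locallyCompact
  have : LocallyCompactSpace V := hV.locallyCompactSpace
  have : T2Space (e ⁻¹' V) := T2Space.of_injective_continuous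
    (f := V.restrictPreimage e) (he.injective.restrictPreimage _) he.continuous.restrictPreimage
  obtain ⟨hc, K, hKV, hK, h0⟩ := mem_CcOn_iff.1 hf
  have hK' : IsCompact (Subtype.val ⁻¹' (e '' K) : Set V) := by
    rw [Subtype.isCompact_iff, Subtype.image_preimage_coe,
      Set.inter_eq_right.2 (Set.image_subset_iff.2 hKV)]
    exact hK.image he.continuous
  -- `V` is locally compact Hausdorff but perhaps not normal, so Tietze's theorem is applied on a
  -- compact neighbourhood `L` of the support, and the extension is cut off by a bump function
  -- supported in the interior of `L`.
  obtain ⟨L, hL, hKL⟩ := exists_compact_superset hK'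
  obtain ⟨χ, hχ1, hχL, -⟩ := exists_bump_of_isCompact hK' isOpen_interior hKL
  have : CompactSpace L := isCompact_iff_compactSpace.1 hL
  let f' : G → ℂ := Function.extend e f 0
  have hf' : f' ∘ e = f := funext fun y => he.injective.extend_apply f 0 y
  have hf'c : ContinuousOn f' (e '' (e ⁻¹' V)) :=
    he.isInducing.continuousOn_image_iff.2 (by rw [hf']; exact hc)
  let j : L → G := fun l => l.1.1
  have hj : Topology.IsEmbedding j :=
    Topology.IsEmbedding.subtypeVal.comp Topology.IsEmbedding.subtypeVal
  let D : Set L := j ⁻¹' Set.range e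
  obtain ⟨g, hg⟩ := ContinuousMap.exists_restrict_eq (he.isClosed_range.preimage hj.continuous)
    (⟨fun d : D => f' (j d), hf'c.comp_continuous (hj.continuous.comp continuous_subtype_val)
      fun d => by
        obtain ⟨y, hy⟩ := d.2
        exact ⟨y, by rw [Set.mem_preimage, hy]; exact d.1.1.2, hy⟩⟩ : C(D, ℂ))
  let g' : G → ℂ := Function.extend j g 0
  have hg' : ∀ l, g' (j l) = g l := fun l => hj.injective.extend_apply g 0 l
  have hg'c : ContinuousOn g' (Set.range j) := by
    rw [← Set.image_univ, hj.isInducing.continuousOn_image_iff, continuousOn_univ,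
      show g' ∘ j = g from funext hg']
    exact g.continuous
  let χ' : G → ℂ := Function.extend (Subtype.val : V → G) χ 0
  have hχ' : ∀ v : V, χ' v = χ v := fun v => Subtype.val_injective.extend_apply _ _ v
  have hχ'V : χ' ∈ CcOn V := ⟨χ, rfl⟩
  let O : Set G := Subtype.val '' interior L
  have hO : IsOpen O := hV.isOpenMap_subtype_val _ isOpen_interior
  have hOV : O ⊆ V := by
    rintro _ ⟨v, -, rfl⟩
    exact v.2
  have hOj : O ⊆ Set.range j := by
    rintro _ ⟨v, hv, rfl⟩
    exact ⟨⟨v, interior_subset hv⟩, rfl⟩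
  have : T2Space O := T2Space.of_injective_continuous
    (f := Set.inclusion hOV) (Set.inclusion_injective _) (continuous_inclusion hOV)
  refine ⟨fun x => χ' x * g' x, CcOn_mono hOV hO (mem_CcOn_iff.2
    ⟨((mem_CcOn_iff.1 hχ'V).1.mono hOV).mul (hg'c.mono hOj), Subtype.val '' tsupport χ,
      Set.image_mono hχL, χ.hasCompactSupport.isCompact.image continuous_subtype_val,
      fun x hx => ?_⟩), funext fun y => ?_⟩
  · by_cases hxV : x ∈ V
    · rw [hχ' ⟨x, hxV⟩, image_eq_zero_of_notMem_tsupport fun h => hx ⟨_, h, rfl⟩, zero_mul]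
    · rw [eq_zero_of_mem_CcOn hχ'V hxV, zero_mul]
  · change χ' (e y) * g' (e y) = f y
    by_cases hyV : e y ∈ V
    -- The cutoff is one on `e '' K`. Elsewhere on the range of `e` either `f` or the cutoff
    -- vanishes, so the product still restricts to `f`.
    · by_cases hyL : (⟨e y, hyV⟩ : V) ∈ L
      · have h1 : g' (e y) = f y := by
          have h2 := congrArg (fun k : C(D, ℂ) => k ⟨⟨⟨e y, hyV⟩, hyL⟩, ⟨y, rfl⟩⟩) hg
          exact (hg' ⟨⟨e y, hyV⟩, hyL⟩).trans (h2.trans (congrFun hf' y))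
        rw [h1]
        by_cases hyK : y ∈ K
        · rw [hχ' ⟨e y, hyV⟩, hχ1 ⟨y, hyK, rfl⟩, Pi.one_apply, one_mul]
        · rw [h0 y hyK, mul_zero]
      · have hyK : y ∉ K := fun h => hyL (interior_subset (hKL ⟨y, h, rfl⟩))
        rw [h0 y hyK, hχ' ⟨e y, hyV⟩, image_eq_zero_of_notMem_tsupport fun h =>
          hyL (interior_subset (hχL h)), zero_mul]
    · rw [eq_zero_of_mem_CcOn hχ'V hyV, zero_mul, h0 y fun h => hyV (hKV h)]

variable {X : Set (UnitSpace G)} (hX : IsInvariant X)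

/-- Open subsets of `G_X` are locally traces of open bisections of `G`. A partition of unity reduces
to functions carried by one such trace, and these extend to the bisection. -/
theorem restrictCc_surjective (hc : IsClosed X) : Function.Surjective (restrictCc hX hc) := by
  let v := Reduction.val hX hc.isLocallyClosed
  have he : Topology.IsClosedEmbedding v := isClosedEmbedding_val hX hc
  have : LocallyCompactSpace (Reduction X hX hc.isLocallyClosed) :=
    IsLCEtaleGroupoid.locallyCompact
  have key : Cc (Set.univ : Set (Reduction X hX hc.isLocallyClosed)) ≤
      (Cc (Set.univ : Set G)).map (LinearMap.funLeft ℂ ℂ v) := by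
    rw [Cc_eq_span]
    refine Submodule.span_le.2 ?_
    rintro f ⟨V, hV, -, hf⟩
    have := hV.t2
    have h1 := CcOn_mem_span hV.isOpen (fun S => ∃ B : Set G, IsOpenBisection B ∧ v ⁻¹' B = S)
      (fun g hg => by
        obtain ⟨O, hO, rfl⟩ := he.isInducing.isOpen_iff.1 hV.isOpen
        obtain ⟨B, hgB, hBo, hBO, hB⟩ := exists_bisection hO (show v g ∈ O from hg)
        exact ⟨v ⁻¹' B, hgB, hBo.preimage he.continuous, Set.preimage_mono hBO, B, hB, rfl⟩) hf
    refine Submodule.span_le.2 ?_ h1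
    rintro f ⟨_, -, -, ⟨B, hB, rfl⟩, hf⟩
    have := hB.t2
    obtain ⟨F, hF, hFf⟩ := CcOn_exists_extension he hB.isOpen hf
    exact ⟨F, CcOn_le_Cc (Set.subset_univ _) hB.isOpen hF, hFf⟩
  intro f
  obtain ⟨F, hF, hFf⟩ := key f.fn_mem
  exact ⟨.mk F hF, CcAlg.ext hFf⟩

end Extension

/-! ### The ideal of functions supported over an open invariant set -/

section Ideal

variable {U : Set (UnitSpace G)}

/-- For `f` vanishing off a compact `K ⊆ V`, the product is carried by `K ∩ r⁻¹(tsupport χ)`, a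
closed subset of a compact set, hence compact, and contained in `V ∩ r⁻¹(U)`. -/
theorem CcAlg.diag_mem_supported (hU : IsOpen U) (χ : C_c(UnitSpace G, ℂ)) (hχ : tsupport χ ⊆ U)
    (f : CcAlg G) : f.diag χ χ.continuous ∈ CcAlg.supported {g : G | r g ∈ U} := by
  suffices h : ∀ f : G → ℂ, f ∈ Cc Set.univ → diagMul χ f ∈ Cc {g : G | r g ∈ U} from
    h f.fn f.fn_mem
  intro f hf
  induction hf using Submodule.span_induction with
  | mem f h =>
    obtain ⟨V, -, hV, hT, hf⟩ := h
    obtain ⟨hc, K, hKV, hK, h0⟩ := mem_CcOn_iff.1 hf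
    have : T2Space (V ∩ {g : G | r g ∈ U} : Set G) := T2Space.of_injective_continuous
      (f := Set.inclusion Set.inter_subset_left) (Set.inclusion_injective _)
      (continuous_inclusion Set.inter_subset_left)
    refine CcOn_le_Cc Set.inter_subset_right
      (hV.inter (show IsOpen {g : G | r g ∈ U} from hU.preimage continuous_r))
      (mem_CcOn_iff.2 ⟨((χ.continuous.comp continuous_r).continuousOn.mul hc).mono
        Set.inter_subset_left, K ∩ r ⁻¹' tsupport χ, fun g hg => ⟨hKV hg.1, hχ hg.2⟩,
        hK.inter_right ((isClosed_tsupport χ).preimage continuous_r), fun g hg => ?_⟩)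
    change χ (r g) * f g = 0
    by_cases hgK : g ∈ K
    · rw [image_eq_zero_of_notMem_tsupport fun h => hg ⟨hgK, h⟩, zero_mul]
    · rw [h0 g hgK, mul_zero]
  | zero =>
    rw [show diagMul χ (0 : G → ℂ) = 0 from funext fun g => mul_zero _]
    exact Submodule.zero_mem _
  | add f₁ f₂ _ _ h₁ h₂ =>
    rw [show diagMul χ (f₁ + f₂) = diagMul χ f₁ + diagMul χ f₂ from funext fun g => mul_add _ _ _]
    exact Submodule.add_mem _ h₁ h₂
  | smul c f _ h =>
    rw [show diagMul χ (c • f) = c • diagMul χ f from funext fun g => mul_left_comm _ _ _]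
    exact Submodule.smul_mem _ c h

/-- This is the property that distinguishes `C_c(r⁻¹(U))` from the functions that merely vanish off
`r⁻¹(U)`, and it is what provides local units. -/
theorem exists_isCompact_of_mem_Cc {f : G → ℂ} (hf : f ∈ Cc {g : G | r g ∈ U}) :
    ∃ L ⊆ U, IsCompact L ∧ ∀ g, f g ≠ 0 → r g ∈ L := by
  induction hf using Submodule.span_induction with
  | mem f h =>
    obtain ⟨V, hVU, hV, hT, hf⟩ := h
    obtain ⟨-, K, hKV, hK, h0⟩ := mem_CcOn_iff.1 hf
    refine ⟨r '' K, ?_, hK.image continuous_r, fun g hg => ⟨g, ?_, rfl⟩⟩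
    · rintro _ ⟨g, hg, rfl⟩
      exact hVU (hKV hg)
    · by_contra hn
      exact hg (h0 g hn)
  | zero => exact ⟨∅, Set.empty_subset _, isCompact_empty, fun g hg => absurd rfl hg⟩
  | add f₁ f₂ _ _ h₁ h₂ =>
    obtain ⟨L₁, hLU₁, hL₁, h₁⟩ := h₁
    obtain ⟨L₂, hLU₂, hL₂, h₂⟩ := h₂
    refine ⟨L₁ ∪ L₂, Set.union_subset hLU₁ hLU₂, hL₁.union hL₂, fun g hg => ?_⟩
    by_cases hg₁ : f₁ g = 0
    · refine .inr (h₂ g fun hg₂ => hg ?_)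
      rw [Pi.add_apply, hg₁, hg₂, add_zero]
    · exact .inl (h₁ g hg₁)
  | smul c f _ h =>
    obtain ⟨L, hLU, hL, h⟩ := h
    exact ⟨L, hLU, hL, fun g hg => h g (right_ne_zero_of_mul hg)⟩

/-- The functions supported over an open set of units have local left units in `C_c(U)`. -/
theorem CcAlg.exists_diag_eq_self (hU : IsOpen U) {f : CcAlg G}
    (hf : f ∈ CcAlg.supported {g : G | r g ∈ U}) :
    ∃ χ : C_c(UnitSpace G, ℂ), tsupport χ ⊆ U ∧ (∀ y, ‖1 - χ y‖ ≤ 1) ∧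
      f.diag χ χ.continuous = f := by
  obtain ⟨L, hLU, hL, h⟩ := exists_isCompact_of_mem_Cc hf
  obtain ⟨χ, hχ1, hχU, hχ⟩ := exists_bump_of_isCompact hL hU hLU
  refine ⟨χ, hχU, hχ, CcAlg.ext (funext fun g => ?_)⟩
  change χ (r g) * f.fn g = f.fn g
  by_cases hg : f.fn g = 0
  · rw [hg, mul_zero]
  · rw [hχ1 (h g hg), Pi.one_apply, one_mul]

theorem CcAlg.star_mem_supported (hX : IsInvariant U) {f : CcAlg G}
    (hf : f ∈ CcAlg.supported {g : G | r g ∈ U}) : star f ∈ CcAlg.supported {g : G | r g ∈ U} := by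
  suffices h : ∀ f : G → ℂ, f ∈ Cc {g : G | r g ∈ U} → invol f ∈ Cc {g : G | r g ∈ U} from
    h f.fn hf
  intro f hf
  rw [Cc_eq_span] at hf
  induction hf using Submodule.span_induction with
  | mem f h =>
    obtain ⟨B, hB, hBU, hf⟩ := h
    have := hB.preimage_inv.t2
    refine CcOn_le_Cc (fun g hg => ?_) hB.preimage_inv.isOpen (invol_mem_CcOn hB hf)
    have h1 : r (inv g) ∈ U := hBU hg
    rw [show r (inv g) = s g from Subtype.ext (rng_inv g)] at h1
    exact (hX g).2 h1
  | zero =>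
    rw [show invol (0 : G → ℂ) = 0 from funext fun g => star_zero _]
    exact Submodule.zero_mem _
  | add f₁ f₂ _ _ h₁ h₂ => rw [invol_add]; exact Submodule.add_mem _ h₁ h₂
  | smul c f _ h => rw [invol_smul]; exact Submodule.smul_mem _ _ h

/-- With a local left unit `χ` for `f`, `f * h = (χ f) * h = χ (f * h)`. Invariance of `U` enters
only when adjoints are taken to get the other side. -/
theorem CcAlg.mul_mem_supported_left (hU : IsOpen U) {f : CcAlg G} (h : CcAlg G)
    (hf : f ∈ CcAlg.supported {g : G | r g ∈ U}) : f * h ∈ CcAlg.supported {g : G | r g ∈ U} := by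
  obtain ⟨χ, hχU, -, hχ⟩ := CcAlg.exists_diag_eq_self hU hf
  have : f * h = (f * h).diag χ χ.continuous := CcAlg.ext (by
    have h1 := diagMul_conv χ f.fn h.fn
    rwa [show diagMul χ f.fn = f.fn from congrArg CcAlg.fn hχ] at h1)
  rw [this]
  exact CcAlg.diag_mem_supported hU χ hχU _

theorem CcAlg.mul_mem_supported_right (hU : IsOpen U) (hX : IsInvariant U) (h : CcAlg G)
    {f : CcAlg G} (hf : f ∈ CcAlg.supported {g : G | r g ∈ U}) :
    h * f ∈ CcAlg.supported {g : G | r g ∈ U} := by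
  have := CcAlg.star_mem_supported hX
    (CcAlg.mul_mem_supported_left hU (star h) (CcAlg.star_mem_supported hX hf))
  rwa [star_mul, star_star, star_star] at this

/-- The distance to the ideal of functions supported over an open invariant set is a
C*-seminorm. -/
theorem exists_quotient_supported (hU : IsOpen U) (hX : IsInvariant U) :
    ∃ q : CStarSeminorm (CcAlg G),
      (∀ a, ∀ j ∈ CcAlg.supported {g : G | r g ∈ U}, q a ≤ maxCStarSeminorm (CcAlg G) (a - j)) ∧
      ∀ a, ∀ ε > 0, ∃ j ∈ CcAlg.supported {g : G | r g ∈ U},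
        maxCStarSeminorm (CcAlg G) (a - j) < q a + ε := by
  refine CStarSeminorm.exists_quotient _ _ (fun j hj => CcAlg.star_mem_supported hX hj)
    (fun a j hj => CcAlg.mul_mem_supported_right hU hX a hj) fun j hj => ?_
  obtain ⟨χ, hχU, hχ1, hχ⟩ := CcAlg.exists_diag_eq_self hU hj
  have hcont : Continuous fun x => 1 - χ x := continuous_const.sub χ.continuous
  have hsub : ∀ a : CcAlg G, a.diag _ hcont = a - a.diag χ χ.continuous := fun a =>
    CcAlg.ext (funext fun g => one_sub_mul (χ (r g)) (a.fn g))
  -- The multiplier is `1 - χ` for a local unit `χ` of `j`: it kills `j`, is contractive as `|1 - χ|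
  -- ≤ 1`, and differs from the identity by multiplication by `χ`, which maps into the ideal.
  refine ⟨fun a => a.diag _ hcont, fun a b => CcAlg.ext (diagMul_conv (fun x => 1 - χ x) a.fn b.fn).symm,
    fun a b => CcAlg.ext (funext fun g => mul_sub _ _ _), fun a => ?_, ?_, fun a => ?_⟩
  · have := CcAlg.max_diag_le hcont zero_le_one hχ1 a
    rwa [one_mul] at this
  · exact (hsub j).trans (by rw [hχ, sub_self])
  · beta_reduce
    rw [hsub, sub_sub_cancel]
    exact CcAlg.diag_mem_supported hU χ hχU a

end Ideal

/-! ### Kernel and surjectivity of the restriction homomorphism -/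

section Kernel

variable {X : Set (UnitSpace G)} (hX : IsInvariant X)

/-- The distance of `f ∈ C_c(G)` to the functions supported off `G_X` is at most the C*-norm of the
restriction of `f` to `G_X`. -/
theorem exists_supported_near_of_restrict (hc : IsClosed X) (f : CcAlg G) {ε : ℝ} (hε : 0 < ε) :
    ∃ j ∈ CcAlg.supported {g : G | r g ∈ Xᶜ},
      ‖ofCc (f - j)‖ < ‖restrictHom hX hc (ofCc f)‖ + ε := by
  obtain ⟨q, hq, hq'⟩ := exists_quotient_supported hc.isOpen_compl hX.compl
  obtain ⟨q', h⟩ := q.exists_descend (restrictCc hX hc) (restrictCc_surjective hX hc)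
    (fun a ha => by
      refine le_antisymm (le_of_forall_pos_le_add fun δ hδ => ?_) (q.nonneg a)
      -- An element restricting to zero is at distance zero from the ideal, without necessarily
      -- belonging to it.
      obtain ⟨k, hk, hk'⟩ := exists_supported_near (hc.isOpen_compl.preimage continuous_r)
        (f := a) (fun g hg => by
          have hgX : r g ∈ X := not_not.1 hg
          exact congrArg (fun f => f.fn (Reduction.mk hX hc.isLocallyClosed g hgX)) ha) hδ
      rw [zero_add]
      exact (hq a k hk).trans hk'.le)
  obtain ⟨j, hj, hj'⟩ := hq' f ε hε
  refine ⟨j, hj, ?_⟩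
  rw [CStarSeminorm.norm_toCompl, restrictHom_ofCc, CStarSeminorm.norm_toCompl]
  refine hj'.trans_le (add_le_add_left ?_ ε)
  -- The descended seminorm is one of those over which the norm of `C*(G_X)` is the supremum.
  rw [← h]
  exact le_maxCStarSeminorm q' _

theorem continuous_restrictHom (hc : IsClosed X) : Continuous (restrictHom hX hc) :=
  (EnvelopingCStar.liftL _).continuous

theorem restrictHom_ofCc_eq_zero (hc : IsClosed X) {f : CcAlg G}
    (hf : f.fn ∈ Cc {g : G | r g ∉ X}) : restrictHom hX hc (ofCc f) = 0 := by
  have : restrictCc hX hc f = 0 := CcAlg.ext (funext fun g =>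
    eq_zero_of_mem_Cc hf (not_not.2 (Reduction.r_val_mem hX hc.isLocallyClosed g)))
  rw [restrictHom_ofCc, this, map_zero]

/-- For `a` in the kernel and `f ∈ C_c(G)` close to `a`, the restriction of `f` has norm at most `‖a
- f‖`, so `f` is almost as close to the ideal as to `a`. -/
theorem ker_restrictHom (hc : IsClosed X) :
    {a : FullCStar G | restrictHom hX hc a = 0} =
      closure (ofCc '' {f : CcAlg G | f.fn ∈ Cc {g : G | r g ∉ X}}) := by
  refine Set.Subset.antisymm (fun a ha => ?_) (closure_minimal ?_
    (isClosed_eq (continuous_restrictHom hX hc) continuous_const))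
  · rw [Metric.mem_closure_iff]
    intro ε hε
    obtain ⟨f, hf⟩ := (CStarSeminorm.denseRange_toCompl _).exists_dist_lt a
      (show (0 : ℝ) < ε / 3 by positivity)
    have h1 : ‖restrictHom hX hc (ofCc f)‖ ≤ ‖a - ofCc f‖ := by
      rw [← norm_neg, ← zero_sub, ← show restrictHom hX hc a = 0 from ha, ← map_sub]
      exact NonUnitalStarAlgHom.norm_apply_le (restrictHom hX hc) _
    obtain ⟨j, hj, hj'⟩ := exists_supported_near_of_restrict hX hc f
      (show (0 : ℝ) < ε / 3 by positivity)
    refine ⟨ofCc j, ⟨j, hj, rfl⟩, ?_⟩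
    rw [dist_eq_norm] at hf ⊢
    have h2 : a - ofCc j = (a - ofCc f) + ofCc (f - j) := by
      rw [map_sub]
      abel
    rw [h2]
    refine (norm_add_le _ _).trans_lt ?_
    linarith
  · rintro _ ⟨f, hf, rfl⟩
    exact restrictHom_ofCc_eq_zero hX hc hf

/-- Elements of the dense image of `C_c(G_X)` lift with norm at most doubled. Completeness then
gives lifts of all elements, as in the proof of the open mapping theorem. -/
theorem restrictHom_surjective (hc : IsClosed X) : Function.Surjective (restrictHom hX hc) := by
  let φ : NormedAddGroupHom (FullCStar G) (FullCStar (Reduction X hX hc.isLocallyClosed)) :=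
    { toFun := restrictHom hX hc
      map_add' := map_add _
      bound' := ⟨1, fun a => by
        rw [one_mul]
        exact NonUnitalStarAlgHom.norm_apply_le (restrictHom hX hc) a⟩ }
  let K : AddSubgroup (FullCStar (Reduction X hX hc.isLocallyClosed)) :=
    AddMonoidHom.range (ofCc : CcAlg (Reduction X hX hc.isLocallyClosed) →⋆ₙₐ[ℂ] _).toAddMonoidHom
  have h : φ.SurjectiveOnWith K 2 := by
    rintro _ ⟨b, rfl⟩
    obtain ⟨f, rfl⟩ := restrictCc_surjective hX hc b
    change ∃ g, restrictHom hX hc g = ofCc (restrictCc hX hc f) ∧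
      ‖g‖ ≤ 2 * ‖ofCc (restrictCc hX hc f)‖
    rw [← restrictHom_ofCc]
    by_cases h0 : restrictHom hX hc (ofCc f) = 0
    · exact ⟨0, by rw [h0, map_zero], by rw [norm_zero, h0, norm_zero, mul_zero]⟩
    -- Taking the error equal to the norm of the restriction gives the factor 2. This requires a
    -- nonzero restriction; otherwise zero is a lift.
    · obtain ⟨j, hj, hj'⟩ := exists_supported_near_of_restrict hX hc f (norm_pos_iff.2 h0)
      refine ⟨ofCc (f - j), ?_, by linarith⟩
      rw [map_sub, map_sub, restrictHom_ofCc_eq_zero hX hc hj, sub_zero]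
  intro b
  obtain ⟨a, ha, -⟩ := controlled_closure_of_complete two_pos one_pos h b
    (CStarSeminorm.denseRange_toCompl _ b)
  exact ⟨a, ha⟩

end Kernel

end ArrowGroupoid

end

noncomputable section

namespace ArrowGroupoid

variable {G : Type*} [TopologicalSpace G] [ArrowGroupoid G] [IsLCEtaleGroupoid G]

/-! ### Injectivity for open reductions: the left multiplier action -/

section OpenReduction

variable {U : Set (UnitSpace G)} (hU : IsInvariant U) (ho : IsOpen U)

/-- The compact supports lie inside the image of the open embedding, so their preimages are compact.
This would fail for an arbitrary `f ∈ C_c(G)`. -/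
theorem comp_val_mem_Cc_of_supported {f : G → ℂ} (hf : f ∈ Cc {g : G | r g ∈ U}) :
    f ∘ Reduction.val hU ho.isLocallyClosed ∈
      Cc (Set.univ : Set (Reduction U hU ho.isLocallyClosed)) := by
  rw [Cc_eq_span] at hf
  induction hf using Submodule.span_induction with
  | mem f h =>
    obtain ⟨B, hB, hBU, hf⟩ := h
    have := hB.t2
    obtain ⟨hcont, K, hKB, hK, h0⟩ := mem_CcOn_iff.1 hf
    have he := isOpenEmbedding_val hU ho
    have hT : T2Space (Reduction.val hU ho.isLocallyClosed ⁻¹' B) :=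
      T2Space.of_injective_continuous (f := B.restrictPreimage (Reduction.val hU ho.isLocallyClosed))
        (he.injective.restrictPreimage _) he.continuous.restrictPreimage
    refine CcOn_le_Cc (Set.subset_univ _) (hB.isOpen.preimage he.continuous)
      (mem_CcOn_iff.2 ⟨hcont.comp he.continuous.continuousOn fun g hg => hg,
        Reduction.val hU ho.isLocallyClosed ⁻¹' K, Set.preimage_mono hKB,
        (he.isInducing.isCompact_preimage_iff fun g hg => ?_).2 hK, fun g hg => h0 _ hg⟩)
    exact ⟨Reduction.mk hU ho.isLocallyClosed g (hBU (hKB hg)), rfl⟩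
  | zero => exact Submodule.zero_mem _
  | add f₁ f₂ _ _ h₁ h₂ => exact Submodule.add_mem _ h₁ h₂
  | smul c f _ h => exact Submodule.smul_mem _ c h

theorem exists_extendCc_eq {f : CcAlg G} (hf : f.fn ∈ Cc {g : G | r g ∈ U}) :
    ∃ h, extendCc hU ho h = f :=
  ⟨.mk _ (comp_val_mem_Cc_of_supported hU ho hf), CcAlg.ext
    (Reduction.extendZero_unique hU ho.isLocallyClosed _ _ rfl fun _ hg => eq_zero_of_mem_Cc hf hg)⟩

theorem RFin.comp_val {G : Type*} [TopologicalSpace G] [ArrowGroupoid G] {U : Set (UnitSpace G)}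
    (hU : IsInvariant U) (hl : IsLocallyClosed U) {f : G → ℂ} (hf : RFin f) :
    RFin (f ∘ Reduction.val hU hl) := fun x => by
  refine ((hf (Reduction.unitVal hU hl x)).preimage
    (Reduction.val_injective hU hl).injOn).subset ?_
  rintro g ⟨hg, hg'⟩
  exact ⟨congrArg (Reduction.unitVal hU hl) hg, hg'⟩

/-- The restriction of `f` to `G_U` need not be in `C_c(G_U)`. The product with `h` is, because it
is the restriction of `f * h`, with `h` extended by zero, which lies in the ideal `C_c(r⁻¹(U))`. -/
theorem conv_comp_val_mem_Cc (f : CcAlg G) (h : CcAlg (Reduction U hU ho.isLocallyClosed)) :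
    conv (f.fn ∘ Reduction.val hU ho.isLocallyClosed) h.fn ∈
      Cc (Set.univ : Set (Reduction U hU ho.isLocallyClosed)) := by
  have h1 := CcAlg.mul_mem_supported_right ho hU f (f := extendCc hU ho h)
    (extendZero_mem_Cc hU ho h.fn_mem)
  have h2 := comp_val_mem_Cc_of_supported hU ho h1
  rw [CcAlg.fn_mul, ← Reduction.conv_comp_val] at h2
  have h3 : (extendCc hU ho h).fn ∘ Reduction.val hU ho.isLocallyClosed = h.fn :=
    Reduction.extendZero_comp_val hU ho.isLocallyClosed h.fn
  rwa [h3] at h2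

/-- The action of `C_c(G)` by left multipliers on `C_c(G_U)`, for an open invariant set `U`. -/
def leftAction : CcAlg G →ₗ[ℂ] CcAlg (Reduction U hU ho.isLocallyClosed) →ₗ[ℂ]
    CcAlg (Reduction U hU ho.isLocallyClosed) :=
  LinearMap.mk₂ ℂ (fun f h => .mk _ (conv_comp_val_mem_Cc hU ho f h))
    (fun f₁ f₂ _ => CcAlg.ext (add_conv (f₁.rFin.comp_val hU _) (f₂.rFin.comp_val hU _)))
    (fun c f h => CcAlg.ext (smul_conv c (f.fn ∘ Reduction.val hU ho.isLocallyClosed) h.fn))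
    (fun f _ _ => CcAlg.ext (conv_add (f.rFin.comp_val hU _)))
    (fun c f h => CcAlg.ext (conv_smul c (f.fn ∘ Reduction.val hU ho.isLocallyClosed) h.fn))

theorem fn_leftAction (f : CcAlg G) (h : CcAlg (Reduction U hU ho.isLocallyClosed)) :
    (leftAction hU ho f h).fn = conv (f.fn ∘ Reduction.val hU ho.isLocallyClosed) h.fn := rfl

theorem leftAction_mul (f₁ f₂ : CcAlg G) (h : CcAlg (Reduction U hU ho.isLocallyClosed)) :
    leftAction hU ho (f₁ * f₂) h = leftAction hU ho f₁ (leftAction hU ho f₂ h) := by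
  refine CcAlg.ext ?_
  rw [fn_leftAction, CcAlg.fn_mul, ← Reduction.conv_comp_val,
    conv_assoc (f₁.rFin.comp_val hU _) (f₂.rFin.comp_val hU _)]
  rfl

/-- The action of `star f` is the adjoint of that of `f` for the algebra-valued inner product `h*
k`. -/
theorem star_leftAction_mul (f : CcAlg G) (h k : CcAlg (Reduction U hU ho.isLocallyClosed)) :
    star (leftAction hU ho f h) * k = star h * leftAction hU ho (star f) k := by
  refine CcAlg.ext ?_
  rw [CcAlg.fn_mul, CcAlg.fn_star, fn_leftAction, invol_conv, ← CcAlg.fn_star h,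
    Reduction.invol_comp_val, ← CcAlg.fn_star f,
    conv_assoc (star h).rFin ((star f).rFin.comp_val hU _)]
  rfl

theorem leftAction_extendCc (h k : CcAlg (Reduction U hU ho.isLocallyClosed)) :
    leftAction hU ho (extendCc hU ho h) k = h * k := by
  refine CcAlg.ext ?_
  rw [fn_leftAction, CcAlg.fn_mul]
  exact congrArg (conv · k.fn) (Reduction.extendZero_comp_val hU ho.isLocallyClosed h.fn)

/-- Here `(f b)* (f b) = b* (f* f) b`, and `f* f` is a function on the unit space with values in
`[0, M²]`. With `χ = √(M² - f* f)` the complement of this element in `M² b* b` is `(χ b)* (χ b)`. -/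
theorem leftAction_le_of_mem_CcOn {B : Set G} (hB : IsOpenBisection B) {f : CcAlg G}
    (hf : f.fn ∈ CcOn B) {M : ℝ} (hM : 0 ≤ M) (h : ∀ g, ‖f.fn g‖ ≤ M)
    (b : CcAlg (Reduction U hU ho.isLocallyClosed)) :
    maxCStarSeminorm _ (leftAction hU ho f b) ≤ M * maxCStarSeminorm _ b := by
  obtain ⟨φ, hφ⟩ := star_mul_self_mem hB hf
  let φ' : C_c(UnitSpace G, ℂ) := φ
  have hφ' : (star f * f).fn = extendUnits φ' := hφ
  have hval : ∀ x, ∃ t : ℝ, 0 ≤ t ∧ t ≤ M ^ 2 ∧ φ' x = t := fun x => by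
    obtain ⟨t, ht0, htM, ht⟩ := exists_conv_invol_self_eq hB.injOn_s
      (fun g hg => eq_zero_of_mem_CcOn hf hg) h x
    refine ⟨t, ht0, htM, ?_⟩
    rw [← ht, ← extendUnits_coe φ' x]
    exact (congrFun hφ' x).symm
  let u : UnitSpace (Reduction U hU ho.isLocallyClosed) → UnitSpace G :=
    Reduction.unitVal hU ho.isLocallyClosed
  have hu : Continuous u := (Reduction.isEmbedding_unitVal hU ho.isLocallyClosed).continuous
  -- An arrow of the reduction is a unit exactly when it is a unit of `G`, so `f* f` still acts as a
  -- diagonal multiplier on `C_c(G_U)`.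
  have hres : (star f * f).fn ∘ Reduction.val hU ho.isLocallyClosed = extendUnits (φ' ∘ u) := by
    funext g
    rw [hφ', Function.comp_apply]
    by_cases hg : src g = g
    · exact (extendUnits_coe φ' (u ⟨g, hg⟩)).trans (extendUnits_coe (φ' ∘ u) ⟨g, hg⟩).symm
    · rw [extendUnits_of_not _ hg, extendUnits_of_not]
      exact fun e => hg (Reduction.ext_val hU ho.isLocallyClosed e)
  let χ : UnitSpace (Reduction U hU ho.isLocallyClosed) → ℂ := fun x =>
    ((√(M ^ 2 - (φ' (u x)).re) : ℝ) : ℂ)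
  have hχ : Continuous χ := by
    have : Continuous fun x => φ' (u x) := φ'.continuous.comp hu
    fun_prop
  refine CStarSeminorm.le_mul_of_star_mul_self_add _ (c := b.diag χ hχ) hM ?_
  rw [star_leftAction_mul, ← leftAction_mul]
  refine CcAlg.ext ?_
  change conv (invol b.fn) (leftAction hU ho (star f * f) b).fn +
    conv (invol (diagMul χ b.fn)) (diagMul χ b.fn) = ((M ^ 2 : ℝ) : ℂ) • conv (invol b.fn) b.fn
  rw [fn_leftAction, hres, conv_extendUnits_left, conv_invol_diagMul,
    ← conv_add (f₁ := invol b.fn) (star b).rFin, ← conv_smul]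
  congr 1
  funext g
  obtain ⟨t, ht0, htM, ht⟩ := hval (u (r g))
  simp only [diagMul, Pi.add_apply, Pi.mul_apply, Pi.star_apply, Pi.smul_apply, smul_eq_mul,
    ← add_mul, χ, Function.comp_apply, ht]
  congr 1
  rw [Complex.star_def, Complex.conj_ofReal, ← Complex.ofReal_mul, Complex.ofReal_re,
    Real.mul_self_sqrt (sub_nonneg.2 htM)]
  push_cast
  ring

theorem exists_leftAction_le (f : CcAlg G) :
    ∃ C, ∀ b, maxCStarSeminorm _ (leftAction hU ho f b) ≤ C * maxCStarSeminorm _ b := by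
  obtain ⟨n, B, F, hB, hF, rfl⟩ := f.exists_eq_sum
  refine Finset.sum_induction F (fun f => ∃ C, ∀ b,
    maxCStarSeminorm _ (leftAction hU ho f b) ≤ C * maxCStarSeminorm _ b) ?_ ?_ ?_
  · rintro f₁ f₂ ⟨C₁, h₁⟩ ⟨C₂, h₂⟩
    refine ⟨C₁ + C₂, fun b => ?_⟩
    rw [map_add, LinearMap.add_apply, add_mul]
    exact (map_add_le_add (maxCStarSeminorm _).toSeminorm _ _).trans (add_le_add (h₁ b) (h₂ b))
  · refine ⟨0, fun b => ?_⟩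
    rw [map_zero, LinearMap.zero_apply, zero_mul]
    exact (map_zero (maxCStarSeminorm _).toSeminorm).le
  · intro i _
    have := (hB i).t2
    obtain ⟨hc, K, hKB, hK, h0⟩ := mem_CcOn_iff.1 (hF i)
    obtain ⟨M, hM⟩ := hK.exists_bound_of_continuousOn (hc.mono hKB)
    refine ⟨max M 0, leftAction_le_of_mem_CcOn hU ho (hB i) (hF i) (le_max_right _ _) fun g => ?_⟩
    by_cases hg : g ∈ K
    · exact (hM g hg).trans (le_max_left _ _)
    · rw [h0 g hg, norm_zero]
      exact le_max_right _ _

/-- The operator norm `q` of the left action is a C*-seminorm on all of `C_c(G)`, hence at most the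
norm of `C*(G)`. On `h ∈ C_c(G_U)` it dominates the full norm: acting on `h*` gives `‖h‖² = ‖h h*‖ ≤
q(h) ‖h‖`. -/
theorem norm_le_norm_extendHom (a : FullCStar (Reduction U hU ho.isLocallyClosed)) :
    ‖a‖ ≤ ‖extendHom hU ho a‖ := by
  have hcont : Continuous (extendHom hU ho) := (EnvelopingCStar.liftL _).continuous
  obtain ⟨q, hq⟩ := (maxCStarSeminorm (CcAlg (Reduction U hU ho.isLocallyClosed))).exists_of_action
    (leftAction hU ho) (leftAction_mul hU ho)
    (fun f b => by rw [star_leftAction_mul, leftAction_mul]) (exists_leftAction_le hU ho)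
  refine (CStarSeminorm.denseRange_toCompl _).induction_on a
    (isClosed_le continuous_norm hcont.norm) fun h => ?_
  rw [extendHom_ofCc, CStarSeminorm.norm_toCompl, CStarSeminorm.norm_toCompl]
  refine le_trans ?_ (le_maxCStarSeminorm q _)
  have h1 := hq (extendCc hU ho h) (star h)
  rw [leftAction_extendCc] at h1
  have h2 := (maxCStarSeminorm (CcAlg (Reduction U hU ho.isLocallyClosed))).star_mul_self (star h)
  rw [star_star] at h2
  rw [h2, CStarSeminorm.star_eq] at h1
  have h3 := (maxCStarSeminorm (CcAlg (Reduction U hU ho.isLocallyClosed))).nonneg h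
  by_contra! hn
  nlinarith [q.nonneg (extendCc hU ho h)]

theorem extendHom_injective : Function.Injective (extendHom hU ho) := by
  rw [injective_iff_map_eq_zero]
  intro a ha
  have := norm_le_norm_extendHom hU ho a
  rwa [ha, norm_zero, norm_le_zero_iff] at this

/-- An injective *-homomorphism of C*-algebras is isometric, so its range is closed, and it is the
closure of the image of the dense subalgebra `C_c(G_U)`. -/
theorem range_extendHom :
    Set.range (extendHom hU ho) =
      closure (ofCc '' {f : CcAlg G | f.fn ∈ Cc {g : G | r g ∈ U}}) := by
  have hiso : Isometry (extendHom hU ho) :=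
    NonUnitalStarAlgHom.isometry (extendHom hU ho) (extendHom_injective hU ho)
  refine Set.Subset.antisymm ?_ (closure_minimal ?_ hiso.isClosedEmbedding.isClosed_range)
  · rintro _ ⟨a, rfl⟩
    refine map_mem_closure hiso.continuous (CStarSeminorm.denseRange_toCompl _ a) ?_
    rintro _ ⟨h, rfl⟩
    exact ⟨extendCc hU ho h, extendZero_mem_Cc hU ho h.fn_mem, (extendHom_ofCc hU ho h).symm⟩
  · rintro _ ⟨f, hf, rfl⟩
    obtain ⟨h, rfl⟩ := exists_extendCc_eq hU ho hf
    exact ⟨ofCc h, extendHom_ofCc hU ho h⟩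

end OpenReduction

/-! ### The ideal generated by functions on the unit space -/

section Ideal

variable {U : Set (UnitSpace G)}

theorem norm_ofCZeroUnits_le (φ : C₀(UnitSpace G, ℂ)) : ‖ofCZeroUnits φ‖ ≤ ‖φ‖ :=
  NonUnitalStarAlgHom.norm_apply_le ofCZeroUnits φ

theorem ofCZeroUnits_ccToCZero (χ : C_c(UnitSpace G, ℂ)) :
    ofCZeroUnits (ccToCZero χ) = ofCc (unitsHom χ) := extendCZero_apply _ χ

theorem unitsHom_mul (χ : C_c(UnitSpace G, ℂ)) (f : CcAlg G) :
    unitsHom χ * f = f.diag χ χ.continuous := CcAlg.ext (conv_extendUnits_left χ f.fn)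

/-- Writing `χ = κ χ` with a second bump `κ` supported in `U` exhibits `χ` as the result of a
diagonal multiplication. -/
theorem unitsHom_mem_supported (hU : IsOpen U) {χ : C_c(UnitSpace G, ℂ)} (hχ : tsupport χ ⊆ U) :
    unitsHom χ ∈ CcAlg.supported {g : G | r g ∈ U} := by
  obtain ⟨κ, hκ1, hκU, -⟩ := exists_bump_of_isCompact χ.hasCompactSupport.isCompact hU hχ
  have : χ = κ * χ := by
    ext x
    change χ x = κ x * χ x
    by_cases hx : x ∈ tsupport χ
    · rw [hκ1 hx, Pi.one_apply, one_mul]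
    · rw [image_eq_zero_of_notMem_tsupport hx, mul_zero]
  rw [this, map_mul, unitsHom_mul]
  exact CcAlg.diag_mem_supported hU κ hκU _

/-- A function in `C₀(Y)` vanishing off an open set `U` is approximated by functions in
`C_c(U)`. -/
theorem _root_.exists_ccToCZero_near {Y : Type*} [TopologicalSpace Y] [T2Space Y] {U : Set Y}
    (φ : C₀(Y, ℂ)) (hφ : ∀ y ∉ U, φ y = 0) {ε : ℝ} (hε : 0 < ε) :
    ∃ χ : C_c(Y, ℂ), tsupport χ ⊆ U ∧ ‖φ - ccToCZero χ‖ ≤ ε := by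
  obtain ⟨K, hK, hKφ⟩ := Filter.mem_cocompact.1
    (φ.zero_at_infty'.eventually (Metric.ball_mem_nhds (0 : ℂ) hε))
  have hcl : IsClosed {y | ε ≤ ‖φ y‖} := isClosed_le continuous_const φ.continuous.norm
  have hcomp : IsCompact {y | ε ≤ ‖φ y‖} := hK.of_isClosed_subset hcl fun y hy => by
    by_contra hn
    have h1 : φ y ∈ Metric.ball 0 ε := hKφ hn
    rw [mem_ball_zero_iff] at h1
    exact h1.not_ge hy
  have h0 : ∀ y ∉ {y | ε ≤ ‖φ y‖}, φ y - radialRetraction ε (φ y) = 0 := fun y hy => by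
    rw [radialRetraction_eq hε (not_le.1 hy).le, sub_self]
  let χ : C_c(Y, ℂ) := ⟨⟨fun y => φ y - radialRetraction ε (φ y),
    φ.continuous.sub ((continuous_radialRetraction hε).comp φ.continuous)⟩,
    HasCompactSupport.intro hcomp h0⟩
  refine ⟨χ, (closure_minimal (fun y hy => ?_) hcl).trans fun y (hy : ε ≤ ‖φ y‖) => ?_,
    norm_le_of_bound _ hε.le fun y => ?_⟩
  · by_contra hn
    exact hy (h0 y hn)
  · by_contra hn
    rw [hφ y hn, norm_zero] at hy
    exact hε.not_ge hy
  · change ‖φ y - (φ y - radialRetraction ε (φ y))‖ ≤ ε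
    rw [sub_sub_cancel]
    exact norm_radialRetraction_le hε _

theorem closure_supported_eq_closedIdealSpan (hU : IsOpen U) (hX : IsInvariant U) :
    closure (ofCc '' {f : CcAlg G | f.fn ∈ Cc {g : G | r g ∈ U}}) =
      (closedIdealSpan (ofCZeroUnits '' {φ : C₀(UnitSpace G, ℂ) | ∀ x ∉ U, φ x = 0}) :
        Set (FullCStar G)) := by
  have hdense := CStarSeminorm.denseRange_toCompl (maxCStarSeminorm (CcAlg G))
  refine Set.Subset.antisymm (closure_minimal ?_ ?_) ?_
  · rintro _ ⟨f, hf, rfl⟩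
    refine Submodule.mem_sInf.2 fun I ⟨_, hI, hmul⟩ => ?_
    obtain ⟨χ, hχU, -, hχ⟩ := CcAlg.exists_diag_eq_self hU hf
    -- The local unit exhibits `f = χ * f` with `χ` among the generators.
    rw [← hχ, ← unitsHom_mul, map_mul, ← ofCZeroUnits_ccToCZero]
    exact (hmul _ _ (hI ⟨ccToCZero χ, fun x hx =>
      image_eq_zero_of_notMem_tsupport fun h => hx (hχU h), rfl⟩)).2
  · rw [closedIdealSpan, Submodule.coe_sInf]
    exact isClosed_biInter fun I hI => hI.1
  · let I : Submodule ℂ (FullCStar G) := ((CcAlg.supported {g : G | r g ∈ U}).map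
      ((ofCc : CcAlg G →⋆ₙₐ[ℂ] FullCStar G) : CcAlg G →ₗ[ℂ] FullCStar G)).topologicalClosure
    have hI : closedIdealSpan
        (ofCZeroUnits '' {φ : C₀(UnitSpace G, ℂ) | ∀ x ∉ U, φ x = 0}) ≤ I := by
      -- The closure of the functions supported over `U` is itself a closed two-sided ideal
      -- containing the generators. The ideal property passes from `C_c(G)` to `C*(G)` by continuity
      -- in each factor.
      refine sInf_le ⟨Submodule.isClosed_topologicalClosure _, ?_, fun a b hb => ?_⟩
      · rintro _ ⟨φ, hφ, rfl⟩
        refine Metric.mem_closure_iff.2 fun ε hε => ?_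
        obtain ⟨χ, hχU, hχ⟩ := exists_ccToCZero_near φ hφ (half_pos hε)
        refine ⟨ofCc (unitsHom χ), ⟨unitsHom χ, unitsHom_mem_supported hU hχU, rfl⟩, ?_⟩
        rw [dist_eq_norm, ← ofCZeroUnits_ccToCZero, ← map_sub]
        exact ((norm_ofCZeroUnits_le _).trans hχ).trans_lt (half_lt_self hε)
      · have hIc : IsClosed (I : Set (FullCStar G)) := Submodule.isClosed_topologicalClosure _
        constructor
        · refine hdense.induction_on (p := fun a => a * b ∈ I) a
            (hIc.preimage (continuous_id.mul continuous_const)) fun f => ?_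
          refine map_mem_closure (continuous_const.mul continuous_id) hb ?_
          rintro _ ⟨j, hj, rfl⟩
          exact ⟨f * j, CcAlg.mul_mem_supported_right hU hX f hj, map_mul ofCc f j⟩
        · refine hdense.induction_on (p := fun a => b * a ∈ I) a
            (hIc.preimage (continuous_const.mul continuous_id)) fun f => ?_
          refine map_mem_closure (f := (· * ofCc f)) (continuous_id.mul continuous_const) hb ?_
          rintro _ ⟨j, hj, rfl⟩
          exact ⟨j * f, CcAlg.mul_mem_supported_left hU f hj, map_mul ofCc j f⟩
    exact hI

end Ideal

end ArrowGroupoid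

end

theorem proposition1p1 {G : Type*} [TopologicalSpace G] [ArrowGroupoid G] [IsLCEtaleGroupoid G]
    (X : Set (ArrowGroupoid.UnitSpace G)) (hc : IsClosed X) (hX : ArrowGroupoid.IsInvariant X) :
    {a : ArrowGroupoid.FullCStar G | ArrowGroupoid.restrictHom hX hc a = 0} =
        closure (ArrowGroupoid.ofCc ''
          {f : ArrowGroupoid.CcAlg G | f.fn ∈ Cc {g : G | ArrowGroupoid.r g ∉ X}}) ∧
      closure (ArrowGroupoid.ofCc ''
          {f : ArrowGroupoid.CcAlg G | f.fn ∈ Cc {g : G | ArrowGroupoid.r g ∉ X}}) =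
        (closedIdealSpan (ArrowGroupoid.ofCZeroUnits ''
            {φ : C₀(ArrowGroupoid.UnitSpace G, ℂ) | ∀ x ∈ X, φ x = 0}) :
          Set (ArrowGroupoid.FullCStar G)) ∧
      Function.Injective (ArrowGroupoid.extendHom hX.compl hc.isOpen_compl) ∧
      Set.range (ArrowGroupoid.extendHom hX.compl hc.isOpen_compl) =
        {a : ArrowGroupoid.FullCStar G | ArrowGroupoid.restrictHom hX hc a = 0} ∧
      Function.Surjective (ArrowGroupoid.restrictHom hX hc) := by
  refine ⟨ArrowGroupoid.ker_restrictHom hX hc, ?_,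
    ArrowGroupoid.extendHom_injective hX.compl hc.isOpen_compl, ?_,
    ArrowGroupoid.restrictHom_surjective hX hc⟩
  · have h := ArrowGroupoid.closure_supported_eq_closedIdealSpan hc.isOpen_compl hX.compl
    simp only [Set.mem_compl_iff, not_not] at h
    exact h
  · rw [ArrowGroupoid.ker_restrictHom hX hc]
    exact ArrowGroupoid.range_extendHom hX.compl hc.isOpen_compl
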